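/- **Theorem 8 (Convergence Rates of Derivatives).** *Setting.* Let $P_{\mathcal X}$ be a probability law on $\mathbb R^{d}$, $\boldsymbol X_n=(\mathcal X_1,\dots,\mathcal X_n)\sim P_{\mathcal X}^{n}$ and, independently, $\mathcal X_*\sim P_{\mathcal X}$. The noise variables $\Xi_*,\Xi_1,\dots,\Xi_n$ are i.i.d. with mean $0$ and variance $\sigma_\xi^2<\infty$, independent of everything else. Let $c:\mathbb R^d\times\mathbb R^d\to[0,\infty)$ be a continuous, symmetric, positive (semi)definite kernel with $c(x,x)=1$ which is a strictly decreasing function of $\|x-x'\|_2$ and satisfies $c(x,x')\ge 1-L_c\|x-x'\|_2^{2p}$ for some $L_c>0$, $0<p\le1$. Fix hyper-parameters $\hat\sigma_\xi^2>0$, $\hat\sigma_f^2>0$, $\hat\ell>0$, $\hat{\boldsymbol b}\in\mathbb R^{d_T}$. For $1\le m\le n$ let $\boldsymbol x_{n,1},\dots,\boldsymbol x_{n,m}$ be the $m$ nearest neighbours of $\boldsymbol x_*$ among the training points with respect to $\rho_c(x,x')=\sqrt{1-c(x/\hat\ell,x'/\hat\ell)}$ (ties broken by index), and put $[K]_{ij}=\hat\sigma_f^2c(\boldsymbol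 x_{n,i}/\hat\ell,\boldsymbol x_{n,j}/\hat\ell)+\hat\sigma_\xi^2\delta_{ij}$, $[\boldsymbol k^*]_j=\hat\sigma_f^2c(\boldsymbol x_*/\hat\ell,\boldsymbol x_{n,j}/\hat\ell)$, $\Gamma=\frac{\hat\sigma_\xi^2+m\hat\sigma_f^2}{m\hat\sigma_f^2}$; $\boldsymbol y_{\mathcal N}$ denotes the responses at the neighbours. * *GPnn.* $\mathcal Y=f(\mathcal X)+\Xi$, predictor $\tilde\mu=\Gamma\,\boldsymbol k^{*T}K^{-1}\boldsymbol y_{\mathcal N}$, where $|f|\le B_f$ and $|f(x)-f(x')|\le L_f\|x-x'\|_2^{q}$ with $B_f,L_f\ge1$, $0<q\le1$. Put $\alpha_\phi:=\min\{p,q\}$ for every $\phi\in\{\hat\sigma_\xi^2,\hat\sigma_f^2,\hat{\boldsymbol b}\}$. * *NNGP.* $\mathcal Y=\boldsymbol t(\mathcal X)^T\boldsymbol b+w(\mathcal X)+\Xi$ with $\boldsymbol t=(t_1,\dots,t_{d_T})$, $d_T\ge1$, predictor $\tilde\mu=\boldsymbol t(\boldsymbol x_*)^T\hat{\boldsymbol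 b}+\Gamma\,\boldsymbol k^{*T}K^{-1}(\boldsymbol y_{\mathcal N}-T_{\mathcal N}\hat{\boldsymbol b})$, where the rows of $T_{\mathcal N}$ are $\boldsymbol t(\boldsymbol x_{n,j})^T$; $|t_i|\le B_T$ and $|t_i(x)-t_i(x')|\le L_i\|x-x'\|_2^{q_i}$ with $L_i\ge1$, $0<q_i\le1$; $w$ is a mean-zero Gaussian process, independent of covariates and noise, with covariance $\tilde k$, $\tilde k(x,x)=\sigma_w^2>0$, and $\tilde c=\tilde k/\sigma_w^2$ satisfies $\tilde c(x,x')\ge1-L_{\tilde c}\|x-x'\|_2^{2q_0}$ with $L_{\tilde c},q_0>0$; the pseudometrics $\rho_c$ and $\rho_{\tilde c}=\sqrt{1-\tilde c}$ are equivalent (each is bounded by a constant multiple of the other). With $\overline q:=\min_i q_i$ put $\alpha_\phi:=\min\{p,q_0,\overline q\}$ for $\phi\in\{\hat\sigma_\xi^2,\hat\sigma_f^2\}$ and $\alpha_{\hat{\boldsymbol b}}:=\min\{2p,\overline q\}$. Let $MSE(\boldsymbol x_*,X_n)=\mathbb E[(\mathcal Y_*-\tilde\mu)^2\mid \mathcal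 X_*=\boldsymbol x_*,\boldsymbol X_n=X_n]$ be the expectation over the noise (and over $w$ for NNGP), and $D_\phi:=|\partial_\phi MSE|$ for $\phi\in\{\hat\sigma_\xi^2,\hat\sigma_f^2\}$, $D_{\hat{\boldsymbol b}}:=\|\nabla_{\hat{\boldsymbol b}}MSE\|_2$ (which is $0$ for GPnn). *Claim.* Let $\phi\in\{\hat\sigma_\xi^2,\hat\sigma_f^2,\hat{\boldsymbol b}\}$, $d>4(\alpha_\phi+p)$, and suppose $\mathbb E\|\mathcal X\|_2^\beta\le M<\infty$ for some $\beta>\frac{4d(p+\alpha_\phi)}{d-4(p+\alpha_\phi)}$. Then for GPnn, and likewise for NNGP, the derivative defining $D_\phi$ exists at all design points, $D_\phi(\mathcal X_*,\boldsymbol X_n)$ is integrable, and there are $0<A_1^{(\phi)},A_2^{(\phi)}<\infty$ such that for all $1\le m\le n$ $$\mathbb E\left[D_\phi(\mathcal X_*,\boldsymbol X_n)\right]\le A_1^{(\phi)}\Big(\frac mn\Big)^{2\alpha_\phi/d}+A_2^{(\phi)}\,m\Big(\frac mn\Big)^{2(\alpha_\phi+p)/d},$$ and, for $m=m_n=\lfloor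 n^{2p/(2p+d)}\rfloor$, $$\mathbb E\left[D_\phi(\mathcal X_*,\boldsymbol X_n)\right]\le\big(A_1^{(\phi)}+A_2^{(\phi)}\big)\,n^{-\frac{2\alpha_\phi}{2p+d}}.$$ The constants depend only on $\phi$, $d$, $p$, $L_c$, $\sigma_\xi^2$, $\beta$, $M$, the hyper-parameters $\hat\sigma_\xi^2,\hat\sigma_f^2,\hat\ell,\hat{\boldsymbol b}$ and $d_T$, and on $q,B_f,L_f$ (GPnn), respectively on $q_0,\{q_i\},\{L_i\},B_T,L_{\tilde c},\sigma_w^2,\boldsymbol b$ (NNGP); in particular they do not depend on $m$ and $n$. -/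

import Mathlib

open MeasureTheory ProbabilityTheory

noncomputable section

namespace GPNN

/-- Covariate space: `ℝ^d` with the Euclidean norm. -/
abbrev Pt (d : ℕ) := EuclideanSpace ℝ (Fin d)

/-! ### Hyper-parameters -/

/-- The hyper-parameters of the estimators: noise variance `σ̂_ξ²`, kernel scale `σ̂_f²`,
lengthscale `ℓ̂` and regression coefficients `b̂` (the latter enter only in NNGP). -/
structure HyperParams (dT : ℕ) where
  noiseVar : ℝ
  scale : ℝ
  lengthscale : ℝ
  coef : EuclideanSpace ℝ (Fin dT)

structure HyperParams.Admissible {dT : ℕ} (h : HyperParams dT) : Prop where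
  noiseVar_pos : 0 < h.noiseVar
  scale_pos : 0 < h.scale
  lengthscale_pos : 0 < h.lengthscale

/-- The hyper-parameters with respect to which we differentiate. -/
inductive Param
  | noiseVar
  | scale
  | coef

/-! ### Kernel metric and nearest neighbours -/

/-- The kernel-induced (pseudo)metric `ρ_c(x, y) = √(1 - c(x/ℓ, y/ℓ))`. -/
def kernelDist {d : ℕ} (c : Pt d → Pt d → ℝ) (l : ℝ) (x y : Pt d) : ℝ :=
  Real.sqrt (1 - c (l⁻¹ • x) (l⁻¹ • y))

/-- Index in `X` of the `j`-th nearest neighbour of `xs`: the sample is sorted increasingly with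
respect to the kernel-induced distance from `xs` (ties are broken by the smaller index). -/
def nnIndex {d n m : ℕ} (c : Pt d → Pt d → ℝ) (l : ℝ) (hmn : m ≤ n)
    (xs : Pt d) (X : Fin n → Pt d) (j : Fin m) : Fin n :=
  Tuple.sort (fun i => kernelDist c l xs (X i)) (Fin.castLE hmn j)

/-! ### The estimators -/

section Estimators

variable {d dT n m : ℕ}

/-- The shifted Gram matrix `K_𝒩` of the points `Z`. -/
def gram (c : Pt d → Pt d → ℝ) (h : HyperParams dT) (Z : Fin m → Pt d) :
    Matrix (Fin m) (Fin m) ℝ :=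
  Matrix.of fun i j =>
    h.scale * c (h.lengthscale⁻¹ • Z i) (h.lengthscale⁻¹ • Z j)
      + (if i = j then h.noiseVar else 0)

/-- The vector `k_𝒩^*`. -/
def kStar (c : Pt d → Pt d → ℝ) (h : HyperParams dT) (xs : Pt d) (Z : Fin m → Pt d) :
    Fin m → ℝ :=
  fun j => h.scale * c (h.lengthscale⁻¹ • xs) (h.lengthscale⁻¹ • Z j)

/-- The bias correction factor `Γ = (σ̂_ξ² + m σ̂_f²) / (m σ̂_f²)`. -/
def gammaFactor (m : ℕ) (h : HyperParams dT) : ℝ :=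
  (h.noiseVar + m * h.scale) / (m * h.scale)

/-- `Γ k_𝒩^*ᵀ K_𝒩⁻¹ z_𝒩`, for a vector `z` of values at the sample points `X`. -/
def localPredict (c : Pt d → Pt d → ℝ) (hmn : m ≤ n) (h : HyperParams dT)
    (xs : Pt d) (X : Fin n → Pt d) (z : Fin n → ℝ) : ℝ :=
  gammaFactor m h *
    (kStar c h xs (fun j => X (nnIndex c h.lengthscale hmn xs X j)) ⬝ᵥ
      ((gram c h (fun j => X (nnIndex c h.lengthscale hmn xs X j)))⁻¹).mulVec
        (fun j => z (nnIndex c h.lengthscale hmn xs X j)))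

/-- The GPnn predictive mean at `xs`, given covariates `X` and responses `y`. -/
def muGPnn (c : Pt d → Pt d → ℝ) (hmn : m ≤ n) (h : HyperParams dT)
    (xs : Pt d) (X : Fin n → Pt d) (y : Fin n → ℝ) : ℝ :=
  localPredict c hmn h xs X y

/-- The NNGP predictive mean at `xs`, given covariates `X` and responses `y`. -/
def muNNGP (c : Pt d → Pt d → ℝ) (t : Pt d → EuclideanSpace ℝ (Fin dT)) (hmn : m ≤ n)
    (h : HyperParams dT) (xs : Pt d) (X : Fin n → Pt d) (y : Fin n → ℝ) : ℝ :=
  t xs ⬝ᵥ h.coef + localPredict c hmn h xs X (fun i => y i - t (X i) ⬝ᵥ h.coef)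

/-! ### Mean squared error given the covariates -/

/-- The joint law of the noise at the test point and at the `n` training points (i.i.d.). -/
def noiseLaw (Pξ : Measure ℝ) (n : ℕ) : Measure (ℝ × (Fin n → ℝ)) :=
  Pξ.prod (Measure.pi fun _ => Pξ)

/-- `MSE` of GPnn at test point `xs` and training covariates `X`: expectation over the noise. -/
def mseGPnn (c : Pt d → Pt d → ℝ) (f : Pt d → ℝ) (Pξ : Measure ℝ) (hmn : m ≤ n)
    (h : HyperParams dT) (xs : Pt d) (X : Fin n → Pt d) : ℝ :=
  ∫ ξ, ((f xs + ξ.1) - muGPnn c hmn h xs X (fun i => f (X i) + ξ.2 i)) ^ 2 ∂(noiseLaw Pξ n)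

/-- `MSE` of NNGP at test point `xs` and training covariates `X`: expectation over the random
field `w` on `(Ω, Q)` and over the noise, which is independent of `w`. -/
def mseNNGP {Ω : Type*} [MeasurableSpace Ω] (Q : Measure Ω) (w : Pt d → Ω → ℝ)
    (c : Pt d → Pt d → ℝ) (t : Pt d → EuclideanSpace ℝ (Fin dT))
    (b : EuclideanSpace ℝ (Fin dT)) (Pξ : Measure ℝ) (hmn : m ≤ n)
    (h : HyperParams dT) (xs : Pt d) (X : Fin n → Pt d) : ℝ :=
  ∫ z, ((t xs ⬝ᵥ b + w xs z.1 + z.2.1)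
      - muNNGP c t hmn h xs X (fun i => t (X i) ⬝ᵥ b + w (X i) z.1 + z.2.2 i)) ^ 2
    ∂(Q.prod (noiseLaw Pξ n))

end Estimators

/-! ### Derivatives in the hyper-parameters -/

/-- `|∂_φ F|` at `h` for the scalar hyper-parameters, and `‖∇_{b̂} F‖₂` for the coefficients. -/
def absDeriv {dT : ℕ} (F : HyperParams dT → ℝ) (h : HyperParams dT) : Param → ℝ
  | .noiseVar => |deriv (fun s => F { h with noiseVar := s }) h.noiseVar|
  | .scale => |deriv (fun s => F { h with scale := s }) h.scale|
  | .coef => ‖gradient (fun b => F { h with coef := b }) h.coef‖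

/-- `F` is differentiable at `h` in the hyper-parameter `φ`. -/
def HasParamDeriv {dT : ℕ} (F : HyperParams dT → ℝ) (h : HyperParams dT) : Param → Prop
  | .noiseVar => DifferentiableAt ℝ (fun s => F { h with noiseVar := s }) h.noiseVar
  | .scale => DifferentiableAt ℝ (fun s => F { h with scale := s }) h.scale
  | .coef => DifferentiableAt ℝ (fun b => F { h with coef := b }) h.coef

/-! ### Assumptions -/

/-- The normalised regression kernel: continuous, symmetric, positive (semi)definite, nonnegative,
isotropic and strictly decreasing in the distance, with `c(r) ≥ 1 - L_c r^{2p}`. -/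
structure RegressionKernel {d : ℕ} (c : Pt d → Pt d → ℝ) (p Lc : ℝ) : Prop where
  continuous : Continuous fun z : Pt d × Pt d => c z.1 z.2
  posSemidef : ∀ (k : ℕ) (Z : Fin k → Pt d), (Matrix.of fun i j => c (Z i) (Z j)).PosSemidef
  diag : ∀ x, c x x = 1
  nonneg : ∀ x y, 0 ≤ c x y
  isotropic : ∃ c₀ : ℝ → ℝ, StrictAntiOn c₀ (Set.Ici 0) ∧ ∀ x y, c x y = c₀ ‖x - y‖
  lower : ∀ x y, 1 - Lc * ‖x - y‖ ^ (2 * p) ≤ c x y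

/-- `g` is bounded by `B` and `q`-Hölder with constant `L`. -/
def BoundedHolder {d : ℕ} (g : Pt d → ℝ) (B L q : ℝ) : Prop :=
  (∀ x, |g x| ≤ B) ∧ ∀ x y, |g x - g y| ≤ L * ‖x - y‖ ^ q

/-- The covariate law has finite `β`-th absolute moment, at most `M`. -/
def MomentBound {d : ℕ} (PX : Measure (Pt d)) (β M : ℝ) : Prop :=
  Integrable (fun x => ‖x‖ ^ β) PX ∧ ∫ x, ‖x‖ ^ β ∂PX ≤ M

/-- Centred noise with variance `σ2`. -/
structure CentredNoise (Pξ : Measure ℝ) (σ2 : ℝ) : Prop where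
  memLp : MemLp (fun x : ℝ => x) 2 Pξ
  mean : ∫ x, x ∂Pξ = 0
  variance : ∫ x, x ^ 2 ∂Pξ = σ2

/-- `w` is a mean-zero Gaussian process with covariance function `k`, where `k(x,x) = σw2`. The
normalised covariance `k / σw2` is bounded below by `1 - L ‖x - y‖^{2 q0}`, and its kernel metric is
equivalent to the kernel metric of `c` with lengthscale `l`. -/
structure RandomField {d : ℕ} {Ω : Type*} [MeasurableSpace Ω] (Q : Measure Ω)
    (w : Pt d → Ω → ℝ) (k : Pt d → Pt d → ℝ) (c : Pt d → Pt d → ℝ) (l σw2 L q0 : ℝ) : Prop where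
  gaussian : IsGaussianProcess w Q
  mean : ∀ x, ∫ ω, w x ω ∂Q = 0
  cov : ∀ x y, covariance (w x) (w y) Q = k x y
  diag : ∀ x, k x x = σw2
  lower : ∀ x y, 1 - L * ‖x - y‖ ^ (2 * q0) ≤ k x y / σw2
  equiv : ∃ a b : ℝ, 0 < a ∧ a ≤ b ∧ ∀ x y,
    a * kernelDist c l x y ≤ kernelDist (fun u v => k u v / σw2) 1 x y ∧
      kernelDist (fun u v => k u v / σw2) 1 x y ≤ b * kernelDist c l x y

/-! ### Rates -/

/-- The exponent `α_φ` for GPnn. -/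
def alphaGPnn (p q : ℝ) : ℝ := min p q

/-- The exponent `α_φ` for NNGP (with at least one regressor). -/
def alphaNNGP {dT : ℕ} (p q0 : ℝ) (q : Fin dT → ℝ) : Param → ℝ
  | .noiseVar => min p (min q0 (⨅ i, q i))
  | .scale => min p (min q0 (⨅ i, q i))
  | .coef => min (2 * p) (⨅ i, q i)

/-- The dimension condition `d > 4(α + p)` and the condition on the moment order
`β > 4d(p + α) / (d - 4(p + α))`. -/
def RateCondition (d : ℕ) (p α β : ℝ) : Prop :=
  4 * (α + p) < d ∧ 4 * d * (p + α) / (d - 4 * (p + α)) < β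

/-- The derivative of `mse` in `φ` at `h` exists at all design points, `D_φ` is integrable, its
expectation over the test and training covariates is at most
`A₁ (m/n)^{2α/d} + A₂ m (m/n)^{2(α+p)/d}`, and it is at most `(A₁ + A₂) n^{-2α/(2p+d)}` when
`m` is (the integer part of) `n^{2p/(2p+d)}`. -/
def DerivativeRate {d dT : ℕ} (PX : Measure (Pt d)) (m n : ℕ)
    (mse : HyperParams dT → Pt d → (Fin n → Pt d) → ℝ) (h : HyperParams dT) (φ : Param)
    (p α A₁ A₂ : ℝ) : Prop :=
  let D : Pt d × (Fin n → Pt d) → ℝ := fun z => absDeriv (fun h' => mse h' z.1 z.2) h φ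
  let P : Measure (Pt d × (Fin n → Pt d)) := PX.prod (Measure.pi fun _ => PX)
  (∀ xs X, HasParamDeriv (fun h' => mse h' xs X) h φ) ∧
  Integrable D P ∧
  ∫ z, D z ∂P ≤ A₁ * ((m : ℝ) / n) ^ (2 * α / d) + A₂ * m * ((m : ℝ) / n) ^ (2 * (α + p) / d) ∧
  (m = ⌊(n : ℝ) ^ (2 * p / (2 * p + d))⌋₊ →
    ∫ z, D z ∂P ≤ (A₁ + A₂) * (n : ℝ) ^ (-(2 * α / (2 * p + d))))

end GPNN

end

/-! For fixed covariates the predictor is linear in the neighbour responses, with weights `v`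
solving `s v + F C v = ((s + mF)/m) a`. Here `s` and `F` are the noise variance and the scale, `C`
holds the kernel correlations among the neighbours, and `a` those with the test point. If all
correlations equal one, the uniform weights `1/m` are an exact solution; this is the effect of `Γ`.
The proof is a perturbation argument around that case, in the parameter `ε` bounding `1 - a_i`.

Both `v - 1/m` and the derivative `v'` of `v` in `s` solve the same system with small right-hand
sides. `NearConstant.smallWeights` bounds each of them by `√ε` and by `√m ε` in Euclidean norm,
bounds its coordinate sum by `ε (1 + √(mε))`, and bounds `v ⬝ᵥ v'` by `ε`. The bound `√ε`, uniform
in `m`, comes from positive semidefiniteness of the correlation matrix enlarged by the test point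
(`NearConstant.energy_bound`); the bound on the sum comes from symmetry of the system.

Integrating out the noise and the field gives `MSE = ‖ψ x* - ∑ v_j ψ(z_j)‖² + σ² (1 + |v|²)`, where
`ψ = f` for GPnn and `ψ` takes values in `L²` of the field for NNGP. Cauchy–Schwarz bounds the
`s`-derivative by a multiple of `(1 + mε)(Bε + η)² + ε`, where `η` bounds the increments of `ψ`
(`RegressionKernel.abs_noiseDeriv_le`). The weights depend only on `s/F`, so the derivative in `F`
is a multiple of the one in `s`. In the regression coefficients the NNGP error is the square of an
affine function plus a constant, and its gradient is at most quadratic in the prediction residual of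
the regressors; the noise term `ε` is absent there, which allows the larger exponent.

With `δ` the distance to the `m`-th neighbour and `y = min 1 δ`, one has `ε ≲ y^{2p}` and `η ≲ y^γ`,
so every derivative is at most a constant times `y^{2α} + m y^{2(α+p)}`. Finally
`exists_nn_moment_bound` gives `E y^r ≲ (m/n)^{r/d}` by a covering of a large ball with cubes, and
`exists_derivativeRate_of_bound` combines the two. -/

noncomputable section

namespace GPNN

/-! ### Euclidean norm of coordinate vectors -/

section LinearAlgebra

variable {m : ℕ}

/-- The Euclidean norm of a coordinate vector. -/
def l2 (x : Fin m → ℝ) : ℝ := ‖WithLp.toLp 2 x‖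

lemma l2_nonneg (x : Fin m → ℝ) : 0 ≤ l2 x := norm_nonneg _

lemma l2_sq (x : Fin m → ℝ) : l2 x ^ 2 = x ⬝ᵥ x := by
  rw [l2, EuclideanSpace.norm_sq_eq]
  simp [dotProduct, sq]

lemma abs_dotProduct_le (x y : Fin m → ℝ) : |x ⬝ᵥ y| ≤ l2 x * l2 y := by
  have := abs_real_inner_le_norm (WithLp.toLp 2 y) (WithLp.toLp 2 x)
  rw [EuclideanSpace.inner_toLp_toLp] at this
  simpa [l2, mul_comm] using this

lemma l2_add_le (x y : Fin m → ℝ) : l2 (x + y) ≤ l2 x + l2 y := by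
  simpa [l2] using norm_add_le (WithLp.toLp 2 x) (WithLp.toLp 2 y)

lemma l2_smul (r : ℝ) (x : Fin m → ℝ) : l2 (r • x) = |r| * l2 x := by
  simp [l2, norm_smul]

lemma l2_neg (x : Fin m → ℝ) : l2 (-x) = l2 x := by
  simp [l2]

lemma l2_le_of_abs_le {x : Fin m → ℝ} {R : ℝ} (hx : ∀ i, |x i| ≤ R) (hR : 0 ≤ R) :
    l2 x ≤ √m * R := by
  have h1 : l2 x ^ 2 ≤ (√m * R) ^ 2 := by
    rw [l2_sq, mul_pow, Real.sq_sqrt (Nat.cast_nonneg m)]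
    calc x ⬝ᵥ x ≤ ∑ _i : Fin m, R ^ 2 := by
          refine Finset.sum_le_sum fun i _ => ?_
          rw [← sq, ← sq_abs]
          exact pow_le_pow_left₀ (abs_nonneg _) (hx i) 2
      _ = m * R ^ 2 := by simp
  exact (le_abs_self _).trans (abs_le_of_sq_le_sq h1 (by positivity))

lemma sum_abs_le_sqrt_mul_l2 (x : Fin m → ℝ) : ∑ i, |x i| ≤ √m * l2 x := by
  have h := abs_dotProduct_le (fun i => |x i|) 1
  have h1 : l2 (1 : Fin m → ℝ) ≤ √m * 1 := l2_le_of_abs_le (by simp) zero_le_one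
  have h2 : l2 (fun i => |x i|) = l2 x := by
    simp [l2, EuclideanSpace.norm_eq]
  rw [h2, dotProduct_one] at h
  calc ∑ i, |x i| ≤ l2 x * l2 (1 : Fin m → ℝ) := (le_abs_self _).trans h
    _ ≤ l2 x * (√m * 1) := mul_le_mul_of_nonneg_left h1 (l2_nonneg _)
    _ = _ := by ring

/-! ### Perturbation of the kernel weights around the uniform weights -/

/-- `C` is a normalised Gram matrix and `a` the vector of kernel values at the test point, all
close to one. -/
structure NearConstant (C : Matrix (Fin m) (Fin m) ℝ) (a : Fin m → ℝ) (ε : ℝ) : Prop where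
  symm : C.transpose = C
  psd : ∀ x, 0 ≤ x ⬝ᵥ C.mulVec x
  cross : ∀ x, 2 * (x ⬝ᵥ a) ≤ 1 + x ⬝ᵥ C.mulVec x
  gram_le : ∀ i j, C i j ≤ 1
  le_gram : ∀ i j, 1 - 4 * ε ≤ C i j
  star_le : ∀ i, a i ≤ 1
  le_star : ∀ i, 1 - ε ≤ a i

/-- Smallness of a perturbation `x` of the weights. -/
structure SmallWeights (x : Fin m → ℝ) (K ε : ℝ) : Prop where
  l2_le_sqrt : l2 x ≤ K * √ε
  l2_le : l2 x ≤ K * (√m * ε)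
  sum_le : |x ⬝ᵥ 1| ≤ K * (ε * (1 + √m * √ε))

/-- Uniform weights. -/
def unif (m : ℕ) : Fin m → ℝ := fun _ => (m : ℝ)⁻¹

variable {C : Matrix (Fin m) (Fin m) ℝ} {a : Fin m → ℝ} {ε s F : ℝ}

lemma NearConstant.dot_symm (h : NearConstant C a ε) (x y : Fin m → ℝ) :
    x ⬝ᵥ C.mulVec y = y ⬝ᵥ C.mulVec x := by
  rw [Matrix.dotProduct_mulVec, dotProduct_comm, ← Matrix.mulVec_transpose, h.symm]

/-- Pairing the system with `x` leaves `s |x|²` after the nonnegative quadratic form of `C` is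
dropped; Cauchy–Schwarz does the rest. -/
lemma NearConstant.coercive (h : NearConstant C a ε) (hF : 0 < F) {x y : Fin m → ℝ}
    (hxy : s • x + F • C.mulVec x = y) : s * l2 x ≤ l2 y := by
  rcases (l2_nonneg x).eq_or_lt with h0 | h0
  · rw [← h0, mul_zero]; exact l2_nonneg _
  have h1 : x ⬝ᵥ y = s * l2 x ^ 2 + F * (x ⬝ᵥ C.mulVec x) := by
    rw [← hxy, l2_sq]; simp [dotProduct_add]
  have h2 := (le_abs_self _).trans (abs_dotProduct_le x y)
  have h3 := mul_nonneg hF.le (h.psd x)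
  have : l2 x * (s * l2 x) ≤ l2 x * l2 y := by nlinarith
  exact le_of_mul_le_mul_left this h0

variable (hm : 1 ≤ m)
include hm

lemma l2_unif : l2 (unif m) = (√m)⁻¹ := by
  have h0 : (0 : ℝ) < m := by positivity
  have : l2 (unif m) ^ 2 = ((√m)⁻¹) ^ 2 := by
    rw [l2_sq, inv_pow, Real.sq_sqrt h0.le]
    simp [unif, dotProduct]
    field_simp
  exact (pow_left_inj₀ (l2_nonneg _) (by positivity) two_ne_zero).1 this

lemma NearConstant.mulVec_unif_mem (h : NearConstant C a ε) (i : Fin m) :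
    1 - 4 * ε ≤ C.mulVec (unif m) i ∧ C.mulVec (unif m) i ≤ 1 := by
  have h0 : (0 : ℝ) < m := by positivity
  have h1 : ∀ r : ℝ, r = ∑ _j : Fin m, r * (m : ℝ)⁻¹ := fun r => by
    simp; field_simp
  constructor
  · rw [h1 (1 - 4 * ε)]
    exact Finset.sum_le_sum fun j _ =>
      mul_le_mul_of_nonneg_right (h.le_gram i j) (inv_nonneg.2 h0.le)
  · refine le_trans ?_ (h1 1).ge
    change ∑ j, C i j * (m : ℝ)⁻¹ ≤ _
    exact Finset.sum_le_sum fun j _ =>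
      mul_le_mul_of_nonneg_right (h.gram_le i j) (inv_nonneg.2 h0.le)

/-- Convex averages of numbers in an interval stay there. -/
lemma unif_dot_mem {y : Fin m → ℝ} {l r : ℝ} (h : ∀ i, l ≤ y i ∧ y i ≤ r) :
    l ≤ unif m ⬝ᵥ y ∧ unif m ⬝ᵥ y ≤ r := by
  have h0 : (0 : ℝ) < m := by positivity
  have h1 : ∀ r : ℝ, r = ∑ _j : Fin m, (m : ℝ)⁻¹ * r := fun r => by
    simp; field_simp
  constructor
  · rw [h1 l]
    exact Finset.sum_le_sum fun j _ => mul_le_mul_of_nonneg_left (h j).1 (inv_nonneg.2 h0.le)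
  · rw [h1 r]
    exact Finset.sum_le_sum fun j _ => mul_le_mul_of_nonneg_left (h j).2 (inv_nonneg.2 h0.le)

/-- The residual of the uniform weights in the linear system is of order `ε`. -/
theorem NearConstant.residual_bound (h : NearConstant C a ε) (hs : 0 < s) (hF : 0 < F)
    (hε : 0 ≤ ε) (i : Fin m) :
    |(-(s / m) • (1 - a) + F • (a - C.mulVec (unif m))) i| ≤ (s + 4 * F) * ε := by
  have h0 : (1 : ℝ) ≤ m := by exact_mod_cast hm
  obtain ⟨h1, h2⟩ := h.mulVec_unif_mem hm i
  have h3 := h.star_le i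
  have h4 := h.le_star i
  have h5 : |a i - C.mulVec (unif m) i| ≤ 4 * ε := abs_le.2 ⟨by linarith, by linarith⟩
  have h6 : |1 - a i| ≤ ε := abs_le.2 ⟨by linarith, by linarith⟩
  have h7 : s / m ≤ s := div_le_self hs.le h0
  calc |(-(s / m) • (1 - a) + F • (a - C.mulVec (unif m))) i|
      = |-(s / m * (1 - a i)) + F * (a i - C.mulVec (unif m) i)| := by simp
    _ ≤ |s / m * (1 - a i)| + |F * (a i - C.mulVec (unif m) i)| := by
        refine (abs_add_le _ _).trans ?_
        rw [abs_neg]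
    _ = s / m * |1 - a i| + F * |a i - C.mulVec (unif m) i| := by
        rw [abs_mul, abs_mul, abs_of_pos hF, abs_of_nonneg (by positivity)]
    _ ≤ s * ε + F * (4 * ε) := by gcongr
    _ = _ := by ring

/-- Coercivity alone would cost a factor `√m`. Here the pairing of `z` with `a - C u`, `u` uniform,
is instead bounded by `ε` plus half of the energy `z ⬝ᵥ C z`, which the left side absorbs; the
result is uniform in `m`. -/
theorem NearConstant.energy_bound (h : NearConstant C a ε) (hs : 0 < s) (hF : 0 < F)
    (hε : 0 ≤ ε) (hε1 : ε ≤ 1) {z : Fin m → ℝ}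
    (hz : s • z + F • C.mulVec z = -(s / m) • (1 - a) + F • (a - C.mulVec (unif m))) :
    l2 z ≤ (1 + 4 * F / s) * √ε := by
  have h0 : (1 : ℝ) ≤ m := by exact_mod_cast hm
  have e1 : s * l2 z ^ 2 + F * (z ⬝ᵥ C.mulVec z)
      = -(s / m) * (z ⬝ᵥ (1 - a)) + F * (z ⬝ᵥ a - z ⬝ᵥ C.mulVec (unif m)) := by
    have := congrArg (fun y => z ⬝ᵥ y) hz
    simp only [dotProduct_add, dotProduct_smul, smul_eq_mul, dotProduct_sub] at this
    rw [l2_sq, dotProduct_sub]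
    linarith
  -- At `u + z` this reads `2 z·(a - C u) ≤ 1 + u·C u - 2 u·a + z·C z`, and the first three terms on
  -- the right sum to at most `2ε` by `e3` and `e4`.
  have e2 := h.cross (unif m + z)
  rw [Matrix.mulVec_add, add_dotProduct, add_dotProduct, dotProduct_add, dotProduct_add,
    h.dot_symm (unif m) z] at e2
  have e3 := (unif_dot_mem hm (y := a) fun i => ⟨h.le_star i, h.star_le i⟩).1
  have e4 := (unif_dot_mem hm (y := C.mulVec (unif m)) fun i => h.mulVec_unif_mem hm i).2
  have hl : l2 (1 - a) ≤ √m * ε := l2_le_of_abs_le (fun i => abs_le.2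
    ⟨by have := h.star_le i; simp only [Pi.sub_apply, Pi.one_apply]; linarith,
     by have := h.le_star i; simp only [Pi.sub_apply, Pi.one_apply]; linarith⟩) hε
  have e5 : -(s / m) * (z ⬝ᵥ (1 - a)) ≤ s * (l2 z * ε) := by
    have h1 : |z ⬝ᵥ (1 - a)| ≤ l2 z * (√m * ε) :=
      (abs_dotProduct_le _ _).trans (mul_le_mul_of_nonneg_left hl (l2_nonneg _))
    have h2 : √m ≤ m := by
      rw [Real.sqrt_le_left (by positivity)]; nlinarith
    calc -(s / m) * (z ⬝ᵥ (1 - a)) ≤ s / m * |z ⬝ᵥ (1 - a)| := by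
          have := neg_abs_le (z ⬝ᵥ (1 - a))
          have h3 : 0 ≤ s / m := by positivity
          nlinarith
      _ ≤ s / m * (l2 z * (m * ε)) := by
          refine mul_le_mul_of_nonneg_left (h1.trans ?_) (by positivity)
          gcongr
          exact l2_nonneg _
      _ = s * (l2 z * ε) := by field_simp
  have e6 := h.psd z
  -- The inequality `|z| ε ≤ (|z|² + ε²)/2` moves half of `s |z|²` to the left, and `ε² ≤ ε`.
  have e7 : s * l2 z ^ 2 ≤ s * ((1 + 2 * F / s) * ε) := by
    have : s * ((1 + 2 * F / s) * ε) = s * ε + 2 * F * ε := by field_simp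
    rw [this]
    have h8 : s * (l2 z * ε) ≤ s * ((l2 z ^ 2 + ε ^ 2) / 2) :=
      mul_le_mul_of_nonneg_left (by nlinarith [sq_nonneg (l2 z - ε)]) hs.le
    have h9 : s * ε ^ 2 ≤ s * ε := mul_le_mul_of_nonneg_left (by nlinarith) hs.le
    have h10 : F * (z ⬝ᵥ a - z ⬝ᵥ C.mulVec (unif m)) ≤ F * (ε + (z ⬝ᵥ C.mulVec z) / 2) :=
      mul_le_mul_of_nonneg_left (by linarith) hF.le
    have h11 := mul_nonneg hF.le e6
    nlinarith
  have e8 := le_of_mul_le_mul_left e7 hs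
  have hfs : 0 ≤ F / s := by positivity
  have hQ : 0 ≤ 1 + 4 * F / s := by positivity
  refine (le_abs_self _).trans (abs_le_of_sq_le_sq (e8.trans ?_) (by positivity))
  rw [mul_pow, Real.sq_sqrt hε]
  refine mul_le_mul_of_nonneg_right ?_ hε
  rw [mul_div_assoc, mul_div_assoc]
  nlinarith

/-- Deviation of the weights `v` from uniform, and smallness of the derivative `v'`
of the weights in the noise variance. -/
theorem NearConstant.smallWeights (h : NearConstant C a ε) (hs : 0 < s) (hF : 0 < F)
    (hε : 0 ≤ ε) (hε1 : ε ≤ 1) {v v' : Fin m → ℝ}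
    (hv : s • v + F • C.mulVec v = ((s + m * F) / m) • a)
    (hv' : s • v' + F • C.mulVec v' = -(v - (m : ℝ)⁻¹ • a)) :
    let K := 4 * (1 + 4 * F / s) ^ 2 * (1 + s / F + 1 / s + 1 / F)
    SmallWeights (v - unif m) K ε ∧ SmallWeights v' K ε ∧ |v ⬝ᵥ v'| ≤ K * ε := by
  intro K
  have h0 : (1 : ℝ) ≤ m := by exact_mod_cast hm
  have hsm : 0 < √(m : ℝ) := by positivity
  have hsm1 : 1 ≤ √(m : ℝ) := Real.one_le_sqrt.2 h0
  have hsmsq : √(m : ℝ) * √m = m := Real.mul_self_sqrt (by positivity)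
  have hse : 0 ≤ √ε := Real.sqrt_nonneg _
  have hsesq : √ε * √ε = ε := Real.mul_self_sqrt hε
  set Q := 1 + 4 * F / s with hQ
  have hQ1 : 1 ≤ Q := by rw [hQ]; have : 0 ≤ 4 * F / s := by positivity
                         linarith
  have hsQ : s + 4 * F = s * Q := by rw [hQ]; field_simp
  have hs1 : 0 < s / F := by positivity
  have hs2 : 0 < 1 / s := by positivity
  have hs3 : 0 < 1 / F := by positivity
  -- Each constant met below is at most `4 Q²` times a partial sum of the last factor of `K`.
  have hK : ∀ t ≤ 1 + s / F + 1 / s + 1 / F, 4 * Q ^ 2 * t ≤ K := fun t ht =>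
    mul_le_mul_of_nonneg_left ht (by positivity)
  clear_value K
  set z := v - unif m with hzdef
  set r : Fin m → ℝ := -(s / m) • (1 - a) + F • (a - C.mulVec (unif m)) with hr
  have hz : s • z + F • C.mulVec z = r := by
    have : s • z + F • C.mulVec z
        = (s • v + F • C.mulVec v) - (s • unif m + F • C.mulVec (unif m)) := by
      rw [hzdef, Matrix.mulVec_sub]; module
    rw [this, hv, hr]
    ext i
    simp [unif]
    field_simp
    ring
  have hr1 : ∀ i, |r i| ≤ s * Q * ε := fun i => by
    have := h.residual_bound hm hs hF hε i
    rwa [hsQ] at this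
  have hrl : l2 r ≤ √m * (s * Q * ε) := l2_le_of_abs_le hr1 (by positivity)
  have hl : l2 (1 - a) ≤ √m * ε := l2_le_of_abs_le (fun i => abs_le.2
    ⟨by have := h.star_le i; simp only [Pi.sub_apply, Pi.one_apply]; linarith,
     by have := h.le_star i; simp only [Pi.sub_apply, Pi.one_apply]; linarith⟩) hε
  have hz1 : l2 z ≤ Q * √ε := h.energy_bound hm hs hF hε hε1 hz
  have hz2 : l2 z ≤ Q * (√m * ε) := by
    have := (h.coercive hF hz).trans hrl
    refine le_of_mul_le_mul_left (this.trans_eq ?_) hs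
    ring
  have hmF : m / (s + m * F) ≤ 1 / F := by
    rw [div_le_div_iff₀ (by positivity) hF]; nlinarith
  have hmF0 : 0 ≤ m / (s + m * F) := by positivity
  -- Duality: `v` solves the system with right side a multiple of `a`, so by symmetry `x ⬝ᵥ a` is a
  -- multiple of `y ⬝ᵥ v`.
  have ha : ∀ x y : Fin m → ℝ, s • x + F • C.mulVec x = y →
      x ⬝ᵥ a = m / (s + m * F) * (y ⬝ᵥ v) := by
    intro x y hxy
    have e1 : x ⬝ᵥ (((s + m * F) / m) • a) = y ⬝ᵥ v := by
      rw [← hv, ← hxy, dotProduct_add, add_dotProduct, dotProduct_smul, dotProduct_smul,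
        smul_dotProduct, smul_dotProduct, h.dot_symm, dotProduct_comm (C.mulVec x)]
    rw [← e1, dotProduct_smul, smul_eq_mul]
    field_simp
  have hone : ∀ x : Fin m → ℝ, x ⬝ᵥ 1 = x ⬝ᵥ a + x ⬝ᵥ (1 - a) := fun x => by
    rw [dotProduct_sub]; ring
  have hvz : v = unif m + z := by rw [hzdef]; abel
  have hunif : ∀ x : Fin m → ℝ, |x ⬝ᵥ unif m| ≤ l2 x / √m := fun x => by
    have := abs_dotProduct_le x (unif m)
    rwa [l2_unif hm, ← div_eq_mul_inv] at this
  -- Replacing `1` by `a + (1 - a)` makes the sum accessible to `ha`; a direct Cauchy–Schwarz bound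
  -- with the vector `1` would lose a factor.
  have hsum : ∀ x y : Fin m → ℝ, ∀ A B : ℝ, s • x + F • C.mulVec x = y → |y ⬝ᵥ v| ≤ A →
      l2 x ≤ B → |x ⬝ᵥ 1| ≤ A / F + B * (√m * ε) := by
    intro x y A B hxy hA hB
    rw [hone, ha x y hxy]
    have hA0 := (abs_nonneg _).trans hA
    have hB0 := (l2_nonneg _).trans hB
    refine (abs_add_le _ _).trans (add_le_add ?_ ?_)
    · rw [abs_mul, abs_of_nonneg hmF0]
      calc _ ≤ 1 / F * A := mul_le_mul hmF hA (abs_nonneg _) (by positivity)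
        _ = A / F := by ring
    · exact (abs_dotProduct_le _ _).trans (mul_le_mul hB hl (l2_nonneg _) hB0)
  have hrv : |r ⬝ᵥ v| ≤ s * Q * ε + √m * (s * Q * ε) * (Q * √ε) := by
    rw [hvz, dotProduct_add]
    refine (abs_add_le _ _).trans (add_le_add ?_ ?_)
    · refine (hunif r).trans ?_
      rw [div_le_iff₀ hsm]; linarith
    · exact (abs_dotProduct_le _ _).trans (mul_le_mul hrl hz1 (l2_nonneg _) (by positivity))
  have hzs := hsum z r _ _ hz hrv hz1
  -- Up to sign the right side of the system for `v'`; it equals `z + (1 - a)/m` and so inherits the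
  -- bounds on `z`.
  set w : Fin m → ℝ := v - (m : ℝ)⁻¹ • a with hw
  have hw0 : l2 w ≤ l2 z + ε / √m := by
    have : w = z + (m : ℝ)⁻¹ • (1 - a) := by
      ext i; simp [hw, hzdef, unif]; ring
    rw [this]
    refine (l2_add_le _ _).trans (add_le_add le_rfl ?_)
    rw [l2_smul, abs_of_nonneg (by positivity)]
    calc (m : ℝ)⁻¹ * l2 (1 - a) ≤ (m : ℝ)⁻¹ * (√m * ε) := by gcongr
      _ = ε / √m := by nth_rw 1 [← hsmsq]; field_simp
  have hεe : ε ≤ √ε := by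
    rw [Real.le_sqrt hε hε]; nlinarith
  have hed : ε / √m ≤ ε := div_le_self hε hsm1
  have hw1 : l2 w ≤ 2 * Q * √ε := by
    have : √ε ≤ Q * √ε := le_mul_of_one_le_left hse hQ1
    linarith
  have hw2 : l2 w ≤ 2 * Q * (√m * ε) := by
    have : ε ≤ Q * (√m * ε) := by
      calc ε = 1 * (1 * ε) := by ring
        _ ≤ Q * (√m * ε) := by gcongr
    linarith
  have hcv := h.coercive hF hv'
  rw [l2_neg] at hcv
  have hv1 : l2 v' ≤ 2 * Q / s * √ε := by
    refine le_of_mul_le_mul_left ((hcv.trans hw1).trans_eq ?_) hs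
    field_simp
  have hv2 : l2 v' ≤ 2 * Q / s * (√m * ε) := by
    refine le_of_mul_le_mul_left ((hcv.trans hw2).trans_eq ?_) hs
    field_simp
  -- Split `v = u + z`. Against `u`, of norm `1/√m`, the bound `√m ε` gives `ε`; against `z` the
  -- bound `√ε` is used twice.
  have hvmix : ∀ x : Fin m → ℝ, ∀ A : ℝ, 0 ≤ A → l2 x ≤ A * √ε → l2 x ≤ A * (√m * ε) →
      |x ⬝ᵥ v| ≤ A * (1 + Q) * ε := by
    intro x A hA h1 h2
    rw [hvz, dotProduct_add]
    have e1 : |x ⬝ᵥ unif m| ≤ A * ε := by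
      refine (hunif x).trans ?_
      rw [div_le_iff₀ hsm]; linarith
    have e2 : |x ⬝ᵥ z| ≤ A * Q * ε := by
      refine (abs_dotProduct_le _ _).trans ?_
      calc _ ≤ A * √ε * (Q * √ε) := mul_le_mul h1 hz1 (l2_nonneg _) (by positivity)
        _ = A * Q * (√ε * √ε) := by ring
        _ = _ := by rw [hsesq]
    refine (abs_add_le _ _).trans ?_
    linarith
  have hwv := hvmix w (2 * Q) (by positivity) hw1 hw2
  have hv'v := hvmix v' (2 * Q / s) (by positivity) hv1 hv2
  have hv's := hsum v' (-w) (2 * Q * (1 + Q) * ε) _ hv'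
    (by rwa [neg_dotProduct, abs_neg]) hv1
  have hQQ : Q ≤ Q ^ 2 := by clear * - hQ1; nlinarith
  have hK1 : Q ≤ K := by
    have := hK 1 (by linarith)
    linarith
  have hK2 : 2 * Q / s ≤ K := by
    have := hK (1 / s) (by linarith)
    have h2 : 2 * Q / s = 2 * Q * (1 / s) := by ring
    have h3 : 2 * Q * (1 / s) ≤ 4 * Q ^ 2 * (1 / s) :=
      mul_le_mul_of_nonneg_right (by linarith) hs2.le
    linarith
  have hX : 0 ≤ √m * √ε * ε := by positivity
  refine ⟨⟨?_, ?_, ?_⟩, ⟨?_, ?_, ?_⟩, ?_⟩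
  · exact hz1.trans (mul_le_mul_of_nonneg_right hK1 hse)
  · exact hz2.trans (mul_le_mul_of_nonneg_right hK1 (by positivity))
  · refine hzs.trans ?_
    have e : (s * Q * ε + √m * (s * Q * ε) * (Q * √ε)) / F + Q * √ε * (√m * ε)
        = (Q * (s / F)) * ε + (Q ^ 2 * (s / F) + Q) * (√m * √ε * ε) := by
      ring
    have e' : K * (ε * (1 + √m * √ε)) = K * ε + K * (√m * √ε * ε) := by ring
    have hk : 4 * Q ^ 2 * (s / F + 1) ≤ K :=
      hK _ (by linarith)
    rw [e, e']
    refine add_le_add (mul_le_mul_of_nonneg_right (le_trans ?_ hk) hε)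
      (mul_le_mul_of_nonneg_right (le_trans ?_ hk) hX) <;>
      clear * - hQ1 hQQ hs1 hs2 hs3 <;>
      nlinarith [mul_le_mul_of_nonneg_right hQQ hs1.le,
        mul_le_mul_of_nonneg_right hQQ hs2.le,
        mul_le_mul_of_nonneg_right hQQ hs3.le,
        mul_pos hs1 (sq_pos_of_pos (zero_lt_one.trans_le hQ1)),
        mul_pos hs2 (sq_pos_of_pos (zero_lt_one.trans_le hQ1)),
        mul_pos hs3 (sq_pos_of_pos (zero_lt_one.trans_le hQ1))]
  · exact hv1.trans (mul_le_mul_of_nonneg_right hK2 hse)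
  · exact hv2.trans (mul_le_mul_of_nonneg_right hK2 (by positivity))
  · refine hv's.trans ?_
    have e : 2 * Q * (1 + Q) * ε / F + 2 * Q / s * √ε * (√m * ε)
        = (2 * Q * (1 + Q) * (1 / F)) * ε + (2 * Q * (1 / s)) * (√m * √ε * ε) := by
      ring
    have e' : K * (ε * (1 + √m * √ε)) = K * ε + K * (√m * √ε * ε) := by ring
    have hk : 4 * Q ^ 2 * (1 / F + 1 / s) ≤ K :=
      hK _ (by linarith)
    rw [e, e']
    refine add_le_add (mul_le_mul_of_nonneg_right (le_trans ?_ hk) hε)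
      (mul_le_mul_of_nonneg_right (le_trans ?_ hk) hX) <;>
      clear * - hQ1 hQQ hs1 hs2 hs3 <;>
      nlinarith [mul_le_mul_of_nonneg_right hQQ hs1.le,
        mul_le_mul_of_nonneg_right hQQ hs2.le,
        mul_le_mul_of_nonneg_right hQQ hs3.le,
        mul_pos hs1 (sq_pos_of_pos (zero_lt_one.trans_le hQ1)),
        mul_pos hs2 (sq_pos_of_pos (zero_lt_one.trans_le hQ1)),
        mul_pos hs3 (sq_pos_of_pos (zero_lt_one.trans_le hQ1))]
  · rw [dotProduct_comm]
    refine hv'v.trans (mul_le_mul_of_nonneg_right ?_ hε)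
    have hk : 4 * Q ^ 2 * (1 / s) ≤ K :=
      hK _ (by linarith)
    refine le_trans ?_ hk
    have : 2 * Q / s * (1 + Q) = (2 * Q * (1 + Q)) * (1 / s) := by ring
    rw [this]
    exact mul_le_mul_of_nonneg_right (by linarith) hs2.le

end LinearAlgebra

/-! ### Moments of nearest neighbour distances -/

section Moments

/-- A weak-type tail bound of order `κ > r` gives a bound on the `r`-th moment. -/
theorem integral_rpow_le_of_tail {Ω : Type*} [MeasurableSpace Ω] {μ : Measure Ω}
    [IsProbabilityMeasure μ] {f : Ω → ℝ} (hf : Measurable f) (hf0 : ∀ ω, 0 ≤ f ω)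
    {r κ τ B : ℝ} (hr : 0 < r) (hκ : r < κ) (hτ : 0 < τ) (hB : 0 ≤ B)
    (htail : ∀ t, 0 < t → μ.real {ω | t < f ω} ≤ B * (τ / t) ^ κ) :
    ∫ ω, f ω ^ r ∂μ ≤ (1 + B * r / (κ - r)) * τ ^ r := by
  have hκr : 0 < κ - r := sub_pos.2 hκ
  rw [integral_eq_lintegral_of_nonneg_ae (ae_of_all _ fun ω => Real.rpow_nonneg (hf0 ω) r)
    (hf.pow_const r).aestronglyMeasurable,
    lintegral_rpow_eq_lintegral_meas_lt_mul μ (ae_of_all _ hf0) hf.aemeasurable hr]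
  refine ENNReal.toReal_le_of_le_ofReal (by positivity) ?_
  have hi1 : IntegrableOn (fun t : ℝ => t ^ (r - 1)) (Set.Ioc 0 τ) := by
    have := intervalIntegral.intervalIntegrable_rpow' (a := 0) (b := τ) (r := r - 1) (by linarith)
    rwa [intervalIntegrable_iff_integrableOn_Ioc_of_le hτ.le] at this
  have hi2 : IntegrableOn (fun t : ℝ => B * τ ^ κ * t ^ (r - 1 - κ)) (Set.Ioi τ) :=
    (integrableOn_Ioi_rpow_of_lt (by linarith) hτ).const_mul _
  -- Layer-cake formula, split at `τ`: below `τ` the tail is bounded by one, above it by the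
  -- hypothesis, and `r < κ` makes the second integral converge.
  have h1 : ∫⁻ t in Set.Ioc 0 τ, μ {a | t < f a} * ENNReal.ofReal (t ^ (r - 1))
      ≤ ENNReal.ofReal (τ ^ r / r) := by
    calc _ ≤ ∫⁻ t in Set.Ioc 0 τ, ENNReal.ofReal (t ^ (r - 1)) := by
          refine lintegral_mono fun t => ?_
          exact mul_le_of_le_one_left zero_le prob_le_one
      _ = ENNReal.ofReal (∫ t in Set.Ioc 0 τ, t ^ (r - 1)) := by
          rw [ofReal_integral_eq_lintegral_ofReal hi1]
          exact (ae_restrict_mem measurableSet_Ioc).mono fun t ht => Real.rpow_nonneg ht.1.le _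
      _ = ENNReal.ofReal (τ ^ r / r) := by
          rw [← intervalIntegral.integral_of_le hτ.le, integral_rpow (Or.inl (by linarith))]
          simp [Real.zero_rpow hr.ne']
  have h2 : ∫⁻ t in Set.Ioi τ, μ {a | t < f a} * ENNReal.ofReal (t ^ (r - 1))
      ≤ ENNReal.ofReal (B * τ ^ r / (κ - r)) := by
    calc _ ≤ ∫⁻ t in Set.Ioi τ, ENNReal.ofReal (B * τ ^ κ * t ^ (r - 1 - κ)) := by
          refine lintegral_mono_ae ((ae_restrict_mem measurableSet_Ioi).mono fun t ht => ?_)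
          have ht0 : 0 < t := hτ.trans ht
          rw [← ofReal_measureReal, ← ENNReal.ofReal_mul measureReal_nonneg]
          refine ENNReal.ofReal_le_ofReal ?_
          refine (mul_le_mul_of_nonneg_right (htail t ht0) (by positivity)).trans_eq ?_
          rw [Real.div_rpow hτ.le ht0.le, Real.rpow_sub ht0 (r - 1)]
          ring
      _ = ENNReal.ofReal (∫ t in Set.Ioi τ, B * τ ^ κ * t ^ (r - 1 - κ)) := by
          rw [ofReal_integral_eq_lintegral_ofReal hi2]
          exact (ae_restrict_mem measurableSet_Ioi).mono fun t ht => by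
            have ht0 : 0 < t := hτ.trans ht
            positivity
      _ = ENNReal.ofReal (B * τ ^ r / (κ - r)) := by
          rw [integral_const_mul, integral_Ioi_rpow_of_lt (by linarith) hτ]
          congr 1
          have e1 : r - 1 - κ + 1 = -(κ - r) := by ring
          have e2 : τ ^ r = τ ^ κ * τ ^ (-(κ - r)) := by
            rw [← Real.rpow_add hτ]; congr 1; ring
          rw [e1, e2, neg_div_neg_eq]
          ring
  rw [← Set.Ioc_union_Ioi_eq_Ioi hτ.le,
    lintegral_union measurableSet_Ioi (Set.Ioc_disjoint_Ioi le_rfl)]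
  calc _ ≤ ENNReal.ofReal r * (ENNReal.ofReal (τ ^ r / r)
        + ENNReal.ofReal (B * τ ^ r / (κ - r))) := by gcongr
    _ = ENNReal.ofReal ((1 + B * r / (κ - r)) * τ ^ r) := by
        rw [← ENNReal.ofReal_add (by positivity) (by positivity), ← ENNReal.ofReal_mul hr.le]
        congr 1
        field_simp

open Classical in
/-- A set of probability `q` receives fewer than `m` out of `n` sample points with probability at
most `4 m / (n q)`. -/
theorem measureReal_mul_few_points_le {E : Type*} [MeasurableSpace E] (P : Measure E)
    [IsProbabilityMeasure P] {A : Set E} (hA : MeasurableSet A) {m n : ℕ} (hm : 1 ≤ m)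
    (hn : 1 ≤ n) :
    P.real A * (Measure.pi fun _ : Fin n => P).real
      {X | (Finset.univ.filter fun i => X i ∈ A).card < m} ≤ 4 * (m / n : ℝ) := by
  have hm0 : (1 : ℝ) ≤ m := by exact_mod_cast hm
  have hn0 : (0 : ℝ) < n := by exact_mod_cast hn
  set q := P.real A with hq
  have hq0 : 0 ≤ q := measureReal_nonneg
  have hq1 : q ≤ 1 := measureReal_le_one
  set S := {X : Fin n → E | (Finset.univ.filter fun i => X i ∈ A).card < m} with hS
  set μ := (Measure.pi fun _ : Fin n => P) with hμ
  have hS1 : μ.real S ≤ 1 := measureReal_le_one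
  -- If the expected number of points is at most `4m`, the factor `q` alone is small enough.
  -- Otherwise a Chernoff bound applies.
  rcases le_or_gt (n * q) (4 * m) with hc | hc
  · calc q * μ.real S ≤ q * 1 := by gcongr
      _ ≤ 4 * (m / n : ℝ) := by
        rw [mul_one, ← mul_div_assoc, le_div_iff₀ hn0]; linarith
  -- The product of `g` over the sample is `2^{-N}` with `N` the number of points in `A`; its mean
  -- is `(1 - q/2)^n`, and Markov's inequality is applied at level `2^{-m}`.
  set g : E → ℝ := fun x => 1 - A.indicator (fun _ => (1 / 2 : ℝ)) x with hg
  have hgm : Measurable g := by fun_prop (disch := assumption)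
  have hg01 : ∀ x, 0 ≤ g x ∧ g x ≤ 1 := fun x => by
    by_cases hx : x ∈ A <;> (simp [hg, hx]; try norm_num)
  have hgi : ∫ x, g x ∂P = 1 - q / 2 := by
    rw [hg, integral_sub (integrable_const _) ((integrable_const _).indicator hA),
      integral_indicator_const _ hA]
    simp [hq]; ring
  have hprod : ∀ X : Fin n → E,
      ∏ i, g (X i) = (1 / 2 : ℝ) ^ (Finset.univ.filter fun i => X i ∈ A).card := fun X => by
    rw [← Finset.prod_const, Finset.prod_filter]
    refine Finset.prod_congr rfl fun i _ => ?_
    by_cases hx : X i ∈ A <;> simp [hg, hx]; norm_num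
  have hmk : (1 / 2 : ℝ) ^ m * μ.real S ≤ (1 - q / 2) ^ n := by
    have h1 := mul_meas_ge_le_integral_of_nonneg (μ := μ) (f := fun X => ∏ i, g (X i))
      (ae_of_all _ fun X => Finset.prod_nonneg fun i _ => (hg01 _).1) (by
        refine Integrable.of_bound (C := 1) ?_ (ae_of_all _ fun X => ?_)
        · exact (Finset.measurable_fun_prod _ fun i _ =>
            hgm.comp (measurable_pi_apply i)).aestronglyMeasurable
        · rw [Real.norm_of_nonneg (Finset.prod_nonneg fun i _ => (hg01 _).1)]
          exact Finset.prod_le_one (fun i _ => (hg01 _).1) fun i _ => (hg01 _).2)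
      ((1 / 2 : ℝ) ^ m)
    rw [hμ, integral_fintype_prod_eq_pow g, hgi, Fintype.card_fin] at h1
    refine le_trans (mul_le_mul_of_nonneg_left (measureReal_mono fun X hX => ?_) (by positivity)) h1
    simp only [Set.mem_ofPred_eq, hprod]
    exact pow_le_pow_of_le_one (by norm_num) (by norm_num) (le_of_lt hX)
  have hx : 0 < n * q / 4 := by nlinarith
  have hS2 : μ.real S ≤ Real.exp (-(n * q / 4)) := by
    have h1 : (1 - q / 2) ^ n ≤ Real.exp (-(n * q / 2)) := by
      calc (1 - q / 2) ^ n ≤ (Real.exp (-(q / 2))) ^ n := by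
            gcongr
            · linarith
            · exact Real.one_sub_le_exp_neg _
        _ = _ := by rw [← Real.exp_nat_mul]; congr 1; ring
    have h2 : (2 : ℝ) ^ m ≤ Real.exp (n * q / 4) := by
      calc (2 : ℝ) ^ m ≤ (Real.exp 1) ^ m := by
            gcongr
            have := Real.add_one_le_exp 1
            linarith
        _ = Real.exp m := by rw [← Real.exp_nat_mul, mul_one]
        _ ≤ _ := Real.exp_le_exp.2 (by linarith)
    calc μ.real S = 2 ^ m * ((1 / 2 : ℝ) ^ m * μ.real S) := by
          rw [← mul_assoc, ← mul_pow]; norm_num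
      _ ≤ Real.exp (n * q / 4) * Real.exp (-(n * q / 2)) :=
          mul_le_mul h2 (hmk.trans h1) (by positivity) (by positivity)
      _ = _ := by rw [← Real.exp_add]; congr 1; ring
  -- Exponential decay is traded for `1/(nq)` so that the factor `q` cancels and the bound does not
  -- depend on the cell.
  have h3 : Real.exp (-(n * q / 4)) ≤ (n * q / 4)⁻¹ := by
    rw [Real.exp_neg]
    exact inv_anti₀ hx (by linarith [Real.add_one_le_exp (n * q / 4)])
  have hqp : 0 < q := by
    rcases hq0.eq_or_lt with h | h
    · rw [← h] at hx; simp at hx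
    · exact h
  calc q * μ.real S ≤ q * (n * q / 4)⁻¹ := by gcongr; exact hS2.trans h3
    _ = 4 * (1 / n : ℝ) := by field_simp
    _ ≤ 4 * (m / n : ℝ) := by gcongr

/-- Closed axis-parallel cubes of side `s` in a grid with corner `(-R, …, -R)`. -/
def gridCell {d J : ℕ} (R s : ℝ) (k : Fin d → Fin J) : Set (Pt d) :=
  {x | ∀ i, -R + (k i : ℕ) * s ≤ x i ∧ x i ≤ -R + ((k i : ℕ) + 1) * s}

lemma measurableSet_gridCell {d J : ℕ} (R s : ℝ) (k : Fin d → Fin J) :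
    MeasurableSet (gridCell R s k) := by
  have : gridCell R s k = ⋂ i, {x : Pt d | -R + (k i : ℕ) * s ≤ x i}
      ∩ {x | x i ≤ -R + ((k i : ℕ) + 1) * s} := by
    ext x; simp [gridCell]
  rw [this]
  refine MeasurableSet.iInter fun i => MeasurableSet.inter ?_ ?_
  · exact measurableSet_le measurable_const (by fun_prop)
  · exact measurableSet_le (by fun_prop) measurable_const

lemma norm_sub_le_of_mem_gridCell {d J : ℕ} {R s : ℝ} (hs : 0 ≤ s) {k : Fin d → Fin J}
    {x y : Pt d} (hx : x ∈ gridCell R s k) (hy : y ∈ gridCell R s k) : ‖x - y‖ ≤ d * s := by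
  rw [EuclideanSpace.norm_eq]
  refine Real.sqrt_le_iff.2 ⟨by positivity, ?_⟩
  calc ∑ i, ‖(x - y) i‖ ^ 2 ≤ ∑ _i : Fin d, s ^ 2 := by
        refine Finset.sum_le_sum fun i _ => ?_
        rw [Real.norm_eq_abs]
        refine pow_le_pow_left₀ (abs_nonneg _) (abs_le.2 ?_) 2
        have h1 := hx i
        have h2 := hy i
        simp only [PiLp.sub_apply]
        constructor <;> linarith
    _ = d * s ^ 2 := by simp
    -- The crude diameter `d s` replaces `√d s`; only constants are affected.
    _ ≤ (d * s) ^ 2 := by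
        rw [mul_pow]
        refine mul_le_mul_of_nonneg_right ?_ (by positivity)
        have h : d ≤ d ^ 2 := Nat.le_self_pow two_ne_zero d
        exact_mod_cast h

lemma exists_mem_gridCell {d J : ℕ} {R s : ℝ} (hs : 0 < s) (hJ : 2 * R < J * s) {x : Pt d}
    (hx : ‖x‖ ≤ R) : ∃ k : Fin d → Fin J, x ∈ gridCell R s k := by
  have hxi : ∀ i, -R ≤ x i ∧ x i ≤ R := fun i => by
    have := (PiLp.norm_apply_le x i).trans hx
    rw [Real.norm_eq_abs] at this
    exact abs_le.1 this
  have h0 : ∀ i, 0 ≤ (x i + R) / s := fun i => div_nonneg (by linarith [(hxi i).1]) hs.le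
  refine ⟨fun i => ⟨⌊(x i + R) / s⌋₊, ?_⟩, fun i => ?_⟩
  -- The strict inequality in `hJ` keeps the index below `J` even when `x i = R`.
  · rw [Nat.floor_lt (h0 i), div_lt_iff₀ hs]
    linarith [(hxi i).2]
  · have h1 := Nat.floor_le (h0 i)
    have h2 := (Nat.lt_floor_add_one ((x i + R) / s)).le
    rw [le_div_iff₀ hs] at h1
    rw [div_le_iff₀ hs] at h2
    constructor <;> simp only <;> linarith

variable {d m n : ℕ}

open Classical in
/-- Tail of the distance to the `m`-th nearest neighbour. -/
theorem nn_tail_le (hd : 1 ≤ d) (PX : Measure (Pt d)) [IsProbabilityMeasure PX] {β M : ℝ}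
    (hβ : 0 < β) (hM : MomentBound PX β M) (hm : 1 ≤ m) (hn : 1 ≤ n)
    {δ : Pt d × (Fin n → Pt d) → ℝ}
    (hδ : ∀ z t, t < δ z → (Finset.univ.filter fun i => ‖z.1 - z.2 i‖ ≤ t).card < m)
    {R t : ℝ} (ht : 0 < t) (ht1 : t ≤ 1) (hR : 1 ≤ R) :
    (PX.prod (Measure.pi fun _ => PX)).real {z | t < δ z}
      ≤ M * R ^ (-β) + 4 * (m / n : ℝ) * ((2 * d + 1) * R / t) ^ d := by
  have hd0 : (1 : ℝ) ≤ d := by exact_mod_cast hd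
  have hR0 : 0 < R := by linarith
  -- Cells of side `t/d` have diameter at most `t`, so `m` sample points in the cell of the test
  -- point force the radius to be at most `t`.
  set s := t / d with hs
  have hs0 : 0 < s := by positivity
  set J := ⌊2 * R / s⌋₊ + 1 with hJ
  have hJ1 : 2 * R < J * s := by
    have := Nat.lt_floor_add_one (2 * R / s)
    rw [div_lt_iff₀ hs0] at this
    simpa [hJ] using this
  have hJ2 : (J : ℝ) ≤ (2 * d + 1) * R / t := by
    have h1 : (J : ℝ) ≤ 2 * R / s + 1 := by
      have := Nat.floor_le (a := 2 * R / s) (by positivity)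
      rw [hJ]; push_cast; linarith
    have h2 : 2 * R / s = 2 * d * R / t := by rw [hs]; field_simp
    have h3 : 1 ≤ R / t := by rw [le_div_iff₀ ht]; linarith
    calc (J : ℝ) ≤ 2 * d * R / t + R / t := by linarith
      _ = _ := by ring
  set π := (Measure.pi fun _ : Fin n => PX) with hπ
  -- Either the test point leaves the ball of radius `R`, which Markov's inequality controls, or it
  -- lies in a cell with fewer than `m` sample points; there are `J ^ d` cells.
  have hsub : {z | t < δ z} ⊆ ({x : Pt d | R < ‖x‖} ×ˢ Set.univ) ∪
      ⋃ k ∈ (Finset.univ : Finset (Fin d → Fin J)), gridCell R s k ×ˢ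
        {X | (Finset.univ.filter fun i => X i ∈ gridCell R s k).card < m} := by
    intro z hz
    by_cases hzR : R < ‖z.1‖
    · exact Or.inl ⟨hzR, trivial⟩
    · obtain ⟨k, hk⟩ := exists_mem_gridCell hs0 hJ1 (not_lt.1 hzR)
      refine Or.inr (Set.mem_biUnion (Finset.mem_coe.2 (Finset.mem_univ k)) ⟨hk, ?_⟩)
      refine lt_of_le_of_lt (Finset.card_le_card fun i hi => ?_) (hδ z t hz)
      simp only [Finset.mem_filter, Finset.mem_univ, true_and] at hi ⊢
      refine (norm_sub_le_of_mem_gridCell hs0.le hk hi).trans_eq ?_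
      rw [hs]; field_simp
  have h1 : (PX.prod π).real ({x : Pt d | R < ‖x‖} ×ˢ Set.univ) ≤ M * R ^ (-β) := by
    rw [measureReal_prod_prod, probReal_univ, mul_one, Real.rpow_neg hR0.le, ← div_eq_mul_inv,
      le_div_iff₀ (by positivity), mul_comm]
    have := mul_meas_ge_le_integral_of_nonneg (μ := PX) (f := fun x => ‖x‖ ^ β)
      (ae_of_all _ fun x => by positivity) hM.1 (R ^ β)
    refine le_trans (mul_le_mul_of_nonneg_left (measureReal_mono fun x hx => ?_) (by positivity))
      (this.trans hM.2)
    exact Real.rpow_le_rpow hR0.le (le_of_lt hx) hβ.le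
  have h2 : (PX.prod π).real (⋃ k ∈ (Finset.univ : Finset (Fin d → Fin J)), gridCell R s k ×ˢ
        {X | (Finset.univ.filter fun i => X i ∈ gridCell R s k).card < m})
      ≤ 4 * (m / n : ℝ) * ((2 * d + 1) * R / t) ^ d := by
    refine (measureReal_biUnion_finset_le _ _).trans ?_
    calc _ ≤ ∑ _k : Fin d → Fin J, 4 * (m / n : ℝ) := by
          refine Finset.sum_le_sum fun k _ => ?_
          rw [measureReal_prod_prod]
          exact measureReal_mul_few_points_le PX (measurableSet_gridCell R s k) hm hn
      _ = 4 * (m / n : ℝ) * (J : ℝ) ^ d := by simp; ring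
      _ ≤ _ := by gcongr
  exact (measureReal_mono hsub).trans ((measureReal_union_le _ _).trans (add_le_add h1 h2))

open Classical in
/-- Moments of the truncated distance to the `m`-th nearest neighbour. -/
theorem exists_nn_moment_bound (d : ℕ) {β M r : ℝ} (hr : 0 < r) (hrd : r < d)
    (hβ : d * r / (d - r) < β) :
    ∃ B : ℝ, 0 < B ∧ ∀ (PX : Measure (Pt d)) [IsProbabilityMeasure PX], MomentBound PX β M →
      ∀ m n : ℕ, 1 ≤ m → m ≤ n → ∀ δ : Pt d × (Fin n → Pt d) → ℝ, Measurable δ → (∀ z, 0 ≤ δ z) →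
        (∀ z t, t < δ z → (Finset.univ.filter fun i => ‖z.1 - z.2 i‖ ≤ t).card < m) →
        ∫ z, (min 1 (δ z)) ^ r ∂(PX.prod (Measure.pi fun _ => PX))
          ≤ B * ((m : ℝ) / n) ^ (r / d) := by
  have hd0 : (0 : ℝ) < d := hr.trans hrd
  have hd1 : 1 ≤ d := by exact_mod_cast hd0
  have hdr : 0 < d - r := sub_pos.2 hrd
  have hβ0 : 0 < β := lt_of_le_of_lt (by positivity) hβ
  -- The tail exponent left after optimising over `R`; `r < κ` is equivalent to the moment condition
  -- on `β`.
  set κ := d * β / (β + d) with hκ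
  have hκr : r < κ := by
    rw [hκ, lt_div_iff₀ (by positivity)]
    rw [div_lt_iff₀ hdr] at hβ
    nlinarith
  set A := |M| + 4 * (2 * d + 1) ^ d + 1 with hA
  have hA1 : 1 ≤ A := by
    have : 0 ≤ 4 * (2 * (d : ℝ) + 1) ^ d := by positivity
    have := abs_nonneg M
    rw [hA]; linarith
  refine ⟨1 + A * r / (κ - r), ?_, ?_⟩
  · have := sub_pos.2 hκr
    positivity
  intro PX _ hM m n hm hmn δ hδm hδ0 hδ
  have hn : 1 ≤ n := hm.trans hmn
  have hn0 : (0 : ℝ) < n := by exact_mod_cast hn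
  have hm0 : (0 : ℝ) < m := by exact_mod_cast hm
  set a : ℝ := m / n with ha
  have ha0 : 0 < a := by positivity
  set τ := a ^ (1 / d : ℝ) with hτ
  have hτ0 : 0 < τ := by positivity
  have hτd : τ ^ (d : ℝ) = a := by
    rw [hτ, ← Real.rpow_mul ha0.le, one_div_mul_cancel hd0.ne', Real.rpow_one]
  have hτr : τ ^ r = a ^ (r / d) := by
    rw [hτ, ← Real.rpow_mul ha0.le]; congr 1; ring
  rw [← hτr]
  refine integral_rpow_le_of_tail (measurable_const.min hδm)
    (fun z => le_min zero_le_one (hδ0 z)) hr hκr hτ0 (by linarith) fun t ht => ?_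
  rcases le_or_gt 1 t with ht1 | ht1
  · have : {z | t < min 1 (δ z)} = ∅ := by
      ext z; simp only [Set.mem_ofPred_eq, lt_min_iff, Set.mem_empty_iff_false, iff_false]
      exact fun h => absurd h.1 (not_lt.2 ht1)
    rw [this, measureReal_empty]
    positivity
  -- Below the scale `τ` the tail estimate is trivial because `A ≥ 1`.
  rcases lt_or_ge t τ with htτ | htτ
  · refine measureReal_le_one.trans ?_
    have : 1 ≤ (τ / t) ^ κ := Real.one_le_rpow ((one_le_div ht).2 htτ.le) (hr.trans hκr).le
    nlinarith
  -- This choice equalises `R^{-β}` and `(m/n)(R/t)^d`; both become `(τ/t)^κ`.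
  set R := (t / τ) ^ (d / (β + d) : ℝ) with hR
  have hR1 : 1 ≤ R := Real.one_le_rpow ((one_le_div hτ0).2 htτ) (by positivity)
  have hR0 : 0 < R := by linarith
  have htt : 0 < t / τ := by positivity
  have e0 : (τ / t) ^ κ = (t / τ) ^ (-κ) := by
    rw [Real.rpow_neg htt.le, ← Real.inv_rpow htt.le, inv_div]
  have e1 : R ^ (-β) = (τ / t) ^ κ := by
    rw [e0, hR, ← Real.rpow_mul htt.le, hκ]; congr 1; ring
  have e2 : a * (R / t) ^ d = (τ / t) ^ κ := by
    rw [e0, div_pow, ← Real.rpow_natCast R, ← Real.rpow_natCast t, hR, ← Real.rpow_mul htt.le,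
      ← hτd, mul_div_left_comm, ← Real.div_rpow hτ0.le ht.le]
    rw [← inv_div t τ, Real.inv_rpow htt.le, ← Real.rpow_neg htt.le, ← Real.rpow_add htt]
    congr 1
    rw [hκ]; field_simp; ring
  have h := nn_tail_le hd1 PX hβ0 hM hm hn hδ ht ht1.le hR1
  have e3 : ((2 * d + 1) * R / t : ℝ) ^ d = (2 * d + 1) ^ d * (R / t) ^ d := by
    rw [mul_div_assoc, mul_pow]
  have hX : 0 ≤ (τ / t) ^ κ := by positivity
  have hsub : {z | t < min 1 (δ z)} ⊆ {z | t < δ z} := fun z hz => by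
    simp only [Set.mem_ofPred_eq, lt_min_iff] at hz ⊢
    exact hz.2
  refine (measureReal_mono hsub).trans ?_
  refine h.trans ?_
  calc _ = M * (τ / t) ^ κ + 4 * (2 * d + 1) ^ d * (τ / t) ^ κ := by
        rw [e1, e3, ← ha, ← e2]; ring
    _ ≤ A * (τ / t) ^ κ := by
        rw [hA]
        have := mul_le_mul_of_nonneg_right (le_abs_self M) hX
        nlinarith

end Moments

/-! ### The regression kernel -/

section Kernel

variable {d m n dT : ℕ} {c : Pt d → Pt d → ℝ} {p Lc : ℝ}

lemma RegressionKernel.symm (hc : RegressionKernel c p Lc) (x y : Pt d) : c x y = c y x := by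
  obtain ⟨c₀, -, h⟩ := hc.isotropic
  rw [h, h, norm_sub_rev]

lemma RegressionKernel.le_one (hc : RegressionKernel c p Lc) (x y : Pt d) : c x y ≤ 1 := by
  obtain ⟨c₀, h0, h⟩ := hc.isotropic
  rw [← hc.diag x, h, h x x, sub_self, norm_zero]
  exact h0.antitoneOn (Set.mem_Ici.2 le_rfl) (Set.mem_Ici.2 (norm_nonneg _)) (norm_nonneg _)

/-- Strict decrease of the radial profile makes ordering by the kernel metric the same as ordering
by Euclidean distance, so neighbours can be treated as Euclidean ones. -/
lemma RegressionKernel.norm_le_of_kernelDist_le (hc : RegressionKernel c p Lc) {l : ℝ}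
    (hl : 0 < l) {x y z : Pt d} (h : kernelDist c l x y ≤ kernelDist c l x z) :
    ‖x - y‖ ≤ ‖x - z‖ := by
  obtain ⟨c₀, h0, hc0⟩ := hc.isotropic
  by_contra! hlt
  have h1 : ‖l⁻¹ • x - l⁻¹ • z‖ < ‖l⁻¹ • x - l⁻¹ • y‖ := by
    rw [← smul_sub, ← smul_sub, norm_smul, norm_smul]
    exact mul_lt_mul_of_pos_left hlt (norm_pos_iff.2 (inv_ne_zero hl.ne'))
  have h2 : c (l⁻¹ • x) (l⁻¹ • y) < c (l⁻¹ • x) (l⁻¹ • z) := by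
    rw [hc0, hc0 _ (l⁻¹ • z)]
    exact h0 (Set.mem_Ici.2 (norm_nonneg _)) (Set.mem_Ici.2 (norm_nonneg _)) h1
  refine absurd h (not_le.2 (Real.sqrt_lt_sqrt ?_ (by linarith)))
  linarith [hc.le_one (l⁻¹ • x) (l⁻¹ • z)]

/-- The normalised Gram matrix of the points `Z`. -/
def corr (c : Pt d → Pt d → ℝ) (l : ℝ) (Z : Fin m → Pt d) : Matrix (Fin m) (Fin m) ℝ :=
  Matrix.of fun i j => c (l⁻¹ • Z i) (l⁻¹ • Z j)

/-- The kernel values between the test point and the points `Z`. -/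
def corrStar (c : Pt d → Pt d → ℝ) (l : ℝ) (xs : Pt d) (Z : Fin m → Pt d) : Fin m → ℝ :=
  fun j => c (l⁻¹ • xs) (l⁻¹ • Z j)

/-- Everything follows from positive semidefiniteness once the test point is added to the
neighbours; closeness to the test point already forces the neighbours to be correlated with each
other. -/
lemma RegressionKernel.nearConstant (hc : RegressionKernel c p Lc) (l : ℝ) (xs : Pt d)
    (Z : Fin m → Pt d) {ε : ℝ} (hε : ∀ j, 1 - corrStar c l xs Z j ≤ ε) :
    NearConstant (corr c l Z) (corrStar c l xs Z) ε where
  symm := by ext i j; exact hc.symm _ _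
  psd x := by
    have h := (hc.posSemidef m fun i => l⁻¹ • Z i).dotProduct_mulVec_nonneg x
    rw [star_trivial] at h
    exact h
  cross x := by
    -- The vector `(1, -x)` gives `1 - 2 x·a + x·C x ≥ 0`.
    have h := (hc.posSemidef (m + 1) (Fin.cons (l⁻¹ • xs) fun i => l⁻¹ • Z i)).dotProduct_mulVec_nonneg
      (Fin.cons 1 (-x))
    simp only [dotProduct, Matrix.mulVec, Fin.sum_univ_succ, star_trivial, Fin.cons_zero,
      Fin.cons_succ, Matrix.of_apply, hc.diag, Pi.neg_apply, mul_neg, neg_mul, mul_one, one_mul,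
      Finset.sum_neg_distrib] at h
    have e : ∑ i, x i * (c (l⁻¹ • Z i) (l⁻¹ • xs)
          + -∑ j, c (l⁻¹ • Z i) (l⁻¹ • Z j) * x j)
        = x ⬝ᵥ corrStar c l xs Z - x ⬝ᵥ (corr c l Z).mulVec x := by
      rw [← dotProduct_sub]
      refine Finset.sum_congr rfl fun i _ => ?_
      rw [hc.symm _ (l⁻¹ • xs)]
      simp [corrStar, corr, Matrix.mulVec, dotProduct, sub_eq_add_neg]
    have e2 : ∑ i, c (l⁻¹ • xs) (l⁻¹ • Z i) * x i = x ⬝ᵥ corrStar c l xs Z := by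
      rw [dotProduct_comm]; rfl
    rw [e, e2] at h
    linarith
  gram_le i j := hc.le_one _ _
  le_gram i j := by
    -- The vector `(2, -1, -1)` gives `C i j ≥ 2 a i + 2 a j - 3`, hence the constant `4`.
    have h := (hc.posSemidef 3 ![l⁻¹ • xs, l⁻¹ • Z i, l⁻¹ • Z j]).dotProduct_mulVec_nonneg
      ![2, -1, -1]
    simp [dotProduct, Matrix.mulVec, Fin.sum_univ_succ, hc.diag] at h
    rw [hc.symm (l⁻¹ • Z i) (l⁻¹ • xs), hc.symm (l⁻¹ • Z j) (l⁻¹ • xs),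
      hc.symm (l⁻¹ • Z j) (l⁻¹ • Z i)] at h
    have h1 := hε i
    have h2 := hε j
    simp only [corrStar] at h1 h2
    simp only [corr, Matrix.of_apply]
    linarith
  star_le j := hc.le_one _ _
  le_star j := by linarith [hε j]

/-! ### Nearest neighbours -/

/-- The distance from the test point to the `m`-th nearest neighbour. -/
def nnRadius (c : Pt d → Pt d → ℝ) (l : ℝ) (hm : 1 ≤ m) (hmn : m ≤ n)
    (z : Pt d × (Fin n → Pt d)) : ℝ :=
  ‖z.1 - z.2 (nnIndex c l hmn z.1 z.2 ⟨m - 1, by omega⟩)‖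

lemma nnRadius_nonneg (c : Pt d → Pt d → ℝ) (l : ℝ) (hm : 1 ≤ m) (hmn : m ≤ n)
    (z : Pt d × (Fin n → Pt d)) : 0 ≤ nnRadius c l hm hmn z := norm_nonneg _

lemma RegressionKernel.monotone_norm_sort (hc : RegressionKernel c p Lc) {l : ℝ} (hl : 0 < l)
    (xs : Pt d) (X : Fin n → Pt d) :
    Monotone fun i => ‖xs - X (Tuple.sort (fun i => kernelDist c l xs (X i)) i)‖ :=
  fun _ _ hij => hc.norm_le_of_kernelDist_le hl
    (Tuple.monotone_sort (fun i => kernelDist c l xs (X i)) hij)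

lemma RegressionKernel.norm_sub_nn_le (hc : RegressionKernel c p Lc) {l : ℝ} (hl : 0 < l)
    (hm : 1 ≤ m) (hmn : m ≤ n) (z : Pt d × (Fin n → Pt d)) (j : Fin m) :
    ‖z.1 - z.2 (nnIndex c l hmn z.1 z.2 j)‖ ≤ nnRadius c l hm hmn z := by
  refine hc.monotone_norm_sort hl z.1 z.2 (?_ : Fin.castLE hmn j ≤ Fin.castLE hmn ⟨m - 1, by omega⟩)
  rw [Fin.le_def]
  simp only [Fin.val_castLE]
  omega

open Classical in
lemma RegressionKernel.card_lt_of_lt_nnRadius (hc : RegressionKernel c p Lc) {l : ℝ} (hl : 0 < l)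
    (hm : 1 ≤ m) (hmn : m ≤ n) (z : Pt d × (Fin n → Pt d)) {t : ℝ}
    (ht : t < nnRadius c l hm hmn z) :
    (Finset.univ.filter fun i => ‖z.1 - z.2 i‖ ≤ t).card < m := by
  set σ := Tuple.sort (fun i => kernelDist c l z.1 (z.2 i)) with hσ
  -- Positions count from zero: if the sorted value at position `m - 1` exceeds `t`, at most `m - 1`
  -- values are at most `t`.
  have h1 := (Tuple.lt_card_le_iff_apply_le_of_monotone (j := Fin.castLE hmn ⟨m - 1, by omega⟩)
    (a := t) (hc.monotone_norm_sort hl z.1 z.2)).not.2 (not_le.2 ht)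
  have h2 : (Finset.univ.filter fun i => ‖z.1 - z.2 (σ i)‖ ≤ t).card
      = (Finset.univ.filter fun i => ‖z.1 - z.2 i‖ ≤ t).card := by
    refine Finset.card_bij (fun i _ => σ i) (fun i hi => ?_) (fun i _ j _ h => σ.injective h)
      fun i hi => ⟨σ.symm i, ?_, by simp⟩
    · simpa using hi
    · simpa using hi
  rw [← h2]
  simp only [Fin.val_castLE, not_lt] at h1
  refine lt_of_le_of_lt (le_trans (le_of_eq ?_) h1) (by omega : m - 1 < m)
  congr

/-- The sorting permutation takes finitely many values, and each of its level sets is cut out by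
finitely many comparisons of kernel distances, ties included. -/
lemma RegressionKernel.measurable_nnIndex (hc : RegressionKernel c p Lc) (l : ℝ)
    (hmn : m ≤ n) (j : Fin m) :
    Measurable fun z : Pt d × (Fin n → Pt d) => nnIndex c l hmn z.1 z.2 j := by
  have hk : ∀ i : Fin n, Measurable fun z : Pt d × (Fin n → Pt d) => kernelDist c l z.1 (z.2 i) := by
    intro i
    refine (measurable_const.sub ?_).sqrt
    exact hc.continuous.measurable.comp (f := fun z : Pt d × (Fin n → Pt d) =>
      (l⁻¹ • z.1, l⁻¹ • z.2 i)) (by fun_prop)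
  let _ : MeasurableSpace (Equiv.Perm (Fin n)) := ⊤
  have hs : Measurable fun z : Pt d × (Fin n → Pt d) =>
      Tuple.sort fun i => kernelDist c l z.1 (z.2 i) := by
    refine measurable_to_countable' fun σ => ?_
    have : (fun z : Pt d × (Fin n → Pt d) => Tuple.sort fun i => kernelDist c l z.1 (z.2 i)) ⁻¹' {σ}
        = {z | (∀ i j : Fin n, i ≤ j →
            kernelDist c l z.1 (z.2 (σ i)) ≤ kernelDist c l z.1 (z.2 (σ j))) ∧
          ∀ i j : Fin n, i < j → kernelDist c l z.1 (z.2 (σ i)) = kernelDist c l z.1 (z.2 (σ j)) →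
            σ i < σ j} := by
      ext z
      rw [Set.mem_preimage, Set.mem_singleton_iff, eq_comm, Tuple.eq_sort_iff]
      rfl
    rw [this]
    simp only [measurableSet_setOfPred]
    have h1 : ∀ i j : Fin n, Measurable fun z : Pt d × (Fin n → Pt d) =>
        kernelDist c l z.1 (z.2 (σ i)) ≤ kernelDist c l z.1 (z.2 (σ j)) := fun i j =>
      measurableSet_setOfPred.1 (measurableSet_le (hk _) (hk _))
    have h2 : ∀ i j : Fin n, Measurable fun z : Pt d × (Fin n → Pt d) =>
        kernelDist c l z.1 (z.2 (σ i)) = kernelDist c l z.1 (z.2 (σ j)) := fun i j =>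
      measurableSet_setOfPred.1 (measurableSet_eq_fun (hk _) (hk _))
    refine Measurable.and ?_ ?_
    · exact Measurable.forall fun i => Measurable.forall fun j => measurable_const.imp (h1 i j)
    · exact Measurable.forall fun i => Measurable.forall fun j =>
        measurable_const.imp ((h2 i j).imp measurable_const)
  exact (measurable_of_countable fun σ : Equiv.Perm (Fin n) => σ (Fin.castLE hmn j)).comp hs

lemma RegressionKernel.measurable_nn (hc : RegressionKernel c p Lc) (l : ℝ)
    (hmn : m ≤ n) (j : Fin m) :
    Measurable fun z : Pt d × (Fin n → Pt d) => z.2 (nnIndex c l hmn z.1 z.2 j) := by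
  intro S hS
  have : (fun z : Pt d × (Fin n → Pt d) => z.2 (nnIndex c l hmn z.1 z.2 j)) ⁻¹' S
      = ⋃ i : Fin n, (fun z => nnIndex c l hmn z.1 z.2 j) ⁻¹' {i} ∩ (fun z => z.2 i) ⁻¹' S := by
    ext z; simp
  rw [this]
  exact MeasurableSet.iUnion fun i => ((hc.measurable_nnIndex l hmn j) (measurableSet_singleton i)).inter
    (((measurable_pi_apply i).comp measurable_snd) hS)

lemma RegressionKernel.measurable_nnRadius (hc : RegressionKernel c p Lc) (l : ℝ)
    (hm : 1 ≤ m) (hmn : m ≤ n) : Measurable (nnRadius c l hm hmn : Pt d × (Fin n → Pt d) → ℝ) :=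
  (measurable_fst.sub (hc.measurable_nn l hmn _)).norm

lemma nnIndex_injective (c : Pt d → Pt d → ℝ) (l : ℝ) (hmn : m ≤ n) (xs : Pt d)
    (X : Fin n → Pt d) : Function.Injective (nnIndex c l hmn xs X) := fun i j h => by
  have := (Tuple.sort fun i => kernelDist c l xs (X i)).injective h
  exact Fin.castLE_injective hmn this

end Kernel

/-! ### The prediction weights -/

section Weights

variable {d m dT : ℕ} {c : Pt d → Pt d → ℝ} {p Lc : ℝ}

/-- The weights `Γ k^*ᵀ K⁻¹` of the predictor. -/
def weights (c : Pt d → Pt d → ℝ) (h : HyperParams dT) (xs : Pt d) (Z : Fin m → Pt d) :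
    Fin m → ℝ :=
  gammaFactor m h • Matrix.vecMul (kStar c h xs Z) (gram c h Z)⁻¹

lemma localPredict_eq {n : ℕ} (c : Pt d → Pt d → ℝ) (hmn : m ≤ n) (h : HyperParams dT)
    (xs : Pt d) (X : Fin n → Pt d) (z : Fin n → ℝ) :
    localPredict c hmn h xs X z
      = weights c h xs (fun j => X (nnIndex c h.lengthscale hmn xs X j)) ⬝ᵥ
        fun j => z (nnIndex c h.lengthscale hmn xs X j) := by
  rw [localPredict, weights, smul_dotProduct, Matrix.dotProduct_mulVec, smul_eq_mul]

lemma gram_mulVec (c : Pt d → Pt d → ℝ) (h : HyperParams dT) (Z : Fin m → Pt d) (x : Fin m → ℝ) :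
    (gram c h Z).mulVec x = h.noiseVar • x + h.scale • (corr c h.lengthscale Z).mulVec x := by
  have : gram c h Z = h.noiseVar • (1 : Matrix (Fin m) (Fin m) ℝ)
      + h.scale • corr c h.lengthscale Z := by
    ext i j
    simp [gram, corr, Matrix.one_apply, add_comm]
  rw [this, Matrix.add_mulVec, Matrix.smul_mulVec, Matrix.smul_mulVec, Matrix.one_mulVec]

lemma RegressionKernel.nearConstant_one (hc : RegressionKernel c p Lc) (l : ℝ) (xs : Pt d)
    (Z : Fin m → Pt d) : NearConstant (corr c l Z) (corrStar c l xs Z) 1 :=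
  hc.nearConstant l xs Z fun j => by
    have := hc.nonneg (l⁻¹ • xs) (l⁻¹ • Z j)
    simp only [corrStar]; linarith

/-- The linear system solved by the weights has at most one solution. -/
lemma NearConstant.eq_of_solves {C : Matrix (Fin m) (Fin m) ℝ} {a : Fin m → ℝ} {ε s F : ℝ}
    (h : NearConstant C a ε) (hs : 0 < s) (hF : 0 < F) {x y r : Fin m → ℝ}
    (hx : s • x + F • C.mulVec x = r) (hy : s • y + F • C.mulVec y = r) : x = y := by
  have h0 : s • (x - y) + F • C.mulVec (x - y) = 0 := by
    rw [Matrix.mulVec_sub, ← sub_eq_zero.2 (hx.trans hy.symm)]; module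
  have h1 := h.coercive hF h0
  have h2 : l2 (0 : Fin m → ℝ) = 0 := by simp [l2]
  rw [h2] at h1
  have h3 : l2 (x - y) = 0 := le_antisymm (by nlinarith) (l2_nonneg _)
  rw [l2, norm_eq_zero] at h3
  have h4 : x - y = 0 := (WithLp.toLp_eq_zero 2).1 h3
  exact sub_eq_zero.1 h4

lemma RegressionKernel.gram_det_ne_zero (hc : RegressionKernel c p Lc) {h : HyperParams dT}
    (hs : 0 < h.noiseVar) (hF : 0 < h.scale) (Z : Fin m → Pt d) : (gram c h Z).det ≠ 0 := by
  rw [Ne, ← Matrix.exists_mulVec_eq_zero_iff]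
  rintro ⟨x, hx, hx0⟩
  rw [gram_mulVec] at hx0
  exact hx ((hc.nearConstant_one h.lengthscale 0 Z).eq_of_solves hs hF hx0 (by simp))

lemma RegressionKernel.gram_transpose (hc : RegressionKernel c p Lc) (h : HyperParams dT)
    (Z : Fin m → Pt d) : (gram c h Z).transpose = gram c h Z := by
  ext i j
  simp only [gram, Matrix.transpose_apply, Matrix.of_apply, hc.symm (_ • Z j), eq_comm]

lemma RegressionKernel.weights_eq (hc : RegressionKernel c p Lc) (h : HyperParams dT)
    (xs : Pt d) (Z : Fin m → Pt d) :
    weights c h xs Z = gammaFactor m h • (gram c h Z)⁻¹.mulVec (kStar c h xs Z) := by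
  rw [weights, ← Matrix.mulVec_transpose, Matrix.transpose_nonsing_inv, hc.gram_transpose]

/-- The scale in the denominator of `Γ` cancels the one in `kStar`. The resulting right side is the
one for which uniform weights are exact when all correlations equal one. -/
lemma RegressionKernel.weights_solves (hc : RegressionKernel c p Lc) (hm : 1 ≤ m)
    {h : HyperParams dT} (hs : 0 < h.noiseVar) (hF : 0 < h.scale) (xs : Pt d) (Z : Fin m → Pt d) :
    h.noiseVar • weights c h xs Z + h.scale • (corr c h.lengthscale Z).mulVec (weights c h xs Z)
      = ((h.noiseVar + m * h.scale) / m) • corrStar c h.lengthscale xs Z := by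
  have hm0 : (m : ℝ) ≠ 0 := by positivity
  rw [← gram_mulVec, hc.weights_eq, Matrix.mulVec_smul, Matrix.mulVec_mulVec,
    Matrix.mul_nonsing_inv _ (isUnit_iff_ne_zero.2 (hc.gram_det_ne_zero hs hF Z)), Matrix.one_mulVec]
  ext j
  simp [gammaFactor, kStar, corrStar]
  field_simp

/-- Multiplying the system by a positive number shows that only the ratio of noise variance to scale
matters, which reduces the derivative in the scale to that in the noise variance. -/
lemma RegressionKernel.weights_scale (hc : RegressionKernel c p Lc) (hm : 1 ≤ m)
    {h : HyperParams dT} (hs : 0 < h.noiseVar) (hF : 0 < h.scale) (xs : Pt d) (Z : Fin m → Pt d)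
    {F : ℝ} (hF' : 0 < F) :
    weights c { h with scale := F } xs Z
      = weights c { h with noiseVar := h.noiseVar * h.scale / F } xs Z := by
  have hm0 : (m : ℝ) ≠ 0 := by positivity
  have h1 := hc.weights_solves hm (h := { h with scale := F }) hs hF' xs Z
  have h2 := hc.weights_solves hm (h := { h with noiseVar := h.noiseVar * h.scale / F })
    (by positivity) hF xs Z
  simp only at h1 h2
  refine (hc.nearConstant_one h.lengthscale xs Z).eq_of_solves (by positivity) hF ?_ h2
  have h3 := congrArg (fun y => (h.scale / F) • y) h1
  simp only [smul_add, smul_smul] at h3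
  have e1 : h.scale / F * h.noiseVar = h.noiseVar * h.scale / F := by ring
  have e2 : h.scale / F * F = h.scale := by field_simp
  have e3 : h.scale / F * ((h.noiseVar + m * F) / m)
      = (h.noiseVar * h.scale / F + m * h.scale) / m := by field_simp
  rwa [e1, e2, e3] at h3

/-! Differentiability and measurability of determinants and inverses. -/

lemma differentiableAt_matrix_det {A : ℝ → Matrix (Fin m) (Fin m) ℝ} {s : ℝ}
    (hA : ∀ i j, DifferentiableAt ℝ (fun s => A s i j) s) :
    DifferentiableAt ℝ (fun s => (A s).det) s := by
  simp only [Matrix.det_apply]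
  refine DifferentiableAt.fun_sum fun σ _ => DifferentiableAt.const_smul ?_ _
  exact DifferentiableAt.fun_finsetProd fun i _ => hA _ _

/-- By Cramer's rule the entries of the inverse are quotients of determinants. -/
lemma differentiableAt_matrix_inv {A : ℝ → Matrix (Fin m) (Fin m) ℝ} {s : ℝ}
    (hA : ∀ i j, DifferentiableAt ℝ (fun s => A s i j) s) (h0 : (A s).det ≠ 0) (i j : Fin m) :
    DifferentiableAt ℝ (fun s => (A s)⁻¹ i j) s := by
  simp only [Matrix.inv_def, Ring.inverse_eq_inv', Matrix.smul_apply, smul_eq_mul,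
    Matrix.adjugate_apply]
  refine ((differentiableAt_matrix_det hA).inv h0).mul (differentiableAt_matrix_det fun k l => ?_)
  by_cases hk : k = j
  · subst hk; simp
  · simpa [hk] using hA k l

lemma measurable_matrix_det {α : Type*} [MeasurableSpace α] {A : α → Matrix (Fin m) (Fin m) ℝ}
    (hA : ∀ i j, Measurable fun z => A z i j) : Measurable fun z => (A z).det := by
  simp only [Matrix.det_apply]
  refine Finset.measurable_fun_sum _ fun σ _ => Measurable.const_smul ?_ _
  exact Finset.measurable_fun_prod _ fun i _ => hA _ _

lemma measurable_matrix_inv {α : Type*} [MeasurableSpace α] {A : α → Matrix (Fin m) (Fin m) ℝ}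
    (hA : ∀ i j, Measurable fun z => A z i j) (i j : Fin m) :
    Measurable fun z => (A z)⁻¹ i j := by
  simp only [Matrix.inv_def, Ring.inverse_eq_inv', Matrix.smul_apply, smul_eq_mul,
    Matrix.adjugate_apply]
  refine (measurable_matrix_det hA).inv.mul (measurable_matrix_det fun k l => ?_)
  by_cases hk : k = j
  · subst hk; simp
  · simpa [hk] using hA k l

/-- The derivative of the weights in the noise variance. -/
def weightsDeriv (c : Pt d → Pt d → ℝ) (h : HyperParams dT) (xs : Pt d) (Z : Fin m → Pt d) :
    Fin m → ℝ :=
  (gram c h Z)⁻¹.mulVec (-(weights c h xs Z - (m : ℝ)⁻¹ • corrStar c h.lengthscale xs Z))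

lemma RegressionKernel.weightsDeriv_solves (hc : RegressionKernel c p Lc)
    {h : HyperParams dT} (hs : 0 < h.noiseVar) (hF : 0 < h.scale) (xs : Pt d) (Z : Fin m → Pt d) :
    h.noiseVar • weightsDeriv c h xs Z
        + h.scale • (corr c h.lengthscale Z).mulVec (weightsDeriv c h xs Z)
      = -(weights c h xs Z - (m : ℝ)⁻¹ • corrStar c h.lengthscale xs Z) := by
  rw [← gram_mulVec, weightsDeriv, Matrix.mulVec_mulVec,
    Matrix.mul_nonsing_inv _ (isUnit_iff_ne_zero.2 (hc.gram_det_ne_zero hs hF Z)), Matrix.one_mulVec]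

/-- Cramer's rule gives differentiability only. The value is found by differentiating the linear
system and using uniqueness of its solution. -/
lemma RegressionKernel.hasDerivAt_weights (hc : RegressionKernel c p Lc) (hm : 1 ≤ m)
    {h : HyperParams dT} (hs : 0 < h.noiseVar) (hF : 0 < h.scale) (xs : Pt d) (Z : Fin m → Pt d)
    (j : Fin m) :
    HasDerivAt (fun s => weights c { h with noiseVar := s } xs Z j) (weightsDeriv c h xs Z j)
      h.noiseVar := by
  have hm0 : (m : ℝ) ≠ 0 := by positivity
  have hd : ∀ j, DifferentiableAt ℝ (fun s => weights c { h with noiseVar := s } xs Z j)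
      h.noiseVar := by
    intro j
    simp only [hc.weights_eq, Pi.smul_apply, smul_eq_mul, Matrix.mulVec, dotProduct]
    refine DifferentiableAt.mul ?_ (DifferentiableAt.fun_sum fun k _ => DifferentiableAt.mul ?_ ?_)
    · simp only [gammaFactor]; fun_prop
    · refine differentiableAt_matrix_inv (A := fun s => gram c { h with noiseVar := s } Z)
        (fun i j => ?_) (hc.gram_det_ne_zero hs hF Z) j k
      simp only [gram, Matrix.of_apply]
      by_cases hij : i = j
      · simp only [if_pos hij]; fun_prop
      · simp only [if_neg hij]; fun_prop
    · exact differentiableAt_const (kStar c h xs Z k)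
  set v' : Fin m → ℝ := fun j => deriv (fun s => weights c { h with noiseVar := s } xs Z j)
    h.noiseVar with hv'
  have hv'd : ∀ j, HasDerivAt (fun s => weights c { h with noiseVar := s } xs Z j) (v' j)
      h.noiseVar := fun j => (hd j).hasDerivAt
  have hsolve : h.noiseVar • v' + h.scale • (corr c h.lengthscale Z).mulVec v'
      = -(weights c h xs Z - (m : ℝ)⁻¹ • corrStar c h.lengthscale xs Z) := by
    ext i
    have h1 : HasDerivAt (fun s => s * weights c { h with noiseVar := s } xs Z i
        + h.scale * ∑ k, corr c h.lengthscale Z i k * weights c { h with noiseVar := s } xs Z k)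
        (1 * weights c h xs Z i + h.noiseVar * v' i
          + h.scale * ∑ k, corr c h.lengthscale Z i k * v' k) h.noiseVar :=
      ((hasDerivAt_id _).mul (hv'd i)).add
        ((HasDerivAt.fun_sum fun k _ => (hv'd k).const_mul _).const_mul _)
    have h2 : HasDerivAt (fun s => (s + m * h.scale) / m * corrStar c h.lengthscale xs Z i)
        (1 / m * corrStar c h.lengthscale xs Z i) h.noiseVar :=
      (((hasDerivAt_id _).add_const _).div_const _).mul_const _
    -- The system is available for positive noise variance, hence only near `h.noiseVar`.
    have h3 : (fun s => s * weights c { h with noiseVar := s } xs Z i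
        + h.scale * ∑ k, corr c h.lengthscale Z i k * weights c { h with noiseVar := s } xs Z k)
        =ᶠ[nhds h.noiseVar]
        fun s => (s + m * h.scale) / m * corrStar c h.lengthscale xs Z i := by
      filter_upwards [lt_mem_nhds hs] with s hs'
      exact congrFun (hc.weights_solves hm (h := { h with noiseVar := s }) hs' hF xs Z) i
    have h4 := h1.unique (h2.congr_of_eventuallyEq h3)
    simp only [Pi.add_apply, Pi.smul_apply, smul_eq_mul, Matrix.mulVec, dotProduct, Pi.neg_apply,
      Pi.sub_apply]
    rw [one_div] at h4
    linarith
  have : v' = weightsDeriv c h xs Z :=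
    (hc.nearConstant_one h.lengthscale xs Z).eq_of_solves hs hF hsolve
      (hc.weightsDeriv_solves hs hF xs Z)
  rw [← this]
  exact hv'd j

lemma RegressionKernel.measurable_weights (hc : RegressionKernel c p Lc) (h : HyperParams dT)
    {α : Type*} [MeasurableSpace α] {xs : α → Pt d} {Z : α → Fin m → Pt d} (hxs : Measurable xs)
    (hZ : ∀ j, Measurable fun z => Z z j) (j : Fin m) :
    (Measurable fun z => weights c h (xs z) (Z z) j) ∧
      Measurable fun z => weightsDeriv c h (xs z) (Z z) j := by
  have hcc : ∀ {u v : α → Pt d}, Measurable u → Measurable v →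
      Measurable fun z => c (h.lengthscale⁻¹ • u z) (h.lengthscale⁻¹ • v z) := fun hu hv =>
    hc.continuous.measurable.comp ((hu.const_smul h.lengthscale⁻¹).prodMk
      (hv.const_smul h.lengthscale⁻¹))
  have hG : ∀ i k, Measurable fun z => (gram c h (Z z))⁻¹ i k :=
    measurable_matrix_inv fun i k => ((hcc (hZ i) (hZ k)).const_mul _).add measurable_const
  have hw : ∀ j, Measurable fun z => weights c h (xs z) (Z z) j := fun j => by
    simp only [hc.weights_eq, Pi.smul_apply, smul_eq_mul, Matrix.mulVec, dotProduct]
    exact (Finset.measurable_fun_sum _ fun k _ =>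
      (hG j k).mul ((hcc hxs (hZ k)).const_mul _)).const_mul _
  refine ⟨hw j, ?_⟩
  simp only [weightsDeriv, Matrix.mulVec, dotProduct, Pi.neg_apply, Pi.sub_apply, Pi.smul_apply,
    smul_eq_mul]
  exact Finset.measurable_fun_sum _ fun k _ =>
    (hG j k).mul ((hw k).sub ((hcc hxs (hZ k)).const_mul _)).neg

end Weights

/-! ### Evaluation of the mean squared errors -/

section MSE

lemma integral_sq_add_of_centred {α β : Type*} [MeasurableSpace α] [MeasurableSpace β]
    {μ : Measure α} {ν : Measure β} [IsProbabilityMeasure μ] [IsProbabilityMeasure ν]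
    {A : α → ℝ} {N : β → ℝ} (hA : MemLp A 2 μ) (hN : MemLp N 2 ν) (h0 : ∫ y, N y ∂ν = 0) :
    ∫ z, (A z.1 + N z.2) ^ 2 ∂(μ.prod ν) = ∫ x, A x ^ 2 ∂μ + ∫ y, N y ^ 2 ∂ν := by
  have h1 : Integrable (fun z : α × β => A z.1 ^ 2) (μ.prod ν) := hA.integrable_sq.comp_fst ν
  have h2 : Integrable (fun z : α × β => N z.2 ^ 2) (μ.prod ν) := hN.integrable_sq.comp_snd μ
  have h3 : Integrable (fun z : α × β => A z.1 * N z.2) (μ.prod ν) :=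
    (hA.integrable one_le_two).mul_prod (hN.integrable one_le_two)
  have e : ∀ z : α × β, (A z.1 + N z.2) ^ 2 = A z.1 ^ 2 + 2 * (A z.1 * N z.2) + N z.2 ^ 2 :=
    fun z => by ring
  simp only [e]
  have h4 : Integrable (fun z : α × β => A z.1 ^ 2 + 2 * (A z.1 * N z.2)) (μ.prod ν) :=
    h1.add (h3.const_mul 2)
  rw [integral_add h4 h2, integral_add h1 (h3.const_mul 2),
    integral_const_mul, integral_prod_mul, h0, integral_fun_fst (fun x => A x ^ 2),
    integral_fun_snd (fun x => N x ^ 2)]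
  simp

lemma integral_const_add_sq_of_centred {α : Type*} [MeasurableSpace α] {μ : Measure α}
    [IsProbabilityMeasure μ] {N : α → ℝ} (hN : MemLp N 2 μ) (h0 : ∫ x, N x ∂μ = 0) (r : ℝ) :
    ∫ x, (r + N x) ^ 2 ∂μ = r ^ 2 + ∫ x, N x ^ 2 ∂μ := by
  have e : ∀ x, (r + N x) ^ 2 = r ^ 2 + 2 * r * N x + N x ^ 2 := fun x => by ring
  have hi := (hN.integrable one_le_two).const_mul (2 * r)
  have hi2 : Integrable (fun x => r ^ 2 + 2 * r * N x) μ := (integrable_const _).add hi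
  simp only [e]
  rw [integral_add hi2 hN.integrable_sq, integral_add (integrable_const _) hi,
    integral_const_mul, h0]
  simp

variable {Pξ : Measure ℝ} {σ2 : ℝ}

instance instIsProbabilityMeasureNoiseLaw [IsProbabilityMeasure Pξ] (n : ℕ) :
    IsProbabilityMeasure (noiseLaw Pξ n) := by
  unfold noiseLaw; infer_instance

/-- Mean and variance of a linear combination of distinct training noise variables. -/
lemma CentredNoise.sum [IsProbabilityMeasure Pξ] (hP : CentredNoise Pξ σ2) {m n : ℕ}
    {g : Fin m → Fin n} (hg : Function.Injective g) (v : Fin m → ℝ) :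
    MemLp (fun ξ : Fin n → ℝ => ∑ j, v j * ξ (g j)) 2 (Measure.pi fun _ => Pξ) ∧
    ∫ ξ, ∑ j, v j * ξ (g j) ∂(Measure.pi fun _ : Fin n => Pξ) = 0 ∧
    ∫ ξ, (∑ j, v j * ξ (g j)) ^ 2 ∂(Measure.pi fun _ : Fin n => Pξ) = σ2 * (v ⬝ᵥ v) := by
  set μ := Measure.pi fun _ : Fin n => Pξ with hμ
  have hev : ∀ i : Fin n, MeasurePreserving (fun ξ : Fin n → ℝ => ξ i) μ Pξ := fun i =>
    measurePreserving_eval _ i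
  have hL : ∀ i : Fin n, MemLp (fun ξ : Fin n → ℝ => ξ i) 2 μ := fun i =>
    hP.memLp.comp_measurePreserving (hev i)
  have hi0 : ∀ i : Fin n, ∫ ξ, ξ i ∂μ = 0 := fun i => by
    rw [← hP.mean, ← (hev i).map_eq,
      integral_map (hev i).measurable.aemeasurable (by fun_prop)]
  have hi2 : ∀ i : Fin n, ∫ ξ, ξ i * ξ i ∂μ = σ2 := fun i => by
    rw [← hP.variance, ← (hev i).map_eq,
      integral_map (hev i).measurable.aemeasurable (by fun_prop)]
    simp only [sq]
  have hij : ∀ i j : Fin n, i ≠ j → ∫ ξ, ξ i * ξ j ∂μ = 0 := fun i j h => by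
    have hind : iIndepFun (fun (i : Fin n) (ξ : Fin n → ℝ) => ξ i) μ :=
      iIndepFun_pi (X := fun _ x => x) fun i => aemeasurable_id
    rw [(hind.indepFun h).integral_fun_mul_eq_mul_integral (hL i).1 (hL j).1, hi0, zero_mul]
  have hmul : ∀ i j : Fin n, Integrable (fun ξ : Fin n → ℝ => ξ i * ξ j) μ := fun i j =>
    (hL i).integrable_mul (hL j)
  refine ⟨memLp_finsetSum _ fun j _ => (hL (g j)).const_mul _, ?_, ?_⟩
  · rw [integral_finsetSum _ fun j _ => ((hL (g j)).integrable one_le_two).const_mul _]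
    simp [integral_const_mul, hi0]
  · have e : ∀ ξ : Fin n → ℝ, (∑ j, v j * ξ (g j)) ^ 2
        = ∑ j, ∑ k, v j * v k * (ξ (g j) * ξ (g k)) := fun ξ => by
      rw [sq, Finset.sum_mul_sum]
      exact Finset.sum_congr rfl fun j _ => Finset.sum_congr rfl fun k _ => by ring
    simp only [e]
    rw [integral_finsetSum _ fun j _ => integrable_finsetSum _ fun k _ => (hmul _ _).const_mul _]
    simp only [dotProduct, Finset.mul_sum]
    refine Finset.sum_congr rfl fun j _ => ?_
    rw [integral_finsetSum _ fun k _ => (hmul _ _).const_mul _, Finset.sum_eq_single j]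
    · rw [integral_const_mul, hi2]; ring
    · intro k _ hk
      rw [integral_const_mul, hij _ _ (hg.ne hk.symm), mul_zero]
    · simp

lemma CentredNoise.residual [IsProbabilityMeasure Pξ] (hP : CentredNoise Pξ σ2) {m n : ℕ}
    {g : Fin m → Fin n} (hg : Function.Injective g) (v : Fin m → ℝ) :
    MemLp (fun ξ : ℝ × (Fin n → ℝ) => ξ.1 - ∑ j, v j * ξ.2 (g j)) 2 (noiseLaw Pξ n) ∧
    ∫ ξ, (ξ.1 - ∑ j, v j * ξ.2 (g j)) ∂(noiseLaw Pξ n) = 0 ∧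
    ∫ ξ, (ξ.1 - ∑ j, v j * ξ.2 (g j)) ^ 2 ∂(noiseLaw Pξ n) = σ2 * (1 + v ⬝ᵥ v) := by
  obtain ⟨h1, h2, h3⟩ := hP.sum hg v
  have hf : MemLp (fun ξ : ℝ × (Fin n → ℝ) => ξ.1) 2 (noiseLaw Pξ n) := hP.memLp.comp_fst _
  have hs : MemLp (fun ξ : ℝ × (Fin n → ℝ) => ∑ j, v j * ξ.2 (g j)) 2 (noiseLaw Pξ n) :=
    h1.comp_snd _
  refine ⟨hf.sub hs, ?_, ?_⟩
  · rw [integral_sub (hf.integrable one_le_two) (hs.integrable one_le_two), noiseLaw,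
      integral_fun_fst (fun x : ℝ => x), integral_fun_snd (fun ξ : Fin n → ℝ => ∑ j, v j * ξ (g j)),
      h2, hP.mean]
    simp
  · have h := integral_sq_add_of_centred hP.memLp h1.neg (by
      simp only [Pi.neg_apply]; rw [integral_neg, h2, neg_zero])
    simp only [Pi.neg_apply, neg_sq, ← sub_eq_add_neg] at h
    rw [noiseLaw, h, h3, hP.variance]
    ring

variable {d dT m n : ℕ} {c : Pt d → Pt d → ℝ}

/-- The `j`-th nearest neighbour. -/
def nn (c : Pt d → Pt d → ℝ) (l : ℝ) (hmn : m ≤ n) (xs : Pt d) (X : Fin n → Pt d) :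
    Fin m → Pt d :=
  fun j => X (nnIndex c l hmn xs X j)

/-- The error is a deterministic bias plus a centred noise residual, the neighbours having distinct
indices. The bias is written with a norm and scalar multiplication so that it has the form used for
Hilbert-space valued `ψ`. -/
theorem mseGPnn_eq [IsProbabilityMeasure Pξ] (hP : CentredNoise Pξ σ2) (f : Pt d → ℝ)
    (hmn : m ≤ n) (h : HyperParams dT) (xs : Pt d) (X : Fin n → Pt d) :
    mseGPnn c f Pξ hmn h xs X
      = ‖f xs - ∑ j, weights c h xs (nn c h.lengthscale hmn xs X) j
            • f (nn c h.lengthscale hmn xs X j)‖ ^ 2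
        + σ2 * (1 + weights c h xs (nn c h.lengthscale hmn xs X)
            ⬝ᵥ weights c h xs (nn c h.lengthscale hmn xs X)) := by
  set Z := nn c h.lengthscale hmn xs X with hZ
  set v := weights c h xs Z with hv
  obtain ⟨h1, h2, h3⟩ := hP.residual (nnIndex_injective c h.lengthscale hmn xs X) v
  set r := f xs - ∑ j, v j • f (Z j) with hr
  have e : ∀ ξ : ℝ × (Fin n → ℝ),
      (f xs + ξ.1) - muGPnn c hmn h xs X (fun i => f (X i) + ξ.2 i)
        = r + (ξ.1 - ∑ j, v j * ξ.2 (nnIndex c h.lengthscale hmn xs X j)) := fun ξ => by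
    rw [muGPnn, localPredict_eq]
    change f xs + ξ.1 - ∑ j, v j * (f (Z j) + ξ.2 _) = _
    simp only [mul_add, Finset.sum_add_distrib, hr, smul_eq_mul]
    ring
  simp only [mseGPnn, e]
  rw [integral_const_add_sq_of_centred h1 h2, h3, Real.norm_eq_abs, sq_abs]

/-! ### The random field and its `L²` norms. -/

section Field

variable {Ω : Type*} [MeasurableSpace Ω] {Q : Measure Ω}

lemma norm_toLp_sq {f : Ω → ℝ} (hf : MemLp f 2 Q) : ‖hf.toLp f‖ ^ 2 = ∫ ω, f ω ^ 2 ∂Q := by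
  rw [← real_inner_self_eq_norm_sq, L2.inner_def]
  refine integral_congr_ae ?_
  filter_upwards [hf.coeFn_toLp] with ω hω
  rw [hω, real_inner_self_eq_norm_sq, Real.norm_eq_abs, sq_abs]

lemma sum_smul_toLp {ι : Type*} (s : Finset ι) {F : ι → Ω → ℝ} (hF : ∀ j, MemLp (F j) 2 Q)
    (v : ι → ℝ) (hs : MemLp (fun ω => ∑ j ∈ s, v j * F j ω) 2 Q) :
    ∑ j ∈ s, v j • (hF j).toLp (F j) = hs.toLp _ := by
  classical
  induction s using Finset.induction_on with
  | empty => exact (MemLp.toLp_zero _).symm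
  | insert a s ha ih =>
    have hs' : MemLp (fun ω => ∑ j ∈ s, v j * F j ω) 2 Q :=
      memLp_finsetSum _ fun j _ => (hF j).const_mul _
    rw [Finset.sum_insert ha, ih hs', ← MemLp.toLp_const_smul, ← MemLp.toLp_add]
    congr 1
    ext ω
    simp [Finset.sum_insert ha]

lemma norm_sub_sum_toLp_sq {F : Pt d → Ω → ℝ} (hF : ∀ x, MemLp (F x) 2 Q) (xs : Pt d)
    (Z : Fin m → Pt d) (v : Fin m → ℝ) :
    ‖(hF xs).toLp (F xs) - ∑ j, v j • (hF (Z j)).toLp (F (Z j))‖ ^ 2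
      = ∫ ω, (F xs ω - ∑ j, v j * F (Z j) ω) ^ 2 ∂Q := by
  have hs : MemLp (fun ω => ∑ j, v j * F (Z j) ω) 2 Q :=
    memLp_finsetSum _ fun j _ => (hF _).const_mul _
  rw [sum_smul_toLp Finset.univ (fun j => hF (Z j)) v hs, ← MemLp.toLp_sub, norm_toLp_sq]
  rfl

lemma memLp_const_add [IsFiniteMeasure Q] {f : Ω → ℝ} (hf : MemLp f 2 Q) (r : ℝ) :
    MemLp (fun ω => r + f ω) 2 Q :=
  (memLp_const r).add hf

/-- The prediction error of NNGP splits into a field part and a noise part. -/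
lemma sub_muNNGP_eq (t : Pt d → EuclideanSpace ℝ (Fin dT)) (b : EuclideanSpace ℝ (Fin dT))
    (hmn : m ≤ n) (h : HyperParams dT) (xs : Pt d) (X : Fin n → Pt d) (u : Pt d → ℝ) (ξ₀ : ℝ)
    (ξ : Fin n → ℝ) :
    (t xs ⬝ᵥ b + u xs + ξ₀) - muNNGP c t hmn h xs X (fun i => t (X i) ⬝ᵥ b + u (X i) + ξ i)
      = ((inner ℝ (t xs) (b - h.coef) + u xs)
          - ∑ j, weights c h xs (nn c h.lengthscale hmn xs X) j
            * (inner ℝ (t (nn c h.lengthscale hmn xs X j)) (b - h.coef)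
                + u (nn c h.lengthscale hmn xs X j)))
        + (ξ₀ - ∑ j, weights c h xs (nn c h.lengthscale hmn xs X) j
            * ξ (nnIndex c h.lengthscale hmn xs X j)) := by
  have hdot : ∀ x y : EuclideanSpace ℝ (Fin dT), inner ℝ x y = x ⬝ᵥ y := fun x y => by
    rw [EuclideanSpace.inner_eq_star_dotProduct, dotProduct_comm]; simp
  rw [muNNGP, localPredict_eq]
  unfold nn
  generalize weights c h xs (fun j => X (nnIndex c h.lengthscale hmn xs X j)) = v
  generalize nnIndex c h.lengthscale hmn xs X = g
  have e : (v ⬝ᵥ fun j => t (X (g j)) ⬝ᵥ b + u (X (g j)) + ξ (g j) - t (X (g j)) ⬝ᵥ h.coef)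
      = ∑ j, v j * (t (X (g j)) ⬝ᵥ b - t (X (g j)) ⬝ᵥ h.coef + u (X (g j)))
        + ∑ j, v j * ξ (g j) := by
    rw [dotProduct, ← Finset.sum_add_distrib]
    exact Finset.sum_congr rfl fun j _ => by ring
  simp only [hdot, WithLp.ofLp_sub, dotProduct_sub]
  rw [e]
  ring

theorem mseNNGP_eq [IsProbabilityMeasure Pξ] [IsProbabilityMeasure Q] (hP : CentredNoise Pξ σ2)
    {w : Pt d → Ω → ℝ} (hw : ∀ x, MemLp (w x) 2 Q) (t : Pt d → EuclideanSpace ℝ (Fin dT))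
    (b : EuclideanSpace ℝ (Fin dT)) (hmn : m ≤ n) (h : HyperParams dT) (xs : Pt d)
    (X : Fin n → Pt d) :
    mseNNGP Q w c t b Pξ hmn h xs X
      = ∫ ω, ((inner ℝ (t xs) (b - h.coef) + w xs ω)
          - ∑ j, weights c h xs (nn c h.lengthscale hmn xs X) j
            * (inner ℝ (t (nn c h.lengthscale hmn xs X j)) (b - h.coef)
                + w (nn c h.lengthscale hmn xs X j) ω)) ^ 2 ∂Q
        + σ2 * (1 + weights c h xs (nn c h.lengthscale hmn xs X)
            ⬝ᵥ weights c h xs (nn c h.lengthscale hmn xs X)) := by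
  obtain ⟨h1, h2, h3⟩ := hP.residual (nnIndex_injective c h.lengthscale hmn xs X)
    (weights c h xs (nn c h.lengthscale hmn xs X))
  have hF : ∀ x, MemLp (fun ω => inner ℝ (t x) (b - h.coef) + w x ω) 2 Q := fun x =>
    memLp_const_add (hw x) _
  have hA : MemLp (fun ω => (inner ℝ (t xs) (b - h.coef) + w xs ω)
      - ∑ j, weights c h xs (nn c h.lengthscale hmn xs X) j
        * (inner ℝ (t (nn c h.lengthscale hmn xs X j)) (b - h.coef)
            + w (nn c h.lengthscale hmn xs X j) ω)) 2 Q :=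
    (hF xs).sub (memLp_finsetSum _ fun j _ => (hF _).const_mul _)
  have key := integral_sq_add_of_centred hA h1 h2
  rw [h3] at key
  refine Eq.trans ?_ key
  unfold mseNNGP
  congr 1
  funext z
  rw [sub_muNNGP_eq t b hmn h xs X (fun x => w x z.1) z.2.1 z.2.2]

end Field

end MSE

/-! ### Bounds on the derivatives -/

section Bounds

variable {d m n dT : ℕ} {c : Pt d → Pt d → ℝ} {p Lc : ℝ}
  {H : Type*} [NormedAddCommGroup H]

/-- `ψ` is bounded by `B` and satisfies a truncated Hölder condition of order `γ`. -/
structure TruncHolder (ψ : Pt d → H) (B N γ : ℝ) : Prop where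
  norm_le : ∀ x, ‖ψ x‖ ≤ B
  norm_sub_le : ∀ x y, ‖ψ x - ψ y‖ ≤ N * (min 1 ‖x - y‖) ^ γ

lemma TruncHolder.bound_nonneg {ψ : Pt d → H} {B N γ : ℝ} (h : TruncHolder ψ B N γ) : 0 ≤ B :=
  (norm_nonneg _).trans (h.norm_le 0)

lemma TruncHolder.continuous {ψ : Pt d → H} {B N γ : ℝ} (h : TruncHolder ψ B N γ) (hγ : 0 < γ) :
    Continuous ψ := by
  rw [continuous_iff_continuousAt]
  intro x
  rw [ContinuousAt, tendsto_iff_norm_sub_tendsto_zero]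
  refine squeeze_zero (fun _ => norm_nonneg _) (fun y => h.norm_sub_le y x) ?_
  have hc : Continuous fun y : Pt d => N * (min 1 ‖y - x‖) ^ γ :=
    continuous_const.mul ((continuous_const.min (continuous_id.sub continuous_const).norm).rpow_const
      fun _ => Or.inr hγ.le)
  simpa [Real.zero_rpow hγ.ne'] using hc.tendsto x

/-- Truncation at one lets exponents be lowered at all distances, so different Hölder orders can be
merged into their minimum. -/
lemma min_one_rpow_anti {x a b : ℝ} (hx : 0 ≤ x) (ha : 0 ≤ a) (hab : a ≤ b) :
    (min 1 x) ^ b ≤ (min 1 x) ^ a :=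
  Real.rpow_le_rpow_of_exponent_ge' (le_min zero_le_one hx) (min_le_left _ _) ha hab

lemma min_one_rpow_mono {x y a : ℝ} (hx : 0 ≤ x) (hxy : x ≤ y) (ha : 0 ≤ a) :
    (min 1 x) ^ a ≤ (min 1 y) ^ a :=
  Real.rpow_le_rpow (le_min zero_le_one hx) (min_le_min_left 1 hxy) ha

/-- A quantity that is bounded, and bounded by a power, is bounded by the truncated power. -/
lemma le_mul_min_one_rpow {u x q A B : ℝ} (hx : 0 ≤ x) (hA : 0 ≤ A) (hB : 0 ≤ B)
    (h1 : u ≤ A) (h2 : u ≤ B * x ^ q) : u ≤ (A + B) * (min 1 x) ^ q := by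
  rcases le_total 1 x with h | h
  · rw [min_eq_left h, Real.one_rpow]; linarith
  · rw [min_eq_right h]
    have := mul_nonneg hA (Real.rpow_nonneg hx q)
    linarith

/-- The kernel deviation of the nearest neighbours, in terms of the truncated radius. -/
lemma RegressionKernel.exists_kernel_deviation (hc : RegressionKernel c p Lc) (hp : 0 < p)
    (hLc : 0 < Lc) {l : ℝ} (hl : 0 < l) (hm : 1 ≤ m) (hmn : m ≤ n)
    (z : Pt d × (Fin n → Pt d)) :
    ∃ ε, 0 ≤ ε ∧ ε ≤ 1 ∧ (∀ j, 1 - corrStar c l z.1 (nn c l hmn z.1 z.2) j ≤ ε) ∧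
      ε ≤ (1 + Lc * (l⁻¹) ^ (2 * p)) * (min 1 (nnRadius c l hm hmn z)) ^ (2 * p) := by
  have hδ := nnRadius_nonneg c l hm hmn z
  set δ := nnRadius c l hm hmn z with hδdef
  -- The cap at one is legitimate because the kernel is nonnegative.
  refine ⟨min 1 (Lc * (l⁻¹) ^ (2 * p) * δ ^ (2 * p)), le_min zero_le_one (by positivity),
    min_le_left _ _, fun j => le_min ?_ ?_, ?_⟩
  · have := hc.nonneg (l⁻¹ • z.1) (l⁻¹ • nn c l hmn z.1 z.2 j)
    simp only [corrStar]; linarith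
  · have h1 := hc.lower (l⁻¹ • z.1) (l⁻¹ • nn c l hmn z.1 z.2 j)
    rw [← smul_sub, norm_smul, Real.norm_of_nonneg (by positivity),
      Real.mul_rpow (by positivity) (norm_nonneg _)] at h1
    have h2 : ‖z.1 - nn c l hmn z.1 z.2 j‖ ^ (2 * p) ≤ δ ^ (2 * p) :=
      Real.rpow_le_rpow (norm_nonneg _) (hc.norm_sub_nn_le hl hm hmn z j) (by positivity)
    have h3 : Lc * (l⁻¹) ^ (2 * p) * ‖z.1 - nn c l hmn z.1 z.2 j‖ ^ (2 * p)
        ≤ Lc * (l⁻¹) ^ (2 * p) * δ ^ (2 * p) := by gcongr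
    simp only [corrStar]
    linarith
  · exact le_mul_min_one_rpow hδ zero_le_one (by positivity) (min_le_left _ _) (min_le_right _ _)

lemma TruncHolder.norm_nn_sub_le {ψ : Pt d → H} {B N γ : ℝ} (hψ : TruncHolder ψ B N γ)
    (hN : 0 ≤ N) (hγ : 0 ≤ γ) (hc : RegressionKernel c p Lc) {l : ℝ} (hl : 0 < l) (hm : 1 ≤ m)
    (hmn : m ≤ n) (z : Pt d × (Fin n → Pt d)) (j : Fin m) :
    ‖ψ (nn c l hmn z.1 z.2 j) - ψ z.1‖ ≤ N * (min 1 (nnRadius c l hm hmn z)) ^ γ := by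
  rw [norm_sub_rev]
  refine (hψ.norm_sub_le _ _).trans (mul_le_mul_of_nonneg_left ?_ hN)
  exact min_one_rpow_mono (norm_nonneg _) (hc.norm_sub_nn_le hl hm hmn z j) hγ

variable [InnerProductSpace ℝ H]

/-- Write `ψ j = ψ₀ + (ψ j - ψ₀)`. The constant part sees only the sum of the weights, which is of
order `ε`; the increments see the `ℓ¹` norm, at most `√m` times the Euclidean one. -/
lemma norm_sum_smul_le_of_smallWeights (hm : 1 ≤ m) {x : Fin m → ℝ} {K ε B η : ℝ}
    (hx : SmallWeights x K ε) (hK : 0 ≤ K) (hε : 0 ≤ ε) (hη : 0 ≤ η) {ψ₀ : H} {ψ : Fin m → H}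
    (h0 : ‖ψ₀‖ ≤ B) (hψ : ∀ j, ‖ψ j - ψ₀‖ ≤ η) :
    ‖∑ j, x j • ψ j‖ ≤ K * (1 + √m * √ε) * (B * ε + η) := by
  have hB : 0 ≤ B := (norm_nonneg _).trans h0
  have e : ∑ j, x j • ψ j = (x ⬝ᵥ 1) • ψ₀ + ∑ j, x j • (ψ j - ψ₀) := by
    simp only [smul_sub, Finset.sum_sub_distrib, ← Finset.sum_smul, dotProduct_one]
    abel
  have h1 : ‖(x ⬝ᵥ 1) • ψ₀‖ ≤ K * (ε * (1 + √m * √ε)) * B := by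
    rw [norm_smul, Real.norm_eq_abs]
    exact mul_le_mul hx.sum_le h0 (norm_nonneg _) (by positivity)
  have h2 : ‖∑ j, x j • (ψ j - ψ₀)‖ ≤ √m * (K * √ε) * η := by
    calc _ ≤ ∑ j, |x j| * η := norm_sum_le_of_le _ fun j _ => by
          rw [norm_smul, Real.norm_eq_abs]
          exact mul_le_mul_of_nonneg_left (hψ j) (abs_nonneg _)
      _ = (∑ j, |x j|) * η := by rw [Finset.sum_mul]
      _ ≤ √m * (K * √ε) * η := by
          refine mul_le_mul_of_nonneg_right ((sum_abs_le_sqrt_mul_l2 x).trans ?_) hη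
          exact mul_le_mul_of_nonneg_left hx.l2_le_sqrt (Real.sqrt_nonneg _)
  rw [e]
  refine (norm_add_le _ _).trans ((add_le_add h1 h2).trans ?_)
  have : 0 ≤ K * η := by positivity
  nlinarith

/-- The uniform average misses `ψ₀` by at most `η`; the deviation from uniform weights is covered by
the preceding bound. -/
lemma norm_sub_sum_smul_le (hm : 1 ≤ m) {v : Fin m → ℝ} {K ε B η : ℝ}
    (hx : SmallWeights (v - unif m) K ε) (hK : 1 ≤ K) (hε : 0 ≤ ε) (hη : 0 ≤ η) {ψ₀ : H}
    {ψ : Fin m → H} (h0 : ‖ψ₀‖ ≤ B) (hψ : ∀ j, ‖ψ j - ψ₀‖ ≤ η) :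
    ‖ψ₀ - ∑ j, v j • ψ j‖ ≤ 2 * K * (1 + √m * √ε) * (B * ε + η) := by
  have hB : 0 ≤ B := (norm_nonneg _).trans h0
  have hm0 : (m : ℝ) ≠ 0 := by positivity
  have h1 := norm_sum_smul_le_of_smallWeights hm hx (by linarith) hε hη h0 hψ
  have e : ψ₀ - ∑ j, v j • ψ j
      = -(∑ j, (v - unif m) j • ψ j) - ∑ j, (m : ℝ)⁻¹ • (ψ j - ψ₀) := by
    simp only [Pi.sub_apply, sub_smul, smul_sub, Finset.sum_sub_distrib, unif, Finset.sum_const,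
      Finset.card_univ, Fintype.card_fin]
    rw [← Nat.cast_smul_eq_nsmul ℝ, smul_smul, mul_inv_cancel₀ hm0, one_smul]
    abel
  have h2 : ‖∑ j, (m : ℝ)⁻¹ • (ψ j - ψ₀)‖ ≤ η := by
    calc _ ≤ ∑ _j : Fin m, (m : ℝ)⁻¹ * η := norm_sum_le_of_le _ fun j _ => by
          rw [norm_smul, Real.norm_eq_abs, abs_of_nonneg (by positivity)]
          exact mul_le_mul_of_nonneg_left (hψ j) (by positivity)
      _ = η := by simp; field_simp
  have h3 : η ≤ K * (1 + √m * √ε) * (B * ε + η) := by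
    have a1 : 1 ≤ K * (1 + √m * √ε) := by
      have : 0 ≤ √m * √ε := by positivity
      nlinarith
    have a2 : 0 ≤ B * ε := by positivity
    nlinarith
  rw [e]
  refine (norm_sub_le _ _).trans ?_
  rw [norm_neg]
  linarith

/-- The constant controlling the perturbation of the weights. -/
def weightConst (h : HyperParams dT) : ℝ :=
  4 * (1 + 4 * h.scale / h.noiseVar) ^ 2
    * (1 + h.noiseVar / h.scale + 1 / h.noiseVar + 1 / h.scale)

lemma one_le_weightConst {h : HyperParams dT} (hh : h.Admissible) : 1 ≤ weightConst h := by
  have h1 := hh.noiseVar_pos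
  have h2 := hh.scale_pos
  have a1 : 1 ≤ (1 + 4 * h.scale / h.noiseVar) ^ 2 := by
    have : 0 ≤ 4 * h.scale / h.noiseVar := by positivity
    nlinarith
  have a2 : 1 ≤ 1 + h.noiseVar / h.scale + 1 / h.noiseVar + 1 / h.scale := by
    have b1 : 0 ≤ h.noiseVar / h.scale := by positivity
    have b2 : 0 ≤ 1 / h.noiseVar := by positivity
    have b3 : 0 ≤ 1 / h.scale := by positivity
    linarith
  unfold weightConst
  nlinarith

lemma RegressionKernel.smallWeights (hc : RegressionKernel c p Lc) (hm : 1 ≤ m)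
    {h : HyperParams dT} (hh : h.Admissible) {xs : Pt d} {Z : Fin m → Pt d} {ε : ℝ}
    (hε0 : 0 ≤ ε) (hε1 : ε ≤ 1) (hε : ∀ j, 1 - corrStar c h.lengthscale xs Z j ≤ ε) :
    SmallWeights (weights c h xs Z - unif m) (weightConst h) ε ∧
      SmallWeights (weightsDeriv c h xs Z) (weightConst h) ε ∧
      |weights c h xs Z ⬝ᵥ weightsDeriv c h xs Z| ≤ weightConst h * ε :=
  (hc.nearConstant h.lengthscale xs Z hε).smallWeights hm hh.noiseVar_pos hh.scale_pos hε0 hε1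
    (hc.weights_solves hm hh.noiseVar_pos hh.scale_pos xs Z)
    (hc.weightsDeriv_solves hh.noiseVar_pos hh.scale_pos xs Z)

/-- The derivative in the noise variance of `‖ψ xs - ∑ v_j ψ (Z j)‖² + σ² (1 + |v|²)`. -/
def noiseDeriv (c : Pt d → Pt d → ℝ) (σ2 : ℝ) (ψ : Pt d → H) (h : HyperParams dT) (xs : Pt d)
    (Z : Fin m → Pt d) : ℝ :=
  2 * inner ℝ (ψ xs - ∑ j, weights c h xs Z j • ψ (Z j))
      (-∑ j, weightsDeriv c h xs Z j • ψ (Z j))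
    + σ2 * (2 * (weights c h xs Z ⬝ᵥ weightsDeriv c h xs Z))

theorem RegressionKernel.hasDerivAt_noiseVar (hc : RegressionKernel c p Lc) (hm : 1 ≤ m)
    {h : HyperParams dT} (hh : h.Admissible) (xs : Pt d) (Z : Fin m → Pt d) (ψ : Pt d → H)
    (σ2 : ℝ) {F : HyperParams dT → ℝ}
    (hF : ∀ s : ℝ, F { h with noiseVar := s }
      = ‖ψ xs - ∑ j, weights c { h with noiseVar := s } xs Z j • ψ (Z j)‖ ^ 2
        + σ2 * (1 + weights c { h with noiseVar := s } xs Z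
          ⬝ᵥ weights c { h with noiseVar := s } xs Z)) :
    HasDerivAt (fun s => F { h with noiseVar := s }) (noiseDeriv c σ2 ψ h xs Z) h.noiseVar := by
  have hw := hc.hasDerivAt_weights hm hh.noiseVar_pos hh.scale_pos xs Z
  simp only [hF]
  have h1 : HasDerivAt (fun s => ψ xs - ∑ j, weights c { h with noiseVar := s } xs Z j • ψ (Z j))
      (-∑ j, weightsDeriv c h xs Z j • ψ (Z j)) h.noiseVar := by
    have := (HasDerivAt.fun_sum (u := Finset.univ) fun j _ => (hw j).smul_const (ψ (Z j))).const_sub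
      (ψ xs)
    exact this
  have h2 : HasDerivAt (fun s => σ2 * (1 + weights c { h with noiseVar := s } xs Z
          ⬝ᵥ weights c { h with noiseVar := s } xs Z))
      (σ2 * (2 * (weights c h xs Z ⬝ᵥ weightsDeriv c h xs Z))) h.noiseVar := by
    refine HasDerivAt.const_mul _ (HasDerivAt.const_add _ ?_)
    have := HasDerivAt.fun_sum (u := Finset.univ) fun j _ => (hw j).mul (hw j)
    refine this.congr_deriv ?_
    rw [dotProduct, Finset.mul_sum]
    exact Finset.sum_congr rfl fun j _ => by ring
  exact h1.norm_sq.add h2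

/-- By `weights_scale`, near `h.scale` varying the scale amounts to varying the noise variance along
`s ↦ σ̂_ξ² σ̂_f² / s`; the factor is the derivative of this map. -/
theorem RegressionKernel.hasDerivAt_scale (hc : RegressionKernel c p Lc) (hm : 1 ≤ m)
    {h : HyperParams dT} (hh : h.Admissible) (xs : Pt d) (Z : Fin m → Pt d) (ψ : Pt d → H)
    (σ2 : ℝ) {F : HyperParams dT → ℝ}
    (hF : ∀ s : ℝ, F { h with noiseVar := s }
      = ‖ψ xs - ∑ j, weights c { h with noiseVar := s } xs Z j • ψ (Z j)‖ ^ 2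
        + σ2 * (1 + weights c { h with noiseVar := s } xs Z
          ⬝ᵥ weights c { h with noiseVar := s } xs Z))
    (hF' : ∀ s : ℝ, F { h with scale := s }
      = ‖ψ xs - ∑ j, weights c { h with scale := s } xs Z j • ψ (Z j)‖ ^ 2
        + σ2 * (1 + weights c { h with scale := s } xs Z
          ⬝ᵥ weights c { h with scale := s } xs Z)) :
    HasDerivAt (fun s => F { h with scale := s })
      (noiseDeriv c σ2 ψ h xs Z * (-(h.noiseVar / h.scale))) h.scale := by
  have hs := hh.scale_pos
  have e : (fun s => F { h with scale := s }) =ᶠ[nhds h.scale]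
      fun s => F { h with noiseVar := h.noiseVar * h.scale / s } := by
    filter_upwards [lt_mem_nhds hs] with s hs'
    rw [hF, hF', hc.weights_scale hm hh.noiseVar_pos hs xs Z hs']
  have e0 : h.noiseVar * h.scale / h.scale = h.noiseVar := by field_simp
  have h1 := hc.hasDerivAt_noiseVar hm hh xs Z ψ σ2 hF
  have h2 : HasDerivAt (fun s => h.noiseVar * h.scale / s) (-(h.noiseVar / h.scale)) h.scale := by
    have := (hasDerivAt_inv hs.ne').const_mul (h.noiseVar * h.scale)
    refine (this.congr_deriv ?_)
    field_simp
  rw [← e0] at h1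
  have h3 := h1.comp h.scale h2
  exact h3.congr_of_eventuallyEq e

/-- The residual and its derivative are of the same order `(1 + √(mε))(Bε + η)`, so their inner
product is quadratic in it; the isolated `ε` comes from the noise term `v ⬝ᵥ v'`. -/
theorem RegressionKernel.abs_noiseDeriv_le (hc : RegressionKernel c p Lc) (hm : 1 ≤ m)
    {h : HyperParams dT} (hh : h.Admissible) {xs : Pt d} {Z : Fin m → Pt d} {ε B η : ℝ}
    (hε0 : 0 ≤ ε) (hε1 : ε ≤ 1) (hε : ∀ j, 1 - corrStar c h.lengthscale xs Z j ≤ ε)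
    (hη : 0 ≤ η) {ψ : Pt d → H} (h0 : ‖ψ xs‖ ≤ B) (hψ : ∀ j, ‖ψ (Z j) - ψ xs‖ ≤ η) (σ2 : ℝ) :
    |noiseDeriv c σ2 ψ h xs Z|
      ≤ (8 * weightConst h ^ 2 + 2 * |σ2| * weightConst h)
        * ((1 + m * ε) * (B * ε + η) ^ 2 + ε) := by
  obtain ⟨h1, h2, h3⟩ := hc.smallWeights hm hh hε0 hε1 hε
  have hK := one_le_weightConst hh
  set K := weightConst h
  have hK0 : 0 ≤ K := by linarith
  have hB : 0 ≤ B := (norm_nonneg _).trans h0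
  have a1 := norm_sub_sum_smul_le hm h1 hK hε0 hη h0 hψ
  have a2 := norm_sum_smul_le_of_smallWeights hm h2 hK0 hε0 hη h0 hψ
  set e := ψ xs - ∑ j, weights c h xs Z j • ψ (Z j)
  set e' := ∑ j, weightsDeriv c h xs Z j • ψ (Z j)
  have a3 : |inner ℝ e (-e')| ≤ 4 * K ^ 2 * ((1 + m * ε) * (B * ε + η) ^ 2) := by
    have hme : (√m * √ε) ^ 2 = m * ε := by
      rw [mul_pow, Real.sq_sqrt (Nat.cast_nonneg m), Real.sq_sqrt hε0]
    calc |inner ℝ e (-e')| ≤ ‖e‖ * ‖e'‖ := by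
          simpa using abs_real_inner_le_norm e (-e')
      _ ≤ (2 * K * (1 + √m * √ε) * (B * ε + η)) * (K * (1 + √m * √ε) * (B * ε + η)) :=
          mul_le_mul a1 a2 (norm_nonneg _) ((norm_nonneg _).trans a1)
      _ = 2 * K ^ 2 * ((1 + √m * √ε) ^ 2 * (B * ε + η) ^ 2) := by ring
      _ ≤ 2 * K ^ 2 * ((2 * (1 + m * ε)) * (B * ε + η) ^ 2) := by
          gcongr
          nlinarith [sq_nonneg (1 - √m * √ε)]
      _ = _ := by ring
  set T := (1 + m * ε) * (B * ε + η) ^ 2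
  have hT : 0 ≤ T := by positivity
  rw [noiseDeriv]
  refine (abs_add_le _ _).trans ?_
  rw [abs_mul, abs_mul, abs_mul, abs_two]
  have a4 : |σ2| * (2 * |weights c h xs Z ⬝ᵥ weightsDeriv c h xs Z|) ≤ |σ2| * (2 * (K * ε)) := by
    gcongr
  have a5 : 0 ≤ |σ2| * K * T := by positivity
  have a6 : 0 ≤ K ^ 2 * ε := by positivity
  linarith

/-- With `y = min 1 x`, both `ε` and `y^γ` are `O(y^α)`, and the factor `M ε` contributes the extra
`y^{2p}`. -/
lemma quadratic_rate_le {x α γ E B N ε M : ℝ} (hx : 0 ≤ x) (hM : 0 ≤ M) (hp : 0 < p) (hα : 0 < α)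
    (hαp : α ≤ 2 * p) (hαγ : α ≤ γ) (hE : 0 ≤ E) (hB : 0 ≤ B) (hN : 0 ≤ N) (hε0 : 0 ≤ ε)
    (hε : ε ≤ E * (min 1 x) ^ (2 * p)) :
    (1 + M * ε) * (B * ε + N * (min 1 x) ^ γ) ^ 2
      ≤ (1 + E) * (B * E + N) ^ 2
        * ((min 1 x) ^ (2 * α) + M * (min 1 x) ^ (2 * (α + p))) := by
  set y := min 1 x with hy
  have hy0 : 0 ≤ y := le_min zero_le_one hx
  have h1 : B * ε + N * y ^ γ ≤ (B * E + N) * y ^ α := by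
    have a1 := min_one_rpow_anti hx hα.le hαp
    have a2 := min_one_rpow_anti hx hα.le hαγ
    calc B * ε + N * y ^ γ ≤ B * (E * y ^ α) + N * y ^ α := by
          gcongr
          exact hε.trans (by gcongr)
      _ = _ := by ring
  have h2 : (B * ε + N * y ^ γ) ^ 2 ≤ (B * E + N) ^ 2 * y ^ (2 * α) := by
    calc _ ≤ ((B * E + N) * y ^ α) ^ 2 := by gcongr
      _ = _ := by rw [mul_pow, ← Real.rpow_mul_natCast hy0]; congr 2; push_cast; ring
  have h3 : y ^ (2 * (α + p)) = y ^ (2 * p) * y ^ (2 * α) := by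
    rw [← Real.rpow_add_of_nonneg hy0 (by positivity) (by positivity)]; congr 1; ring
  rw [h3]
  calc (1 + M * ε) * (B * ε + N * y ^ γ) ^ 2
      ≤ (1 + M * (E * y ^ (2 * p))) * ((B * E + N) ^ 2 * y ^ (2 * α)) := by gcongr
    _ = (B * E + N) ^ 2 * (1 * y ^ (2 * α) + E * (M * (y ^ (2 * p) * y ^ (2 * α)))) := by ring
    _ ≤ (B * E + N) ^ 2 * ((1 + E) * y ^ (2 * α) + (1 + E) * (M * (y ^ (2 * p) * y ^ (2 * α)))) := by
        gcongr
        · linarith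
        · linarith
    _ = _ := by ring

/-- Measurability of the derivative of the mean squared error. -/
lemma RegressionKernel.measurable_noiseDeriv (hc : RegressionKernel c p Lc) (h : HyperParams dT)
    (hmn : m ≤ n) {ψ : Pt d → H} (hψ : Continuous ψ) (σ2 : ℝ) :
    Measurable fun z : Pt d × (Fin n → Pt d) =>
      noiseDeriv c σ2 ψ h z.1 (nn c h.lengthscale hmn z.1 z.2) := by
  have hZ : ∀ j, Measurable fun z : Pt d × (Fin n → Pt d) => nn c h.lengthscale hmn z.1 z.2 j :=
    hc.measurable_nn h.lengthscale hmn
  have hw := fun j => (hc.measurable_weights h measurable_fst hZ j).1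
  have hw' := fun j => (hc.measurable_weights h measurable_fst hZ j).2
  -- `H` carries no measurable structure, so the derivative is expanded into real inner products of
  -- values of the continuous `ψ`.
  have hin : ∀ {u v : Pt d × (Fin n → Pt d) → Pt d}, Measurable u → Measurable v →
      Measurable fun z => inner ℝ (ψ (u z)) (ψ (v z)) := fun {u v} hu hv => by
    have hcont : Continuous fun q : Pt d × Pt d => inner ℝ (ψ q.1) (ψ q.2) :=
      (hψ.comp continuous_fst).inner (hψ.comp continuous_snd)
    exact hcont.measurable.comp (hu.prodMk hv)
  simp only [noiseDeriv, inner_neg_right, inner_sub_left, inner_sum, sum_inner, inner_smul_left,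
    inner_smul_right, dotProduct, conj_trivial]
  refine ((Measurable.neg ?_).const_mul 2).add
    (((Finset.measurable_fun_sum _ fun j _ => (hw j).mul (hw' j)).const_mul 2).const_mul σ2)
  refine Finset.measurable_fun_sum _ fun j _ => (hw' j).mul ((hin measurable_fst (hZ j)).sub ?_)
  exact Finset.measurable_fun_sum _ fun k _ => (hw k).mul (hin (hZ k) (hZ j))

end Bounds

/-! ### Rates -/

section Rates

/-- The map `r ↦ d r / (d - r)` increases on `[0, d)`, so the condition at `4(α + p)` covers all
smaller orders. -/
lemma RateCondition.moment_condition {d : ℕ} {p α β : ℝ} (h : RateCondition d p α β) {r : ℝ}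
    (hr : 0 < r) (hr2 : r ≤ 4 * (α + p)) : r < d ∧ d * r / (d - r) < β := by
  obtain ⟨h1, h2⟩ := h
  refine ⟨by linarith, lt_of_le_of_lt ?_ h2⟩
  have e : (4 * d * (p + α) : ℝ) / (d - 4 * (p + α)) = d * (4 * (α + p)) / (d - 4 * (α + p)) := by
    congr 1 <;> ring
  rw [e]
  have hd : (0 : ℝ) ≤ d := Nat.cast_nonneg d
  have : 0 < (d : ℝ) - 4 * (α + p) := by linarith
  have hs : 0 ≤ α + p := by linarith
  gcongr

/-- A pointwise bound on the derivative by truncated nearest neighbour distances gives the rate. -/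
theorem exists_derivativeRate_of_bound {d dT : ℕ} {p α β M A : ℝ} (hp : 0 < p) (hα : 0 < α)
    (hA : 0 < A) (hR : RateCondition d p α β) :
    ∃ A₁ A₂ : ℝ, 0 < A₁ ∧ 0 < A₂ ∧
      ∀ (PX : Measure (Pt d)) [IsProbabilityMeasure PX], MomentBound PX β M →
      ∀ (c : Pt d → Pt d → ℝ) (Lc l : ℝ), RegressionKernel c p Lc → 0 < l →
      ∀ (m n : ℕ) (hm : 1 ≤ m) (hmn : m ≤ n)
        (mse : HyperParams dT → Pt d → (Fin n → Pt d) → ℝ) (h : HyperParams dT) (φ : Param),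
        (∀ xs X, HasParamDeriv (fun h' => mse h' xs X) h φ) →
        (Measurable fun z : Pt d × (Fin n → Pt d) => absDeriv (fun h' => mse h' z.1 z.2) h φ) →
        (∀ z : Pt d × (Fin n → Pt d), absDeriv (fun h' => mse h' z.1 z.2) h φ
          ≤ A * ((min 1 (nnRadius c l hm hmn z)) ^ (2 * α)
            + m * (min 1 (nnRadius c l hm hmn z)) ^ (2 * (α + p)))) →
        DerivativeRate PX m n mse h φ p α A₁ A₂ := by
  obtain ⟨r1, c1⟩ := hR.moment_condition (r := 2 * α) (by positivity) (by linarith)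
  obtain ⟨r2, c2⟩ := hR.moment_condition (r := 2 * (α + p)) (by positivity) (by linarith)
  obtain ⟨B₁, hB₁, hb₁⟩ := exists_nn_moment_bound (M := M) d (by positivity) r1 c1
  obtain ⟨B₂, hB₂, hb₂⟩ := exists_nn_moment_bound (M := M) d (by positivity) r2 c2
  have hd0 : (0 : ℝ) < d := lt_trans (by positivity) r1
  refine ⟨A * B₁, A * B₂, by positivity, by positivity, ?_⟩
  intro PX _ hM c Lc l hc hl m n hm hmn mse h φ hdiff hmeas hbound
  have hm0 : (0 : ℝ) < m := by exact_mod_cast hm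
  have hn0 : (0 : ℝ) < n := by exact_mod_cast hm.trans hmn
  set P := PX.prod (Measure.pi fun _ : Fin n => PX) with hP
  set δ : Pt d × (Fin n → Pt d) → ℝ := nnRadius c l hm hmn with hδ
  have hδm : Measurable δ := hc.measurable_nnRadius l hm hmn
  have hδ0 : ∀ z, 0 ≤ δ z := nnRadius_nonneg c l hm hmn
  have hδc := fun z t (ht : t < δ z) => hc.card_lt_of_lt_nnRadius hl hm hmn z ht
  have hD0 : ∀ z : Pt d × (Fin n → Pt d), 0 ≤ absDeriv (fun h' => mse h' z.1 z.2) h φ := fun z => by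
    cases φ <;> simp [absDeriv]
  -- Truncation makes integrability free; moments of the covariates enter only through the rate.
  have hint : ∀ r : ℝ, 0 ≤ r → Integrable (fun z => (min 1 (δ z)) ^ r) P := fun r hr => by
    refine Integrable.of_bound ((measurable_const.min hδm).pow_const r).aestronglyMeasurable 1
      (ae_of_all _ fun z => ?_)
    have h0 := le_min zero_le_one (hδ0 z)
    rw [Real.norm_of_nonneg (Real.rpow_nonneg h0 r)]
    exact Real.rpow_le_one h0 (min_le_left _ _) hr
  have hi1 := hint (2 * α) (by positivity)
  have hi2 := hint (2 * (α + p)) (by positivity)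
  have hiG : Integrable (fun z => A * ((min 1 (δ z)) ^ (2 * α)
      + m * (min 1 (δ z)) ^ (2 * (α + p)))) P := (hi1.add (hi2.const_mul _)).const_mul _
  have hiD : Integrable (fun z : Pt d × (Fin n → Pt d) =>
      absDeriv (fun h' => mse h' z.1 z.2) h φ) P :=
    hiG.mono' hmeas.aestronglyMeasurable (ae_of_all _ fun z => by
      rw [Real.norm_of_nonneg (hD0 z)]; exact hbound z)
  have hmain : ∫ z, absDeriv (fun h' => mse h' z.1 z.2) h φ ∂P
      ≤ A * B₁ * ((m : ℝ) / n) ^ (2 * α / d)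
        + A * B₂ * m * ((m : ℝ) / n) ^ (2 * (α + p) / d) := by
    refine (integral_mono hiD hiG hbound).trans ?_
    rw [integral_const_mul, integral_add hi1 (hi2.const_mul _), integral_const_mul]
    have e1 := hb₁ PX hM m n hm hmn δ hδm hδ0 hδc
    have e2 := hb₂ PX hM m n hm hmn δ hδm hδ0 hδc
    calc _ ≤ A * (B₁ * ((m : ℝ) / n) ^ (2 * α / d)
          + m * (B₂ * ((m : ℝ) / n) ^ (2 * (α + p) / d))) := by gcongr
      _ = _ := by ring
  refine ⟨hdiff, hiD, hmain, fun hmeq => hmain.trans ?_⟩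
  -- Both terms increase with `m`, so the upper bound provided by the floor suffices; at that size
  -- of `m` the two rates coincide.
  have hmle : (m : ℝ) ≤ (n : ℝ) ^ (2 * p / (2 * p + d)) := by
    rw [hmeq]; exact Nat.floor_le (by positivity)
  have hpd : 0 < 2 * p + d := by positivity
  have hmn' : (m : ℝ) / n ≤ (n : ℝ) ^ (-(d / (2 * p + d)) : ℝ) := by
    calc (m : ℝ) / n ≤ (n : ℝ) ^ (2 * p / (2 * p + d)) / n := by gcongr
      _ = (n : ℝ) ^ (2 * p / (2 * p + d)) / (n : ℝ) ^ (1 : ℝ) := by rw [Real.rpow_one]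
      _ = _ := by
        rw [← Real.rpow_sub hn0]; congr 1; field_simp; ring
  have f1 : ((m : ℝ) / n) ^ (2 * α / d) ≤ (n : ℝ) ^ (-(2 * α / (2 * p + d))) := by
    calc _ ≤ ((n : ℝ) ^ (-(d / (2 * p + d)) : ℝ)) ^ (2 * α / d) := by gcongr
      _ = _ := by rw [← Real.rpow_mul hn0.le]; congr 1; field_simp
  have f2 : m * ((m : ℝ) / n) ^ (2 * (α + p) / d) ≤ (n : ℝ) ^ (-(2 * α / (2 * p + d))) := by
    calc _ ≤ (n : ℝ) ^ (2 * p / (2 * p + d))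
          * ((n : ℝ) ^ (-(d / (2 * p + d)) : ℝ)) ^ (2 * (α + p) / d) := by gcongr
      _ = _ := by
        rw [← Real.rpow_mul hn0.le, ← Real.rpow_add hn0]; congr 1; field_simp; ring
  calc _ = A * B₁ * ((m : ℝ) / n) ^ (2 * α / d)
        + A * B₂ * (m * ((m : ℝ) / n) ^ (2 * (α + p) / d)) := by ring
    _ ≤ A * B₁ * (n : ℝ) ^ (-(2 * α / (2 * p + d)))
        + A * B₂ * (n : ℝ) ^ (-(2 * α / (2 * p + d))) := by gcongr
    _ = _ := by ring

end Rates

/-! ### Derivatives in the noise variance and the kernel scale -/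

section ScalarParams

variable {d m n dT : ℕ} {c : Pt d → Pt d → ℝ} {p Lc : ℝ}

/-- The rate constant of the kernel deviation. -/
def kernelConst (p Lc : ℝ) (h : HyperParams dT) : ℝ := 1 + Lc * (h.lengthscale⁻¹) ^ (2 * p)

lemma one_le_kernelConst (hLc : 0 < Lc) {h : HyperParams dT} (hh : h.Admissible) :
    1 ≤ kernelConst p Lc h := by
  have := hh.lengthscale_pos
  have h1 : 0 ≤ Lc * (h.lengthscale⁻¹) ^ (2 * p) := by positivity
  unfold kernelConst; linarith

/-- The constant in the pointwise bound on the derivative in a scalar hyper-parameter. -/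
def scalarConst (p Lc σ2 B N : ℝ) (h : HyperParams dT) : ℝ :=
  (1 + h.noiseVar / h.scale) * ((8 * weightConst h ^ 2 + 2 * |σ2| * weightConst h)
    * ((1 + kernelConst p Lc h) * (B * kernelConst p Lc h + N) ^ 2 + kernelConst p Lc h))

lemma scalarConst_pos (hLc : 0 < Lc) {h : HyperParams dT} (hh : h.Admissible) (σ2 B N : ℝ) :
    0 < scalarConst p Lc σ2 B N h := by
  have h1 := hh.noiseVar_pos
  have h2 := hh.scale_pos
  have h3 : 0 < weightConst h := zero_lt_one.trans_le (one_le_weightConst hh)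
  have h4 : 0 < kernelConst p Lc h := zero_lt_one.trans_le (one_le_kernelConst hLc hh)
  unfold scalarConst
  positivity

/-- Derivatives of a mean squared error of the form `‖ψ xs - ∑ v_j ψ (Z j)‖² + σ² (1 + |v|²)`
in a scalar hyper-parameter. -/
theorem RegressionKernel.scalar_param_bound {H : Type*} [NormedAddCommGroup H]
    [InnerProductSpace ℝ H] (hc : RegressionKernel c p Lc) (hp : 0 < p) (hLc : 0 < Lc) (hm : 1 ≤ m)
    (hmn : m ≤ n) {h : HyperParams dT} (hh : h.Admissible) {ψ : Pt d → H} {B N γ α σ2 : ℝ}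
    (hψ : TruncHolder ψ B N γ) (hN : 0 ≤ N) (hα : 0 < α) (hαp : α ≤ p) (hαγ : α ≤ γ)
    {mse : HyperParams dT → Pt d → (Fin n → Pt d) → ℝ}
    (hmse : ∀ h' : HyperParams dT, h'.lengthscale = h.lengthscale → h'.coef = h.coef → ∀ xs X,
      mse h' xs X = ‖ψ xs - ∑ j, weights c h' xs (nn c h'.lengthscale hmn xs X) j
            • ψ (nn c h'.lengthscale hmn xs X j)‖ ^ 2
        + σ2 * (1 + weights c h' xs (nn c h'.lengthscale hmn xs X)
            ⬝ᵥ weights c h' xs (nn c h'.lengthscale hmn xs X)))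
    {φ : Param} (hφ : φ ≠ Param.coef) :
    (∀ xs X, HasParamDeriv (fun h' => mse h' xs X) h φ) ∧
    (Measurable fun z : Pt d × (Fin n → Pt d) => absDeriv (fun h' => mse h' z.1 z.2) h φ) ∧
    ∀ z : Pt d × (Fin n → Pt d), absDeriv (fun h' => mse h' z.1 z.2) h φ
      ≤ scalarConst p Lc σ2 B N h
        * ((min 1 (nnRadius c h.lengthscale hm hmn z)) ^ (2 * α)
          + m * (min 1 (nnRadius c h.lengthscale hm hmn z)) ^ (2 * (α + p))) := by
  have hl := hh.lengthscale_pos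
  have hs := hh.noiseVar_pos
  have hF := hh.scale_pos
  have hnoise := fun xs X => hc.hasDerivAt_noiseVar hm hh xs (nn c h.lengthscale hmn xs X) ψ σ2
    (F := fun h' => mse h' xs X) fun s => hmse { h with noiseVar := s } rfl rfl xs X
  have hscale := fun xs X => hc.hasDerivAt_scale hm hh xs (nn c h.lengthscale hmn xs X) ψ σ2
    (F := fun h' => mse h' xs X) (fun s => hmse { h with noiseVar := s } rfl rfl xs X)
    fun s => hmse { h with scale := s } rfl rfl xs X
  have hψc : Continuous ψ := hψ.continuous (hα.trans_le hαγ)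
  have hmeas := hc.measurable_noiseDeriv h hmn hψc σ2
  have hbound : ∀ z : Pt d × (Fin n → Pt d),
      |noiseDeriv c σ2 ψ h z.1 (nn c h.lengthscale hmn z.1 z.2)|
        ≤ (8 * weightConst h ^ 2 + 2 * |σ2| * weightConst h)
          * ((1 + kernelConst p Lc h) * (B * kernelConst p Lc h + N) ^ 2 + kernelConst p Lc h)
          * ((min 1 (nnRadius c h.lengthscale hm hmn z)) ^ (2 * α)
            + m * (min 1 (nnRadius c h.lengthscale hm hmn z)) ^ (2 * (α + p))) := by
    intro z
    obtain ⟨ε, hε0, hε1, hε, hεE⟩ := hc.exists_kernel_deviation hp hLc hl hm hmn z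
    have hδ0 := nnRadius_nonneg c h.lengthscale hm hmn z
    have hE := one_le_kernelConst (p := p) hLc hh
    have hK := one_le_weightConst hh
    rw [← kernelConst] at hεE
    set δ := nnRadius c h.lengthscale hm hmn z
    set E := kernelConst p Lc h
    have hy0 : 0 ≤ min 1 δ := le_min zero_le_one hδ0
    have hη : 0 ≤ N * (min 1 δ) ^ γ := by positivity
    have hnn : ∀ j, ‖ψ (nn c h.lengthscale hmn z.1 z.2 j) - ψ z.1‖ ≤ N * (min 1 δ) ^ γ :=
      hψ.norm_nn_sub_le hN (hα.le.trans hαγ) hc hl hm hmn z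
    refine (hc.abs_noiseDeriv_le hm hh hε0 hε1 hε hη (hψ.norm_le z.1) hnn σ2).trans ?_
    rw [mul_assoc (8 * weightConst h ^ 2 + 2 * |σ2| * weightConst h)]
    refine mul_le_mul_of_nonneg_left ?_ (by positivity)
    have h1 := quadratic_rate_le hδ0 (Nat.cast_nonneg m) hp hα (by linarith) hαγ (by linarith)
      hψ.bound_nonneg hN hε0 hεE
    -- The noise term is of order `y^{2p}` with no square, which is why `α ≤ p` is required here.
    have h2 : ε ≤ E * ((min 1 δ) ^ (2 * α) + m * (min 1 δ) ^ (2 * (α + p))) := by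
      have h3 := min_one_rpow_anti hδ0 (a := 2 * α) (b := 2 * p) (by positivity) (by linarith)
      have h4 : 0 ≤ m * (min 1 δ) ^ (2 * (α + p)) := by positivity
      refine hεE.trans (mul_le_mul_of_nonneg_left (by linarith) (by linarith))
    refine (add_le_add h1 h2).trans_eq ?_
    ring
  have hr : 0 ≤ h.noiseVar / h.scale := by positivity
  have hconst : ∀ (z : Pt d × (Fin n → Pt d)) (x : ℝ), 0 ≤ x → x ≤ 1 + h.noiseVar / h.scale →
      x * |noiseDeriv c σ2 ψ h z.1 (nn c h.lengthscale hmn z.1 z.2)|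
        ≤ scalarConst p Lc σ2 B N h
          * ((min 1 (nnRadius c h.lengthscale hm hmn z)) ^ (2 * α)
            + m * (min 1 (nnRadius c h.lengthscale hm hmn z)) ^ (2 * (α + p))) := by
    intro z x hx0 hx
    rw [scalarConst, mul_assoc (1 + h.noiseVar / h.scale)]
    exact mul_le_mul hx (hbound z) (abs_nonneg _) (by positivity)
  cases φ with
  | noiseVar =>
    have e : ∀ z : Pt d × (Fin n → Pt d), absDeriv (fun h' => mse h' z.1 z.2) h Param.noiseVar
        = |noiseDeriv c σ2 ψ h z.1 (nn c h.lengthscale hmn z.1 z.2)| := fun z => by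
      rw [absDeriv, (hnoise z.1 z.2).deriv]
    refine ⟨fun xs X => (hnoise xs X).differentiableAt, ?_, fun z => ?_⟩
    · simp only [e]; exact hmeas.abs
    · rw [e, ← one_mul |_|]
      exact hconst z 1 zero_le_one (by linarith)
  | scale =>
    have e : ∀ z : Pt d × (Fin n → Pt d), absDeriv (fun h' => mse h' z.1 z.2) h Param.scale
        = h.noiseVar / h.scale * |noiseDeriv c σ2 ψ h z.1 (nn c h.lengthscale hmn z.1 z.2)| :=
      fun z => by
        rw [absDeriv, (hscale z.1 z.2).deriv, abs_mul, abs_neg, abs_of_nonneg hr, mul_comm]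
    refine ⟨fun xs X => (hscale xs X).differentiableAt, ?_, fun z => ?_⟩
    · simp only [e]; exact hmeas.abs.const_mul _
    · rw [e]
      exact hconst z _ hr (by linarith)
  | coef => exact absurd rfl hφ

end ScalarParams

/-! ### The response functions -/

section Responses

variable {d dT : ℕ}

lemma BoundedHolder.abs_sub_le {g : Pt d → ℝ} {B L q : ℝ} (hg : BoundedHolder g B L q)
    (hL : 0 ≤ L) (x y : Pt d) : |g x - g y| ≤ (2 * B + L) * (min 1 ‖x - y‖) ^ q := by
  have hB : 0 ≤ B := (abs_nonneg _).trans (hg.1 0)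
  refine le_mul_min_one_rpow (norm_nonneg _) (by positivity) hL ?_ (hg.2 x y)
  have h1 := hg.1 x
  have h2 := hg.1 y
  rw [abs_le] at h1 h2 ⊢
  constructor <;> linarith

lemma BoundedHolder.truncHolder {g : Pt d → ℝ} {B L q : ℝ} (hg : BoundedHolder g B L q)
    (hL : 0 ≤ L) : TruncHolder g B (2 * B + L) q where
  norm_le := hg.1
  norm_sub_le := hg.abs_sub_le hL

/-- Coordinatewise: each exponent is lowered to `q₀` and each Hölder constant is dominated by the
sum. The absolute value of `BT` covers the case of no coordinates. -/
lemma truncHolder_regressors {t : Pt d → EuclideanSpace ℝ (Fin dT)} {BT q₀ : ℝ} {L q : Fin dT → ℝ}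
    (ht : ∀ i, BoundedHolder (fun x => t x i) BT (L i) (q i)) (hL : ∀ i, 1 ≤ L i) (hq₀ : 0 ≤ q₀)
    (hq : ∀ i, q₀ ≤ q i) :
    TruncHolder t (√dT * |BT|) (√dT * (2 * |BT| + ∑ i, L i)) q₀ where
  norm_le x := l2_le_of_abs_le (x := (t x).ofLp) (fun i => ((ht i).1 x).trans (le_abs_self _))
    (abs_nonneg _)
  norm_sub_le x y := by
    have hL0 : ∀ i, 0 ≤ L i := fun i => zero_le_one.trans (hL i)
    have hS : 0 ≤ ∑ i, L i := Finset.sum_nonneg fun i _ => hL0 i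
    have hy : 0 ≤ min 1 ‖x - y‖ := le_min zero_le_one (norm_nonneg _)
    rw [mul_assoc]
    refine l2_le_of_abs_le (x := (t x - t y).ofLp) (fun i => ?_) (by positivity)
    refine ((ht i).abs_sub_le (hL0 i) x y).trans ?_
    have h1 := Finset.single_le_sum (fun i _ => hL0 i) (Finset.mem_univ i)
    have h2 := min_one_rpow_anti (norm_nonneg (x - y)) hq₀ (hq i)
    have h3 := le_abs_self BT
    exact mul_le_mul (by linarith) h2 (by positivity) (by positivity)

variable {Ω : Type*} [MeasurableSpace Ω] {Q : Measure Ω} {w : Pt d → Ω → ℝ} {k c : Pt d → Pt d → ℝ}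
  {l σw2 Lw q0 : ℝ}

lemma RandomField.memLp (hw : RandomField Q w k c l σw2 Lw q0) (x : Pt d) : MemLp (w x) 2 Q :=
  (hw.gaussian.hasGaussianLaw_eval x).memLp_two

lemma RandomField.integral_mul [IsProbabilityMeasure Q] (hw : RandomField Q w k c l σw2 Lw q0)
    (x y : Pt d) : ∫ ω, w x ω * w y ω ∂Q = k x y := by
  have h := covariance_eq_sub (hw.memLp x) (hw.memLp y)
  rw [hw.cov, hw.mean, zero_mul, sub_zero] at h
  exact h.symm

lemma RandomField.integral_sq [IsProbabilityMeasure Q] (hw : RandomField Q w k c l σw2 Lw q0)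
    (x : Pt d) : ∫ ω, w x ω ^ 2 ∂Q = σw2 := by
  simp only [sq]
  rw [hw.integral_mul, hw.diag]

lemma RandomField.integral_add_smul_sq [IsProbabilityMeasure Q]
    (hw : RandomField Q w k c l σw2 Lw q0) (x y : Pt d) (r : ℝ) :
    ∫ ω, (w x ω + r * w y ω) ^ 2 ∂Q = σw2 + 2 * r * k x y + r ^ 2 * σw2 := by
  have e : ∀ ω, (w x ω + r * w y ω) ^ 2
      = w x ω ^ 2 + 2 * r * (w x ω * w y ω) + r ^ 2 * w y ω ^ 2 := fun ω => by ring
  have h1 := (hw.memLp x).integrable_sq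
  have h2 : Integrable (fun ω => 2 * r * (w x ω * w y ω)) Q :=
    ((hw.memLp x).integrable_mul (hw.memLp y)).const_mul _
  have h3 := (hw.memLp y).integrable_sq.const_mul (r ^ 2)
  have h12 : Integrable (fun ω => w x ω ^ 2 + 2 * r * (w x ω * w y ω)) Q := h1.add h2
  simp only [e]
  rw [integral_add h12 h3, integral_add h1 h2, integral_const_mul, integral_const_mul,
    hw.integral_mul, hw.integral_sq, hw.integral_sq]

/-- The left side is the `L²` norm of the increment. Positivity of `E (w x + w y)²` bounds it by
`2√σw2`, and the lower bound on the covariance gives the Hölder part. -/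
lemma RandomField.sqrt_increment_le [IsProbabilityMeasure Q]
    (hw : RandomField Q w k c l σw2 Lw q0) (hLw : 0 < Lw) (hσ : 0 < σw2) (x y : Pt d) :
    √(2 * (σw2 - k x y)) ≤ (2 * √σw2 + √(2 * σw2 * Lw)) * (min 1 ‖x - y‖) ^ q0 := by
  refine le_mul_min_one_rpow (norm_nonneg _) (by positivity) (by positivity) ?_ ?_
  · have h0 : 0 ≤ ∫ ω, (w x ω + 1 * w y ω) ^ 2 ∂Q := integral_nonneg fun ω => sq_nonneg _
    rw [hw.integral_add_smul_sq] at h0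
    rw [Real.sqrt_le_left (by positivity), mul_pow, Real.sq_sqrt hσ.le]
    linarith
  · have h1 := hw.lower x y
    rw [le_div_iff₀ hσ] at h1
    have h2 : (‖x - y‖ ^ q0) ^ 2 = ‖x - y‖ ^ (2 * q0) := by
      rw [← Real.rpow_mul_natCast (norm_nonneg _)]; congr 1; push_cast; ring
    rw [Real.sqrt_le_left (by positivity), mul_pow, Real.sq_sqrt (by positivity), h2]
    linarith

/-- The NNGP response as an `L²`-valued function of the covariate. -/
def fieldLp (F : Pt d → Ω → ℝ) (hF : ∀ x, MemLp (F x) 2 Q) (x : Pt d) : Lp ℝ 2 Q :=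
  (hF x).toLp (F x)

/-- The centred field is orthogonal to constants in `L²`, so by Pythagoras the regression and field
parts can be estimated separately. -/
lemma truncHolder_fieldLp [IsProbabilityMeasure Q] (hw : RandomField Q w k c l σw2 Lw q0)
    (hLw : 0 < Lw) (hσ : 0 < σw2) {t : Pt d → EuclideanSpace ℝ (Fin dT)} {B N q₀ : ℝ}
    (ht : TruncHolder t B N q₀) (hN : 0 ≤ N) (hq0 : 0 < q0) (hq₀ : 0 < q₀)
    (e : EuclideanSpace ℝ (Fin dT)) (hF : ∀ x, MemLp (fun ω => inner ℝ (t x) e + w x ω) 2 Q) :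
    TruncHolder (fieldLp (fun x ω => inner ℝ (t x) e + w x ω) hF) (B * ‖e‖ + √σw2)
      (N * ‖e‖ + (2 * √σw2 + √(2 * σw2 * Lw))) (min q0 q₀) where
  norm_le x := by
    have h1 : |inner ℝ (t x) e| ≤ B * ‖e‖ := (abs_real_inner_le_norm _ _).trans
      (mul_le_mul_of_nonneg_right (ht.norm_le x) (norm_nonneg _))
    have h2 : ‖fieldLp (fun x ω => inner ℝ (t x) e + w x ω) hF x‖ ^ 2
        = |inner ℝ (t x) e| ^ 2 + √σw2 ^ 2 := by
      rw [fieldLp, norm_toLp_sq, integral_const_add_sq_of_centred (hw.memLp x) (hw.mean x),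
        hw.integral_sq, sq_abs, Real.sq_sqrt hσ.le]
    have h3 : ‖fieldLp (fun x ω => inner ℝ (t x) e + w x ω) hF x‖
        ≤ |inner ℝ (t x) e| + √σw2 := by
      refine (le_abs_self _).trans (abs_le_of_sq_le_sq ?_ (by positivity))
      have := mul_nonneg (abs_nonneg (inner ℝ (t x) e)) (Real.sqrt_nonneg σw2)
      rw [h2]; nlinarith
    linarith
  norm_sub_le x y := by
    have hk : 0 ≤ 2 * (σw2 - k x y) := by
      have h0 : 0 ≤ ∫ ω, (w x ω + -1 * w y ω) ^ 2 ∂Q := integral_nonneg fun ω => sq_nonneg _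
      rw [hw.integral_add_smul_sq] at h0
      linarith
    have hm0 : ∫ ω, (w x ω + -1 * w y ω) ∂Q = 0 := by
      rw [integral_add ((hw.memLp x).integrable one_le_two)
        (((hw.memLp y).integrable one_le_two).const_mul _), integral_const_mul, hw.mean, hw.mean]
      simp
    have h2 : ‖fieldLp (fun x ω => inner ℝ (t x) e + w x ω) hF x
          - fieldLp (fun x ω => inner ℝ (t x) e + w x ω) hF y‖ ^ 2
        = |inner ℝ (t x - t y) e| ^ 2 + √(2 * (σw2 - k x y)) ^ 2 := by
      have hmem : MemLp (fun ω => w x ω + -1 * w y ω) 2 Q :=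
        (hw.memLp x).add ((hw.memLp y).const_mul _)
      have h3 := integral_const_add_sq_of_centred hmem hm0 (inner ℝ (t x - t y) e)
      rw [hw.integral_add_smul_sq] at h3
      rw [fieldLp, fieldLp, ← MemLp.toLp_sub, norm_toLp_sq, sq_abs, Real.sq_sqrt hk]
      refine Eq.trans (integral_congr_ae (ae_of_all _ fun ω => ?_)) (h3.trans (by ring))
      simp only [Pi.sub_apply, inner_sub_left]
      ring
    have h3 : ‖fieldLp (fun x ω => inner ℝ (t x) e + w x ω) hF x
          - fieldLp (fun x ω => inner ℝ (t x) e + w x ω) hF y‖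
        ≤ |inner ℝ (t x - t y) e| + √(2 * (σw2 - k x y)) := by
      refine (le_abs_self _).trans (abs_le_of_sq_le_sq ?_ (by positivity))
      have := mul_nonneg (abs_nonneg (inner ℝ (t x - t y) e)) (Real.sqrt_nonneg (2 * (σw2 - k x y)))
      rw [h2]; nlinarith
    have h4 : |inner ℝ (t x - t y) e| ≤ N * ‖e‖ * (min 1 ‖x - y‖) ^ (min q0 q₀) := by
      refine (abs_real_inner_le_norm _ _).trans ?_
      have h5 := min_one_rpow_anti (norm_nonneg (x - y)) (lt_min hq0 hq₀).le (min_le_right q0 q₀)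
      calc _ ≤ N * (min 1 ‖x - y‖) ^ q₀ * ‖e‖ :=
            mul_le_mul_of_nonneg_right (ht.norm_sub_le x y) (norm_nonneg _)
        _ ≤ N * (min 1 ‖x - y‖) ^ (min q0 q₀) * ‖e‖ := by gcongr
        _ = _ := by ring
    have h6 : √(2 * (σw2 - k x y))
        ≤ (2 * √σw2 + √(2 * σw2 * Lw)) * (min 1 ‖x - y‖) ^ (min q0 q₀) := by
      refine (hw.sqrt_increment_le hLw hσ x y).trans ?_
      have h5 := min_one_rpow_anti (norm_nonneg (x - y)) (lt_min hq0 hq₀).le (min_le_left q0 q₀)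
      gcongr
    refine h3.trans ((add_le_add h4 h6).trans_eq ?_)
    ring

end Responses

/-! ### Derivatives in the regression coefficients -/

section Coefficients

variable {d m n dT : ℕ} {c : Pt d → Pt d → ℝ} {p Lc : ℝ}

lemma hasGradientAt_inner_sub_sq {V : Type*} [NormedAddCommGroup V] [InnerProductSpace ℝ V]
    [CompleteSpace V] (a b b₀ : V) (r : ℝ) :
    HasGradientAt (fun b' => inner ℝ a (b - b') ^ 2 + r) ((-2 * inner ℝ a (b - b₀)) • a) b₀ := by
  rw [hasGradientAt_iff_hasFDerivAt]
  have h1 : HasFDerivAt (fun b' => inner ℝ a (b - b')) (-(innerSL ℝ a)) b₀ := by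
    have h2 : (fun b' => inner ℝ a (b - b')) = fun b' => inner ℝ a b - innerSL ℝ a b' := by
      ext b'; simp [inner_sub_right]
    rw [h2]
    exact (innerSL ℝ a).hasFDerivAt.const_sub _
  refine ((h1.pow 2).add_const r).congr_fderiv ?_
  ext y
  simp

/-- The part of the prediction error that is due to the regression coefficients. -/
def coefResidual (c : Pt d → Pt d → ℝ) (t : Pt d → EuclideanSpace ℝ (Fin dT)) (hmn : m ≤ n)
    (h : HyperParams dT) (xs : Pt d) (X : Fin n → Pt d) : EuclideanSpace ℝ (Fin dT) :=
  t xs - ∑ j, weights c h xs (nn c h.lengthscale hmn xs X) j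
    • t (nn c h.lengthscale hmn xs X j)

/-- The constant in the pointwise bound on the gradient in the regression coefficients. -/
def coefConst (p Lc B N : ℝ) (b : EuclideanSpace ℝ (Fin dT)) (h : HyperParams dT) : ℝ :=
  (2 * ‖b - h.coef‖ + 1) * (8 * weightConst h ^ 2
    * ((1 + kernelConst p Lc h) * (B * kernelConst p Lc h + N) ^ 2 + 1))

/-- The outer summands `1` in the constant keep it positive even when `b = b̂` or `B` and `N`
vanish. -/
lemma coefConst_pos (hLc : 0 < Lc) {h : HyperParams dT} (hh : h.Admissible) (B N : ℝ)
    (b : EuclideanSpace ℝ (Fin dT)) : 0 < coefConst p Lc B N b h := by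
  have h3 : 0 < weightConst h := zero_lt_one.trans_le (one_le_weightConst hh)
  have h4 : 0 < kernelConst p Lc h := zero_lt_one.trans_le (one_le_kernelConst hLc hh)
  unfold coefConst
  positivity

/-- The gradient is `-2 ⟨a, b - b̂⟩ a` with `a` the residual of predicting `t`, so it is quadratic
in `a`. The term `r` does not depend on the coefficients, hence `α` may reach `2p`. -/
theorem RegressionKernel.coef_param_bound (hc : RegressionKernel c p Lc) (hp : 0 < p)
    (hLc : 0 < Lc) (hm : 1 ≤ m) (hmn : m ≤ n) {h : HyperParams dT} (hh : h.Admissible)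
    {t : Pt d → EuclideanSpace ℝ (Fin dT)} {B N γ α : ℝ} (ht : TruncHolder t B N γ) (hN : 0 ≤ N)
    (hα : 0 < α) (hαp : α ≤ 2 * p) (hαγ : α ≤ γ) (b : EuclideanSpace ℝ (Fin dT))
    {mse : HyperParams dT → Pt d → (Fin n → Pt d) → ℝ} {r : Pt d → (Fin n → Pt d) → ℝ}
    (hmse : ∀ b' xs X, mse { h with coef := b' } xs X
      = inner ℝ (coefResidual c t hmn h xs X) (b - b') ^ 2 + r xs X) :
    (∀ xs X, HasParamDeriv (fun h' => mse h' xs X) h Param.coef) ∧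
    (Measurable fun z : Pt d × (Fin n → Pt d) =>
      absDeriv (fun h' => mse h' z.1 z.2) h Param.coef) ∧
    ∀ z : Pt d × (Fin n → Pt d), absDeriv (fun h' => mse h' z.1 z.2) h Param.coef
      ≤ coefConst p Lc B N b h
        * ((min 1 (nnRadius c h.lengthscale hm hmn z)) ^ (2 * α)
          + m * (min 1 (nnRadius c h.lengthscale hm hmn z)) ^ (2 * (α + p))) := by
  have hl := hh.lengthscale_pos
  have hgrad : ∀ xs X, HasGradientAt (fun b' => mse { h with coef := b' } xs X)
      ((-2 * inner ℝ (coefResidual c t hmn h xs X) (b - h.coef)) • coefResidual c t hmn h xs X)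
      h.coef := fun xs X => by
    simp only [hmse]
    exact hasGradientAt_inner_sub_sq _ _ _ _
  have e : ∀ z : Pt d × (Fin n → Pt d), absDeriv (fun h' => mse h' z.1 z.2) h Param.coef
      = 2 * |inner ℝ (coefResidual c t hmn h z.1 z.2) (b - h.coef)|
        * ‖coefResidual c t hmn h z.1 z.2‖ := fun z => by
    rw [absDeriv, (hgrad z.1 z.2).gradient, norm_smul, Real.norm_eq_abs, abs_mul, abs_neg, abs_two]
  have hZ : ∀ j, Measurable fun z : Pt d × (Fin n → Pt d) => nn c h.lengthscale hmn z.1 z.2 j :=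
    hc.measurable_nn h.lengthscale hmn
  have htm : Measurable t := (ht.continuous (hα.trans_le hαγ)).measurable
  have hres : Measurable fun z : Pt d × (Fin n → Pt d) => coefResidual c t hmn h z.1 z.2 :=
    (htm.comp measurable_fst).sub (Finset.measurable_fun_sum _ fun j _ =>
      (hc.measurable_weights h measurable_fst hZ j).1.smul (htm.comp (hZ j)))
  refine ⟨fun xs X => (hgrad xs X).differentiableAt, ?_, fun z => ?_⟩
  · simp only [e]
    exact ((hres.inner measurable_const).abs.const_mul 2).mul hres.norm
  obtain ⟨ε, hε0, hε1, hε, hεE⟩ := hc.exists_kernel_deviation hp hLc hl hm hmn z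
  have hδ0 := nnRadius_nonneg c h.lengthscale hm hmn z
  have hE := one_le_kernelConst (p := p) hLc hh
  have hK := one_le_weightConst hh
  rw [← kernelConst] at hεE
  have hsmall := (hc.smallWeights hm hh hε0 hε1 hε).1
  rw [e, coefConst]
  set δ := nnRadius c h.lengthscale hm hmn z
  set E := kernelConst p Lc h
  set K := weightConst h
  set a := coefResidual c t hmn h z.1 z.2 with ha
  have hy0 : 0 ≤ min 1 δ := le_min zero_le_one hδ0
  have hη : 0 ≤ N * (min 1 δ) ^ γ := by positivity
  have h1 : ‖a‖ ≤ 2 * K * (1 + √m * √ε) * (B * ε + N * (min 1 δ) ^ γ) :=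
    norm_sub_sum_smul_le hm hsmall hK hε0 hη (ht.norm_le z.1) fun j =>
      ht.norm_nn_sub_le hN (hα.le.trans hαγ) hc hl hm hmn z j
  have h2 := quadratic_rate_le hδ0 (Nat.cast_nonneg m) hp hα hαp hαγ (by linarith)
    ht.bound_nonneg hN hε0 hεE
  set T := (min 1 δ) ^ (2 * α) + m * (min 1 δ) ^ (2 * (α + p))
  have hT : 0 ≤ T := by positivity
  have h3 : ‖a‖ ^ 2 ≤ 8 * K ^ 2 * (((1 + E) * (B * E + N) ^ 2 + 1) * T) := by
    have hme : (√m * √ε) ^ 2 = m * ε := by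
      rw [mul_pow, Real.sq_sqrt (Nat.cast_nonneg m), Real.sq_sqrt hε0]
    calc ‖a‖ ^ 2 ≤ (2 * K * (1 + √m * √ε) * (B * ε + N * (min 1 δ) ^ γ)) ^ 2 := by gcongr
      _ = 4 * K ^ 2 * ((1 + √m * √ε) ^ 2 * (B * ε + N * (min 1 δ) ^ γ) ^ 2) := by ring
      _ ≤ 4 * K ^ 2 * (2 * (1 + m * ε) * (B * ε + N * (min 1 δ) ^ γ) ^ 2) := by
          gcongr
          nlinarith [sq_nonneg (1 - √m * √ε)]
      _ = 8 * K ^ 2 * ((1 + m * ε) * (B * ε + N * (min 1 δ) ^ γ) ^ 2) := by ring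
      _ ≤ 8 * K ^ 2 * (((1 + E) * (B * E + N) ^ 2 + 1) * T) := by
          refine mul_le_mul_of_nonneg_left ?_ (by positivity)
          linarith
  calc 2 * |inner ℝ a (b - h.coef)| * ‖a‖ ≤ 2 * (‖a‖ * ‖b - h.coef‖) * ‖a‖ := by
        gcongr
        exact abs_real_inner_le_norm _ _
    _ = 2 * ‖b - h.coef‖ * ‖a‖ ^ 2 := by ring
    _ ≤ (2 * ‖b - h.coef‖ + 1) * (8 * K ^ 2 * (((1 + E) * (B * E + N) ^ 2 + 1) * T)) := by
        refine mul_le_mul (by linarith) h3 (by positivity) (by positivity)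
    _ = _ := by ring

/-- The mean squared error of NNGP as a function of the regression coefficients. -/
lemma mseNNGP_coef_eq {Ω : Type*} [MeasurableSpace Ω] {Q : Measure Ω} [IsProbabilityMeasure Q]
    {Pξ : Measure ℝ} [IsProbabilityMeasure Pξ] {σ2 : ℝ} (hP : CentredNoise Pξ σ2)
    {w : Pt d → Ω → ℝ} (hw : ∀ x, MemLp (w x) 2 Q) (hw0 : ∀ x, ∫ ω, w x ω ∂Q = 0)
    (t : Pt d → EuclideanSpace ℝ (Fin dT)) (b b' : EuclideanSpace ℝ (Fin dT)) (hmn : m ≤ n)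
    (h : HyperParams dT) (xs : Pt d) (X : Fin n → Pt d) :
    mseNNGP Q w c t b Pξ hmn { h with coef := b' } xs X
      = inner ℝ (coefResidual c t hmn h xs X) (b - b') ^ 2
        + (∫ ω, (w xs ω - ∑ j, weights c h xs (nn c h.lengthscale hmn xs X) j
              * w (nn c h.lengthscale hmn xs X j) ω) ^ 2 ∂Q
          + σ2 * (1 + weights c h xs (nn c h.lengthscale hmn xs X)
            ⬝ᵥ weights c h xs (nn c h.lengthscale hmn xs X))) := by
  rw [mseNNGP_eq hP hw]
  have hweights : weights c { h with coef := b' } xs (nn c h.lengthscale hmn xs X)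
      = weights c h xs (nn c h.lengthscale hmn xs X) := rfl
  simp only [hweights, coefResidual]
  generalize nn c h.lengthscale hmn xs X = Z
  generalize weights c h xs Z = v
  have hs : MemLp (fun ω => ∑ j, v j * w (Z j) ω) 2 Q :=
    memLp_finsetSum _ fun j _ => (hw _).const_mul _
  have hN : MemLp (fun ω => w xs ω - ∑ j, v j * w (Z j) ω) 2 Q := (hw xs).sub hs
  have hN0 : ∫ ω, (w xs ω - ∑ j, v j * w (Z j) ω) ∂Q = 0 := by
    rw [integral_sub ((hw xs).integrable one_le_two) (hs.integrable one_le_two),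
      integral_finsetSum _ fun j _ => ((hw (Z j)).integrable one_le_two).const_mul _]
    simp [integral_const_mul, hw0]
  rw [← add_assoc, ← integral_const_add_sq_of_centred hN hN0]
  congr 2
  funext ω
  rw [inner_sub_left, sum_inner]
  simp only [inner_smul_left, conj_trivial, mul_add, Finset.sum_add_distrib]
  ring

end Coefficients

/-! ### Rates for the two estimators, and the theorem. -/

theorem exists_rate_GPnn (d dT : ℕ) (p Lc σξ2 β M : ℝ) (hp : 0 < p) (hLc : 0 < Lc)
    (h : HyperParams dT) (hh : h.Admissible) (φ : Param) (q Bf Lf : ℝ) (hq : 0 < q)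
    (hBf : 1 ≤ Bf) (hLf : 1 ≤ Lf) (hR : RateCondition d p (alphaGPnn p q) β) :
    ∃ A₁ A₂ : ℝ, 0 < A₁ ∧ 0 < A₂ ∧
      ∀ (PX : Measure (Pt d)) (Pξ : Measure ℝ) (c : Pt d → Pt d → ℝ) (f : Pt d → ℝ),
        IsProbabilityMeasure PX → IsProbabilityMeasure Pξ →
        MomentBound PX β M → CentredNoise Pξ σξ2 →
        RegressionKernel c p Lc → BoundedHolder f Bf Lf q →
        ∀ (m n : ℕ) (_ : 1 ≤ m) (hmn : m ≤ n),
          DerivativeRate PX m n (mseGPnn c f Pξ hmn) h φ p (alphaGPnn p q) A₁ A₂ := by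
  have hα : 0 < alphaGPnn p q := lt_min hp hq
  -- The constant is fixed before the laws, the kernel, `f`, `m` and `n` are introduced, which gives
  -- the required uniformity.
  have hA := scalarConst_pos (p := p) hLc hh σξ2 Bf (2 * Bf + Lf)
  obtain ⟨A₁, A₂, hA₁, hA₂, hrate⟩ := exists_derivativeRate_of_bound (M := M) (dT := dT) hp hα hA hR
  refine ⟨A₁, A₂, hA₁, hA₂, ?_⟩
  intro PX Pξ c f _ _ hM hP hc hf m n hm hmn
  by_cases hφ : φ = Param.coef
  · subst hφ
    -- The GPnn predictor does not involve the regression coefficients.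
    have hD : ∀ z : Pt d × (Fin n → Pt d),
        absDeriv (fun h' => mseGPnn c f Pξ hmn h' z.1 z.2) h Param.coef = 0 := fun z => by
      have : (fun b : EuclideanSpace ℝ (Fin dT) => mseGPnn c f Pξ hmn { h with coef := b } z.1 z.2)
          = fun _ => mseGPnn c f Pξ hmn h z.1 z.2 := rfl
      rw [absDeriv, this, gradient_fun_const, norm_zero]
    refine hrate PX hM c Lc h.lengthscale hc hh.lengthscale_pos m n hm hmn _ h Param.coef
      (fun xs X => differentiableAt_const (mseGPnn c f Pξ hmn h xs X)) ?_ fun z => ?_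
    · simp only [hD]; exact measurable_const
    · rw [hD]
      have h0 := le_min zero_le_one (nnRadius_nonneg c h.lengthscale hm hmn z)
      positivity
  · obtain ⟨h1, h2, h3⟩ := hc.scalar_param_bound hp hLc hm hmn hh
      (hf.truncHolder (zero_le_one.trans hLf)) (by linarith) hα (min_le_left _ _)
      (min_le_right _ _) (mse := mseGPnn c f Pξ hmn) (fun h' _ _ xs X => mseGPnn_eq hP f hmn h' xs X)
      hφ
    exact hrate PX hM c Lc h.lengthscale hc hh.lengthscale_pos m n hm hmn _ h φ h1 h2 h3

theorem exists_rate_NNGP (d dT : ℕ) (p Lc σξ2 β M : ℝ) (hp : 0 < p) (hLc : 0 < Lc)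
    (h : HyperParams dT) (hh : h.Admissible) (φ : Param) (q0 : ℝ) (q L : Fin dT → ℝ)
    (BT Lw σw2 : ℝ) (b : EuclideanSpace ℝ (Fin dT)) (hdT : 0 < dT) (hq0 : 0 < q0)
    (hq : ∀ i, 0 < q i) (hL : ∀ i, 1 ≤ L i) (hLw : 0 < Lw) (hσ : 0 < σw2)
    (hR : RateCondition d p (alphaNNGP p q0 q φ) β) :
    ∃ A₁ A₂ : ℝ, 0 < A₁ ∧ 0 < A₂ ∧
      ∀ (PX : Measure (Pt d)) (Pξ : Measure ℝ) (c k : Pt d → Pt d → ℝ)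
        (t : Pt d → EuclideanSpace ℝ (Fin dT))
        (Ω : Type*) (_ : MeasurableSpace Ω) (Q : Measure Ω) (w : Pt d → Ω → ℝ),
        IsProbabilityMeasure PX → IsProbabilityMeasure Pξ → IsProbabilityMeasure Q →
        MomentBound PX β M → CentredNoise Pξ σξ2 →
        RegressionKernel c p Lc → (∀ i, BoundedHolder (fun x => t x i) BT (L i) (q i)) →
        RandomField Q w k c h.lengthscale σw2 Lw q0 →
        ∀ (m n : ℕ) (_ : 1 ≤ m) (hmn : m ≤ n),
          DerivativeRate PX m n (mseNNGP Q w c t b Pξ hmn) h φ p (alphaNNGP p q0 q φ) A₁ A₂ := by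
  have : Nonempty (Fin dT) := ⟨⟨0, hdT⟩⟩
  have hqle : ∀ i, ⨅ i, q i ≤ q i := fun i => ciInf_le (Set.finite_range q).bddBelow i
  have hq₀ : 0 < ⨅ i, q i := by
    obtain ⟨i, hi⟩ := exists_eq_ciInf_of_finite (f := q)
    rw [← hi]; exact hq i
  set q₀ := ⨅ i, q i with hq₀def
  have hS : 0 ≤ ∑ i, L i := Finset.sum_nonneg fun i _ => zero_le_one.trans (hL i)
  set B := √dT * |BT| with hB
  set N := √dT * (2 * |BT| + ∑ i, L i) with hN
  have hN0 : 0 ≤ N := by positivity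
  by_cases hφ : φ = Param.coef
  · subst hφ
    have hα : 0 < alphaNNGP p q0 q Param.coef := lt_min (by positivity) hq₀
    have hA := coefConst_pos (p := p) hLc hh B N b
    obtain ⟨A₁, A₂, hA₁, hA₂, hrate⟩ :=
      exists_derivativeRate_of_bound (M := M) (dT := dT) hp hα hA hR
    refine ⟨A₁, A₂, hA₁, hA₂, ?_⟩
    intro PX Pξ c k t Ω _ Q w _ _ _ hM hP hc ht hw m n hm hmn
    obtain ⟨h1, h2, h3⟩ := hc.coef_param_bound hp hLc hm hmn hh
      (truncHolder_regressors ht hL hq₀.le hqle) hN0 hα (min_le_left _ _) (min_le_right _ _) b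
      (mse := mseNNGP Q w c t b Pξ hmn)
      (fun b' xs X => mseNNGP_coef_eq hP hw.memLp hw.mean t b b' hmn h xs X)
    exact hrate PX hM c Lc h.lengthscale hc hh.lengthscale_pos m n hm hmn _ h Param.coef h1 h2 h3
  · have hαeq : alphaNNGP p q0 q φ = min p (min q0 q₀) := by
      cases φ with
      | noiseVar => rfl
      | scale => rfl
      | coef => exact absurd rfl hφ
    rw [hαeq] at hR ⊢
    have hα : 0 < min p (min q0 q₀) := lt_min hp (lt_min hq0 hq₀)
    have hA := scalarConst_pos (p := p) hLc hh σξ2 (B * ‖b - h.coef‖ + √σw2)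
      (N * ‖b - h.coef‖ + (2 * √σw2 + √(2 * σw2 * Lw)))
    obtain ⟨A₁, A₂, hA₁, hA₂, hrate⟩ :=
      exists_derivativeRate_of_bound (M := M) (dT := dT) hp hα hA hR
    refine ⟨A₁, A₂, hA₁, hA₂, ?_⟩
    intro PX Pξ c k t Ω _ Q w _ _ _ hM hP hc ht hw m n hm hmn
    -- These `L²` classes form `ψ`. It involves `b̂`, so the error has the common form only along
    -- hyper-parameters with the same coefficients, which is enough for scalar derivatives.
    have hF : ∀ x, MemLp (fun ω => inner ℝ (t x) (b - h.coef) + w x ω) 2 Q := fun x =>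
      memLp_const_add (hw.memLp x) _
    obtain ⟨h1, h2, h3⟩ := hc.scalar_param_bound hp hLc hm hmn hh
      (truncHolder_fieldLp hw hLw hσ (truncHolder_regressors ht hL hq₀.le hqle) hN0 hq0 hq₀
        (b - h.coef) hF) (by positivity) hα (min_le_left _ _)
      (min_le_right _ _) (mse := mseNNGP Q w c t b Pξ hmn) (σ2 := σξ2) (fun h' _ hcoef xs X => by
        rw [mseNNGP_eq hP hw.memLp, hcoef, ← norm_sub_sum_toLp_sq hF]
        rfl) hφ
    exact hrate PX hM c Lc h.lengthscale hc hh.lengthscale_pos m n hm hmn _ h φ h1 h2 h3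

end GPNN

end

theorem theorem8 (d dT : ℕ) (p Lc σξ2 β M : ℝ) (hp : 0 < p) (hp1 : p ≤ 1) (hLc : 0 < Lc)
    (h : GPNN.HyperParams dT) (hh : h.Admissible) (φ : GPNN.Param) :
    -- GPnn
    (∀ (q Bf Lf : ℝ), 0 < q → q ≤ 1 → 1 ≤ Bf → 1 ≤ Lf →
      GPNN.RateCondition d p (GPNN.alphaGPnn p q) β →
      ∃ A₁ A₂ : ℝ, 0 < A₁ ∧ 0 < A₂ ∧
        ∀ (PX : Measure (GPNN.Pt d)) (Pξ : Measure ℝ) (c : GPNN.Pt d → GPNN.Pt d → ℝ)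
          (f : GPNN.Pt d → ℝ),
          IsProbabilityMeasure PX → IsProbabilityMeasure Pξ →
          GPNN.MomentBound PX β M → GPNN.CentredNoise Pξ σξ2 →
          GPNN.RegressionKernel c p Lc → GPNN.BoundedHolder f Bf Lf q →
          ∀ (m n : ℕ) (_ : 1 ≤ m) (hmn : m ≤ n),
            GPNN.DerivativeRate PX m n (GPNN.mseGPnn c f Pξ hmn) h φ p (GPNN.alphaGPnn p q) A₁ A₂)
    ∧
    -- NNGP
    (∀ (q0 : ℝ) (q L : Fin dT → ℝ) (BT Lw σw2 : ℝ) (b : EuclideanSpace ℝ (Fin dT)),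
      0 < dT → 0 < q0 → (∀ i, 0 < q i ∧ q i ≤ 1) → (∀ i, 1 ≤ L i) → 0 < Lw → 0 < σw2 →
      GPNN.RateCondition d p (GPNN.alphaNNGP p q0 q φ) β →
      ∃ A₁ A₂ : ℝ, 0 < A₁ ∧ 0 < A₂ ∧
        ∀ (PX : Measure (GPNN.Pt d)) (Pξ : Measure ℝ) (c k : GPNN.Pt d → GPNN.Pt d → ℝ)
          (t : GPNN.Pt d → EuclideanSpace ℝ (Fin dT))
          (Ω : Type*) (_ : MeasurableSpace Ω) (Q : Measure Ω) (w : GPNN.Pt d → Ω → ℝ),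
          IsProbabilityMeasure PX → IsProbabilityMeasure Pξ → IsProbabilityMeasure Q →
          GPNN.MomentBound PX β M → GPNN.CentredNoise Pξ σξ2 →
          GPNN.RegressionKernel c p Lc → (∀ i, GPNN.BoundedHolder (fun x => t x i) BT (L i) (q i)) →
          GPNN.RandomField Q w k c h.lengthscale σw2 Lw q0 →
          ∀ (m n : ℕ) (_ : 1 ≤ m) (hmn : m ≤ n),
            GPNN.DerivativeRate PX m n (GPNN.mseNNGP Q w c t b Pξ hmn) h φ p
              (GPNN.alphaNNGP p q0 q φ) A₁ A₂) := by
  refine ⟨fun q Bf Lf hq _ hBf hLf hR => ?_, fun q0 q L BT Lw σw2 b hdT hq0 hq hL hLw hσ hR => ?_⟩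
  · exact GPNN.exists_rate_GPnn d dT p Lc σξ2 β M hp hLc h hh φ q Bf Lf hq hBf hLf hR
  · exact GPNN.exists_rate_NNGP d dT p Lc σξ2 β M hp hLc h hh φ q0 q L BT Lw σw2 b hdT hq0
      (fun i => (hq i).1) hL hLw hσ hR
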